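/- **Setting.** Let $d\in\{2,3\}$ and let $v:\mathbb R^d\to[0,\infty)$ be a radial function in $L^2$, supported in the ball of radius $R>0$. Let $a>0$ be its scattering length and $\varphi^0$ its scattering solution: $-\Delta\varphi^0+\tfrac12 v\varphi^0=0$ in the sense of distributions on $\mathbb R^d$, where for $|x|\ge R$ we have $\varphi^0(x)=\log(|x|/a)$ if $d=2$ and $\varphi^0(x)=1-a/|x|$ if $d=3$. Let $\rho>0$ and put $$\delta=\frac1{\big|\log(\rho a^2|\log(\rho a^2)|^{-1})\big|},\qquad \varphi=2\delta\varphi^0\ (d=2),\qquad \varphi=\varphi^0\ (d=3),\qquad \omega=1-\varphi,\qquad g=v\varphi,$$ with $\widehat f(k)=\int_{\mathbb R^d}e^{-ik\cdot x}f(x)\,dx$. Put $s=\delta$, $\lambda=\delta$ if $d=2$, and $s=\rho a^3$, $\lambda=\sqrt{\rho a^3}$ if $d=3$. Let $K_\ell,K_L,K_H,\mathcal M$ be real and $\varepsilon_K,\varepsilon_{\rm gap}>0$. Put $\ell=K_\ell/\sqrt{\rho\widehat g(0)}$, $\Lambda=[-\ell/2,\ell/2]^d$ (as a torus), $|\Lambda|=\ell^d$,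 $N=\rho\ell^d$, $\Lambda^*=\frac{2\pi}{\ell}\mathbb Z^d$, $\mathcal P_L=\{p\in\Lambda^*:0<|p|\le K_L/\ell\}$, $\mathcal P_H=\{k\in\Lambda^*:|k|\ge K_H/\ell\}$. Fix constants $c,\zeta>0$ and write $A\ll B$ for $A\le c\,s^{\zeta}B$. We assume the following relations: * $\varepsilon_K,\varepsilon_{\rm gap}\ll1\ll\mathcal M,K_\ell,K_L,K_H$ and $K_\ell\ll K_\ell^4\ll K_L\ll K_H$; * $\ell\rho^{1/2}K_H^{1/2}\|v\|_1^{1/2}\ll\mathcal M$ and $\ell^2\rho^2|\Lambda|\widehat g(0)\lambda\ll\mathcal M$; * $\frac{\mathcal M}N\ll(K_\ell/K_L)^4\ll1$ and $\frac{\mathcal M}NK_H^d\ll1$; * $\ell^{8-d}\rho^3\widehat g(0)^4K_H^{-8}K_L^d\mathcal M\ll\varepsilon_K^2$ and $\ell^{4-d}\rho\,\widehat g(0)^2K_H^{-2}K_L^d\mathcal M\ll K_\ell^2$; * $\rho^3\widehat g(0)^4\ell^{8-d}K_H^{d-6}\ll\varepsilon_{\rm gap}$, $\ \varepsilon_K\ell^2\rho\widehat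 g(0)+\mathcal E_d\ell^2\rho+K_\ell^2K_H^{-1}\ll\varepsilon_{\rm gap}$ and $\frac R\ell K_L\ell^2\rho\widehat g(0)\ll\varepsilon_{\rm gap}$, where $\mathcal E_3=\widehat g(0)^2K_H\ell^{-1}$ and $\mathcal E_2=R^2\ell_\delta^{-2}\widehat g(0)^2+\widehat g(0)^2|\log(K_H\ell_\delta\ell^{-1})|$ with $\ell_\delta=\frac a2e^{1/(2\delta)}e^{\Gamma}$ and $\Gamma$ the Euler–Mascheroni constant. We also assume $R\le\ell/4$. Let $a_k,a_k^\dagger$ be the bosonic annihilation and creation operators of the normalised plane waves $|\Lambda|^{-1/2}e^{ik\cdot x}$, $k\in\Lambda^*$, and let $\mathscr F_s(\mathrm{Ran}\,Q)$ be the subspace of the bosonic Fock space over $L^2(\Lambda)$ with no particle of momentum $0$. For $z\in\mathbb C$ put $\rho_z=|z|^2/|\Lambda|$ and $$\mathcal D_k=\sqrt{k^4+2k^2\rho_z\widehat g(k)},\qquad \alpha_k=\frac{k^2+\rho_z\widehat g(k)-\mathcal D_k}{\rho_z\widehat g(k)},\qquad b_k=\frac{a_k+\alpha_ka_{-k}^\dagger}{\sqrt{1-\alpha_k^2}}$$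 ($\alpha_k=0$ if $\widehat g(k)=0$), and $$\mathcal Q_3^{\rm soft}(z)=\frac1{|\Lambda|}\sum_{k\in\mathcal P_H,\,p\in\mathcal P_L}\widehat g(k)\big(\bar z\,a_p^\dagger a_{p-k}a_k+{\rm h.c.}\big),\qquad \mathcal K_H^{\rm diag}=\sum_{k\in\mathcal P_H}\mathcal D_kb_k^\dagger b_k,$$ $$\mathcal Q_2^{\rm ex}(z)=\rho_z\sum_{k\ne0}\big(\widehat{g\omega}(k)+\widehat{g\omega}(0)\big)a_k^\dagger a_k.$$ Let $n_+=\sum_{k\ne0}a_k^\dagger a_k$, and let $n_+^H$ and $n_+^L$ be the numbers of particles with $|k|>K_L/\ell$ and with $0<|k|<K_H/\ell$, respectively. **Proposition.** For $d\in\{2,3\}$ and all $c,\zeta>0$ there are constants $C,\eta>0$, depending only on $d,c,\zeta$, such that the following holds for all data as above. Let $\rho a^d\le C^{-1}$, let $z\in\mathbb C$ satisfy $|\rho_z-\rho|\le\frac12\rho$, and let $\Phi\in\mathscr F_s(\mathrm{Ran}\,Q)$ be a normalised state of finite kinetic energy, $\langle\sum_kk^2a_k^\dagger a_k\rangle_\Phi<\infty$,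 with $\Phi=\mathbb 1_{[0,\mathcal M]}(n_+^L)\Phi$. Then all the expectations below converge absolutely (term by term), and $$\big\langle\mathcal Q_3^{\rm soft}(z)+\mathcal K_H^{\rm diag}+\mathcal Q_2^{\rm ex}(z)\big\rangle_\Phi\ \ge\ -\varepsilon_{\rm gap}\frac{\langle n_+\rangle_\Phi}{\ell^2}-K_\ell^2\frac{\langle n_+^H\rangle_\Phi}{\ell^2}-C\,\mathfrak e,$$ where $\mathfrak e=\rho^2|\Lambda|\,\delta^{2+\eta}$ if $d=2$ and $\mathfrak e=\rho^2|\Lambda|\,a(\rho a^3)^{\frac12+\eta}$ if $d=3$. -/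

import Mathlib

noncomputable section

open scoped InnerProductSpace ContDiff

namespace SoftPairs

/-- Euclidean space `ℝ^d`. -/
abbrev Space (d : ℕ) := EuclideanSpace ℝ (Fin d)

/-- Momenta of the torus `[-ℓ/2, ℓ/2]^d` are `(2π/ℓ) m` with label `m ∈ ℤ^d`. -/
abbrev Mode (d : ℕ) := Fin d → ℤ

/-! ### The scattering problem -/

/-- `φ₀` is the scattering solution of the potential `v` supported in the ball of radius `R`, and
`a` is the scattering length: `-Δφ₀ + v φ₀ / 2 = 0` in the sense of distributions on `ℝ^d`, and for
`|x| ≥ R` one has `φ₀(x) = log (|x|/a)` if `d = 2`, `φ₀(x) = 1 - a/|x|` if `d = 3`.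
These conditions determine `a` and (almost everywhere) `φ₀` from `v`. -/
structure IsScatteringSolution (d : ℕ) (v : Space d → ℝ) (R a : ℝ) (φ₀ : Space d → ℝ) :
    Prop where
  locallyIntegrable : MeasureTheory.LocallyIntegrable φ₀
  locallyIntegrable_mul : MeasureTheory.LocallyIntegrable (fun x => v x * φ₀ x)
  equation : ∀ ψ : Space d → ℝ, ContDiff ℝ ∞ ψ → HasCompactSupport ψ →
    ∫ x, (-(φ₀ x * Laplacian.laplacian ψ x) + 1 / 2 * (v x * φ₀ x) * ψ x) = 0
  outside : ∀ x : Space d, R ≤ ‖x‖ →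
    φ₀ x = if d = 2 then Real.log (‖x‖ / a) else 1 - a / ‖x‖

/-- The data of the dilute Bose gas: interaction potential `v` on `ℝ^d`, radius `R` of a ball
containing its support, scattering length `a`, scattering solution `φ₀`, density `ρ`. -/
structure BoseGas (d : ℕ) where
  v : Space d → ℝ
  R : ℝ
  a : ℝ
  φ₀ : Space d → ℝ
  ρ : ℝ

/-- The auxiliary parameters `K_ℓ, K_L, K_H, 𝓜, ε_K, ε_gap`. -/
structure Params where
  Kell : ℝ
  KL : ℝ
  KH : ℝ
  M : ℝ
  εK : ℝ
  εgap : ℝ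

/-- Standing assumptions: `v` is a nonnegative, radial, square integrable potential supported in
the ball of radius `R`, with scattering length `a > 0` and scattering solution `φ₀`; `ρ > 0`. -/
structure BoseGas.Admissible {d : ℕ} (G : BoseGas d) : Prop where
  nonneg : ∀ x, 0 ≤ G.v x
  radial : ∀ x y, ‖x‖ = ‖y‖ → G.v x = G.v y
  R_pos : 0 < G.R
  support_subset : Function.support G.v ⊆ Metric.closedBall 0 G.R
  memLp_two : MeasureTheory.MemLp G.v 2
  a_pos : 0 < G.a
  scattering : IsScatteringSolution d G.v G.R G.a G.φ₀
  ρ_pos : 0 < G.ρ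

/-- The real part of the Fourier transform `∫ e^{-ik·x} f(x) dx`. It is only applied to (a.e.)
radial functions, whose Fourier transform is real. -/
def fourier {d : ℕ} (f : Space d → ℝ) (k : Space d) : ℝ :=
  (∫ x : Space d, Complex.exp (-(Complex.I * ((⟪k, x⟫_ℝ : ℝ) : ℂ))) * (f x : ℂ)).re

section Gas

variable {d : ℕ} (G : BoseGas d)

/-- `δ = 1 / |log (ρ a² |log (ρ a²)|⁻¹)|`, used for `d = 2`. -/
def BoseGas.delta : ℝ :=
  1 / |Real.log (G.ρ * G.a ^ 2 * |Real.log (G.ρ * G.a ^ 2)|⁻¹)|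

/-- The normalised scattering solution: `2 δ φ₀` if `d = 2` (equal to `1` at distance
`a e^{1/(2δ)}`), and `φ₀` if `d = 3`. -/
def BoseGas.φ (x : Space d) : ℝ := if d = 2 then 2 * G.delta * G.φ₀ x else G.φ₀ x

/-- `ω = 1 - φ`. -/
def BoseGas.ω (x : Space d) : ℝ := 1 - G.φ x

/-- `g = v φ = v (1 - ω)`. -/
def BoseGas.g (x : Space d) : ℝ := G.v x * G.φ x

/-- `ĝ(k)`. As the support of `g` fits in the box, for `k ∈ Λ*` this is also the Fourier
coefficient of the periodic version of `g`. -/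
def BoseGas.gHat (k : Space d) : ℝ := fourier G.g k

/-- The Fourier transform of `g ω`. -/
def BoseGas.gωHat (k : Space d) : ℝ := fourier (fun x => G.g x * G.ω x) k

/-- The Lee-Huang-Yang correction order: `δ` if `d = 2`, `√(ρ a³)` if `d = 3`. -/
def BoseGas.lamLHY : ℝ := if d = 2 then G.delta else Real.sqrt (G.ρ * G.a ^ 3)

/-- The small parameter of the dilute regime: `δ` if `d = 2`, `ρ a³` if `d = 3`. -/
def BoseGas.small : ℝ := if d = 2 then G.delta else G.ρ * G.a ^ 3

/-- `A ≪ B` with explicit constants: `A ≤ c δ^ζ B` if `d = 2`, `A ≤ c (ρ a³)^ζ B` if `d = 3`. -/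
def BoseGas.MuchLess (c ζ A B : ℝ) : Prop := A ≤ c * G.small ^ ζ * B

/-- `ℓ_δ = (a/2) e^{1/(2δ)} e^Γ`, with `Γ` the Euler-Mascheroni constant. -/
def BoseGas.ellDelta : ℝ :=
  G.a / 2 * Real.exp (1 / (2 * G.delta)) * Real.exp Real.eulerMascheroniConstant

variable (P : Params)

/-- The side length `ℓ = K_ℓ / √(ρ ĝ(0))` of the box `Λ`. -/
def ell : ℝ := P.Kell / Real.sqrt (G.ρ * G.gHat 0)

/-- The volume `|Λ| = ℓ^d`. -/
def vol : ℝ := ell G P ^ d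

/-- The number of particles `N = ρ ℓ^d`. -/
def numParticles : ℝ := G.ρ * vol G P

/-- The momentum `k = (2π/ℓ) m ∈ Λ*` with label `m`. -/
def mom (m : Mode d) : Space d := WithLp.toLp 2 (fun i => 2 * Real.pi / ell G P * (m i : ℝ))

/-- The low momenta `𝒫_L = {0 < |p| ≤ K_L / ℓ}`. -/
def PL : Set (Mode d) := {m | 0 < ‖mom G P m‖ ∧ ‖mom G P m‖ ≤ P.KL / ell G P}

/-- The high momenta `𝒫_H = {|k| ≥ K_H / ℓ}`. -/
def PH : Set (Mode d) := {m | P.KH / ell G P ≤ ‖mom G P m‖}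

/-- The sum-to-integral error `𝓔_d`, without its constant. -/
def sumError : ℝ :=
  if d = 2 then
    G.R ^ 2 / G.ellDelta ^ 2 * G.gHat 0 ^ 2
      + G.gHat 0 ^ 2 * |Real.log (P.KH * G.ellDelta / ell G P)|
  else G.gHat 0 ^ 2 * P.KH / ell G P

/-- The relations between the parameters, every `≪` being understood with the constants `c, ζ`. -/
structure ParamRelations (c ζ : ℝ) : Prop where
  εK_pos : 0 < P.εK
  εgap_pos : 0 < P.εgap
  εK_small : G.MuchLess c ζ P.εK 1
  εgap_small : G.MuchLess c ζ P.εgap 1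
  M_large : G.MuchLess c ζ 1 P.M
  Kell_large : G.MuchLess c ζ 1 P.Kell
  KL_large : G.MuchLess c ζ 1 P.KL
  KH_large : G.MuchLess c ζ 1 P.KH
  Kell_Kell4 : G.MuchLess c ζ P.Kell (P.Kell ^ 4)
  Kell4_KL : G.MuchLess c ζ (P.Kell ^ 4) P.KL
  KL_KH : G.MuchLess c ζ P.KL P.KH
  M_potential : G.MuchLess c ζ
    (ell G P * Real.sqrt G.ρ * Real.sqrt P.KH * Real.sqrt (∫ x, ‖G.v x‖)) P.M
  M_condensation : G.MuchLess c ζ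
    (ell G P ^ 2 * G.ρ ^ 2 * vol G P * G.gHat 0 * G.lamLHY) P.M
  M_N : G.MuchLess c ζ (P.M / numParticles G P) ((P.Kell / P.KL) ^ 4)
  Kell_KL_four : G.MuchLess c ζ ((P.Kell / P.KL) ^ 4) 1
  M_KH : G.MuchLess c ζ (P.M / numParticles G P * P.KH ^ d) 1
  εK_large : G.MuchLess c ζ
    (ell G P ^ ((8 : ℤ) - d) * G.ρ ^ 3 * G.gHat 0 ^ 4 * P.KH ^ (-8 : ℤ) * P.KL ^ d * P.M)
    (P.εK ^ 2)
  Kell_sq_large : G.MuchLess c ζ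
    (ell G P ^ ((4 : ℤ) - d) * G.ρ * G.gHat 0 ^ 2 * P.KH ^ (-2 : ℤ) * P.KL ^ d * P.M)
    (P.Kell ^ 2)
  gap_one : G.MuchLess c ζ
    (G.ρ ^ 3 * G.gHat 0 ^ 4 * ell G P ^ ((8 : ℤ) - d) * P.KH ^ ((d : ℤ) - 6)) P.εgap
  gap_two : G.MuchLess c ζ
    (P.εK * ell G P ^ 2 * G.ρ * G.gHat 0 + sumError G P * ell G P ^ 2 * G.ρ
      + P.Kell ^ 2 / P.KH) P.εgap
  gap_three : G.MuchLess c ζ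
    (G.R / ell G P * P.KL * ell G P ^ 2 * G.ρ * G.gHat 0) P.εgap

/-- The size allowed for an error of smaller order than the Lee-Huang-Yang precision:
`ρ² |Λ| δ^{2+η}` if `d = 2`, `ρ² |Λ| a (ρ a³)^{1/2+η}` if `d = 3`. -/
def lhyError (η : ℝ) : ℝ :=
  if d = 2 then G.ρ ^ 2 * vol G P * G.delta ^ (2 + η)
  else G.ρ ^ 2 * vol G P * G.a * (G.ρ * G.a ^ 3) ^ (1 / 2 + η)

/-- `ρ_z = |z|² / |Λ|`. -/
def rhoZ (z : ℂ) : ℝ := ‖z‖ ^ 2 / vol G P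

/-- `𝒟_k = √(k⁴ + 2 k² ρ_z ĝ(k))`. -/
def Dk (z : ℂ) (m : Mode d) : ℝ :=
  Real.sqrt (‖mom G P m‖ ^ 4 + 2 * ‖mom G P m‖ ^ 2 * rhoZ G P z * G.gHat (mom G P m))

/-- `α_k = (k² + ρ_z ĝ(k) - 𝒟_k) / (ρ_z ĝ(k))`; the value `0` that division by zero gives when
`ĝ(k) = 0` is the limiting one. -/
def alphaK (z : ℂ) (m : Mode d) : ℝ :=
  (‖mom G P m‖ ^ 2 + rhoZ G P z * G.gHat (mom G P m) - Dk G P z m)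
    / (rhoZ G P z * G.gHat (mom G P m))

end Gas

/-! ### Fock space -/

/-- Occupation numbers of the plane waves, finitely many particles in total. -/
abbrev Config (d : ℕ) := Mode d →₀ ℕ

/-- The bosonic Fock space over `L²(Λ)`, in the orthonormal basis of occupation number states of
the normalised plane waves. -/
abbrev Fock (d : ℕ) := lp (fun _ : Config d => ℂ) 2

/-- The excitation Fock space `ℱ_s(Ran Q)`: no particle in the zero momentum mode. -/
def excitationFock (d : ℕ) : Submodule ℂ (Fock d) where
  carrier := {Φ | ∀ n : Config d, n 0 ≠ 0 → Φ n = 0}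
  zero_mem' := fun _ _ => rfl
  add_mem' := fun {a b} ha hb n hn => by
    change a n + b n = 0
    rw [ha n hn, hb n hn, add_zero]
  smul_mem' := fun c a ha n hn => by
    change c • a n = 0
    rw [ha n hn, smul_zero]

/-- Unbounded operators are given by their action on the coefficients in the occupation number
basis; this action makes sense on all families of coefficients. -/
abbrev Op (d : ℕ) := Module.End ℂ (Config d → ℂ)

/-- The annihilation operator `a_k |n⟩ = √(n_k) |n - e_k⟩`. -/
def annih {d : ℕ} (k : Mode d) : Op d where
  toFun f n := (Real.sqrt ((n k : ℝ) + 1) : ℂ) * f (n + Finsupp.single k 1)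
  map_add' f g := by
    funext n
    exact mul_add _ _ _
  map_smul' c f := by
    funext n
    exact mul_left_comm _ _ _

/-- The creation operator `a_k† |n⟩ = √(n_k + 1) |n + e_k⟩`. -/
def creat {d : ℕ} (k : Mode d) : Op d where
  toFun f n := (Real.sqrt (n k : ℝ) : ℂ) * f (n - Finsupp.single k 1)
  map_add' f g := by
    funext n
    exact mul_add _ _ _
  map_smul' c f := by
    funext n
    exact mul_left_comm _ _ _

/-- The expectation `⟨Φ, X Φ⟩` of one elementary operator. -/
def expect {d : ℕ} (X : Op d) (Φ : Config d → ℂ) : ℂ :=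
  ∑' n, (starRingEnd ℂ) (Φ n) * X Φ n

/-- The expectation in `Φ` of the operator `∑ i, X i` converges absolutely. -/
def FormSummable {d : ℕ} {ι : Type} (X : ι → Op d) (Φ : Config d → ℂ) : Prop :=
  (∀ i, Summable fun n => (starRingEnd ℂ) (Φ n) * X i Φ n) ∧ Summable fun i => expect (X i) Φ

/-- The expectation of the (symmetric) operator `∑ i, X i`, term by term. -/
def formSum {d : ℕ} {ι : Type} (X : ι → Op d) (Φ : Config d → ℂ) : ℝ :=
  (∑' i, expect (X i) Φ).re

/-! ### The operators -/

section Operators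

variable {d : ℕ} (G : BoseGas d) (P : Params)

/-- The kinetic energy `∑_{k ∈ Λ*} k² a_k† a_k`. -/
def kinetic (k : Mode d) : Op d := ((‖mom G P k‖ ^ 2 : ℝ) : ℂ) • (creat k * annih k)

/-- `n_+ = ∑_{k ≠ 0} a_k† a_k`. -/
def nPlus (d : ℕ) (k : {k : Mode d // k ≠ 0}) : Op d := creat k.1 * annih k.1

/-- `n_+^H`, the number of particles with `|k| > K_L / ℓ`. -/
def nPlusH (k : {k : Mode d // P.KL / ell G P < ‖mom G P k‖}) : Op d := creat k.1 * annih k.1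

open Classical in
/-- The eigenvalue of `n_+^L` on an occupation number state: the number of particles with
`0 < |k| < K_H / ℓ`. -/
def numLow (n : Config d) : ℕ :=
  n.sum fun k j => if 0 < ‖mom G P k‖ ∧ ‖mom G P k‖ < P.KH / ell G P then j else 0

open Classical in
/-- The spectral projection `𝟙_{[0, M]}(n_+^L)`. -/
def lowProj (M : ℝ) (Φ : Config d → ℂ) : Config d → ℂ :=
  fun n => if (numLow G P n : ℝ) ≤ M then Φ n else 0

/-- `𝒬₃^soft(z) = |Λ|⁻¹ ∑_{k ∈ 𝒫_H, p ∈ 𝒫_L} ĝ(k) (z̄ a_p† a_{p-k} a_k + h.c.)`. -/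
def Q3soft (z : ℂ) (q : PH G P × PL G P) : Op d :=
  let k : Mode d := q.1.1
  let p : Mode d := q.2.1
  ((G.gHat (mom G P k) / vol G P : ℝ) : ℂ) •
    ((starRingEnd ℂ) z • (creat p * annih (p - k) * annih k)
      + z • (creat k * creat (p - k) * annih p))

/-- `b_k = (1 - α_k²)^{-1/2} (a_k + α_k a_{-k}†)`. -/
def bAnnih (z : ℂ) (k : Mode d) : Op d :=
  ((1 / Real.sqrt (1 - alphaK G P z k ^ 2) : ℝ) : ℂ) •
    (annih k + (alphaK G P z k : ℂ) • creat (-k))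

/-- `b_k† = (1 - α_k²)^{-1/2} (a_k† + α_k a_{-k})`. -/
def bCreat (z : ℂ) (k : Mode d) : Op d :=
  ((1 / Real.sqrt (1 - alphaK G P z k ^ 2) : ℝ) : ℂ) •
    (creat k + (alphaK G P z k : ℂ) • annih (-k))

/-- `𝒦_H^diag = ∑_{k ∈ 𝒫_H} 𝒟_k b_k† b_k`. -/
def KHdiag (z : ℂ) (k : PH G P) : Op d :=
  (Dk G P z k.1 : ℂ) • (bCreat G P z k.1 * bAnnih G P z k.1)

/-- `𝒬₂^ex(z) = ρ_z ∑_{k ≠ 0} ((gω)^(k) + (gω)^(0)) a_k† a_k`. -/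
def Q2ex (z : ℂ) (k : {k : Mode d // k ≠ 0}) : Op d :=
  ((rhoZ G P z * (G.gωHat (mom G P k.1) + G.gωHat 0) : ℝ) : ℂ) • (creat k.1 * annih k.1)

end Operators

end SoftPairs

end

open SoftPairs

noncomputable section

open scoped InnerProductSpace ContDiff ComplexConjugate

namespace SoftPairs

/-! ### Ladder operators on families of coefficients -/

section Ladder

variable {d : ℕ}

/-! Fix a high momentum `k` and put `S_k = ∑_{p ∈ 𝒫_L} a†_{p-k} a_p Φ`. The `k`-part of the cubic
term is `2 |Λ|⁻¹ ĝ(k) Re z⟨a_k Φ, S_k⟩`. Write `a_k = √(1-α_k²) b_k - α_k a†_{-k}` and complete the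
square with `𝒟_k b_k† b_k`: the cost is at most `|z|² |Λ|⁻² ĝ(k)² 𝒟_k⁻¹ ‖S_k‖²`, plus a remainder
carrying the small factor `α_k` (`LowState.soft_pair_lower`). Normal ordering of `‖S_k‖²` produces
the commutator `∑_{p ∈ 𝒫_L} ⟨a_p† a_p⟩` and a part which, as there are at most `𝓜` low particles, is
bounded by `𝓜 ∑_p ⟨a†_{p-k} a_{p-k}⟩` (`LowState.norm_pairVec_sq_le`). Since `|p - k| > K_L/ℓ`, this
part and the `α_k` remainder are absorbed by `K_ℓ² n_+^H / ℓ²` (`DiluteRegime.high_coefficient_le`).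

Summed over `k`, the commutator costs about `ρ_z |Λ|⁻¹ ∑ ĝ(k)²/k²` per low particle. The scattering
equation says, up to boundary terms, that `ĝ(k) = 2k² ω̂(k)`, so by Parseval this number is about
`2ρ_z (gω)^(0)`. That is exactly what the exchange term `𝒬₂^ex` gives back for each low particle,
since `(gω)^` varies little on `𝒫_L`. The difference of the two is below `ε_gap / ℓ²`
(`DiluteRegime.main_bound`), and no error of Lee-Huang-Yang type remains.

The analytic input is the comparison of the lattice sum with `∫ gω`, needed from above only
(`UnitScattering.sum_le`). On the scale `ℓ`, subtract from `1 - φ` its constant and a smooth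
multiple of the fundamental solution; the rest `u` is supported inside the unit cell. Testing the
scattering equation with plane waves gives `ĝ = 2k² û - 2b ĥ` with `h` smooth and `b` the small
slope. Inserting this in one factor of `|ĝ|²/(2k²)` and using Parseval for `⟨u, g⟩` leaves an error
of order `b ∫ g`; the omitted zero mode has the favourable sign because `u ≥ 0`.

The signs and bounds of `φ` used here are not assumed. They follow from a weak maximum principle,
itself derived from Kato's inequality by mollification. Finally, the list of `≪` relations is
reduced to the few inequalities collected in `DiluteRegime`. -/

lemma annih_apply (k : Mode d) (f : Config d → ℂ) (n : Config d) :
    annih k f n = (Real.sqrt ((n k : ℝ) + 1) : ℂ) * f (n + Finsupp.single k 1) := rfl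

lemma creat_apply (k : Mode d) (f : Config d → ℂ) (n : Config d) :
    creat k f n = (Real.sqrt (n k : ℝ) : ℂ) * f (n - Finsupp.single k 1) := rfl

lemma add_single_injective (k : Mode d) :
    Function.Injective fun n : Config d => n + Finsupp.single k 1 := add_left_injective _

lemma mem_range_add_single {k : Mode d} {n : Config d} (h : n k ≠ 0) :
    n ∈ Set.range fun n : Config d => n + Finsupp.single k 1 := by
  refine ⟨n - Finsupp.single k 1, tsub_add_cancel_of_le ?_⟩
  rw [Finsupp.single_le_iff]
  omega

/-- The shift `n ↦ n + e_k` is injective and the factor `√(n_k)` kills everything off its range, so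
the two series are reindexings of each other. Hence `a_k†` is the adjoint of `a_k` on arbitrary
families, with no domain condition; together with `tsum_mul_creat` this lets all unbounded operators
be moved across the pairing. -/
lemma summable_mul_creat_iff (k : Mode d) (f g : Config d → ℂ) :
    (Summable fun n => conj (f n) * creat k g n) ↔
      Summable fun n => conj (annih k f n) * g n := by
  rw [← (add_single_injective k).summable_iff]
  · refine summable_congr fun n => ?_
    simp [annih_apply, creat_apply, add_tsub_cancel_right]
    ring
  · intro n hn
    have : n k = 0 := by
      by_contra h
      exact hn (mem_range_add_single h)
    simp [creat_apply, this]

lemma tsum_mul_creat (k : Mode d) (f g : Config d → ℂ) :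
    ∑' n, conj (f n) * creat k g n = ∑' n, conj (annih k f n) * g n := by
  rw [← (add_single_injective k).tsum_eq]
  · refine tsum_congr fun n => ?_
    simp [annih_apply, creat_apply, add_tsub_cancel_right]
    ring
  · intro n hn
    refine mem_range_add_single (k := k) fun h => hn ?_
    simp [creat_apply, h]

lemma conj_mul_eq (a b : ℂ) : conj a * b = conj (conj b * a) := by
  simp [mul_comm]

lemma summable_mul_annih_iff (k : Mode d) (f g : Config d → ℂ) :
    (Summable fun n => conj (f n) * annih k g n) ↔
      Summable fun n => conj (creat k f n) * g n := by
  have h := summable_mul_creat_iff k g f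
  have e : ∀ u v : Config d → ℂ, (Summable fun n => conj (u n) * v n) ↔
      Summable fun n => conj (v n) * u n := by
    intro u v
    rw [← Complex.summable_conj]
    simp [mul_comm]
  rw [e, ← h, e]

lemma tsum_mul_annih (k : Mode d) (f g : Config d → ℂ) :
    ∑' n, conj (f n) * annih k g n = ∑' n, conj (creat k f n) * g n := by
  have h := tsum_mul_creat k g f
  simp_rw [conj_mul_eq (f _), conj_mul_eq (creat k f _)]
  rw [← Complex.conj_tsum, ← Complex.conj_tsum, h]

lemma annih_comm (k l : Mode d) (f : Config d → ℂ) :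
    annih k (annih l f) = annih l (annih k f) := by
  funext n
  by_cases h : k = l
  · subst h; rfl
  · simp only [annih_apply, Finsupp.add_apply, Finsupp.single_apply, if_neg h, if_neg (Ne.symm h)]
    rw [add_right_comm]
    simp only [add_zero]
    ring

lemma annih_creat_of_ne {k l : Mode d} (h : k ≠ l) (f : Config d → ℂ) :
    annih k (creat l f) = creat l (annih k f) := by
  funext n
  have e : n + Finsupp.single k 1 - Finsupp.single l 1
      = n - Finsupp.single l 1 + Finsupp.single k 1 := by
    ext j
    simp only [Finsupp.coe_add, Finsupp.coe_tsub, Pi.add_apply, Pi.sub_apply,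
      Finsupp.single_apply]
    split_ifs with h1 h2
    · exact absurd (h1.trans h2.symm) h
    all_goals omega
  have e2 : (n - Finsupp.single l 1 : Config d) k = n k := by
    simp [Ne.symm h]
  simp only [annih_apply, creat_apply, Finsupp.add_apply, Finsupp.single_apply, if_neg h, e, e2]
  simp only [add_zero]
  ring

lemma sqrt_mul_sqrt_natCast (j : ℕ) :
    ((Real.sqrt (j : ℝ) : ℝ) : ℂ) * ((Real.sqrt (j : ℝ) : ℝ) : ℂ) = (j : ℂ) := by
  rw [← Complex.ofReal_mul, Real.mul_self_sqrt (by positivity)]; push_cast; rfl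

lemma sub_single_add_single {k : Mode d} {n : Config d} (h : n k ≠ 0) :
    n - Finsupp.single k 1 + Finsupp.single k 1 = n := by
  refine tsub_add_cancel_of_le ?_
  rw [Finsupp.single_le_iff]; omega

lemma sub_single_apply_add_one {k : Mode d} {n : Config d} (h : n k ≠ 0) :
    (((n - Finsupp.single k 1 : Config d) k : ℕ) : ℝ) + 1 = n k := by
  simp only [Finsupp.coe_tsub, Pi.sub_apply, Finsupp.single_eq_same]
  rw [Nat.cast_sub (by omega)]; simp

/-- The canonical commutation relation. At `n k = 0` the truncated subtraction in `creat` is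
harmless, being multiplied by `√0`. -/
lemma annih_creat_self (k : Mode d) (f : Config d → ℂ) :
    annih k (creat k f) = creat k (annih k f) + f := by
  funext n
  simp only [annih_apply, creat_apply, Pi.add_apply, add_tsub_cancel_right]
  have e1 : ((Real.sqrt ((n k : ℝ) + 1) : ℝ) : ℂ) * ((Real.sqrt ((n k : ℝ) + 1) : ℝ) : ℂ)
      = (n k : ℂ) + 1 := by
    rw [← Complex.ofReal_mul, Real.mul_self_sqrt (by positivity)]; push_cast; rfl
  by_cases h : n k = 0
  · simp [h]
  · rw [sub_single_add_single h, sub_single_apply_add_one h, ← mul_assoc, ← mul_assoc]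
    simp only [Finsupp.coe_add, Pi.add_apply, Finsupp.single_eq_same, Nat.cast_add, Nat.cast_one]
    rw [e1, sqrt_mul_sqrt_natCast]
    ring

lemma memlp_two_iff (f : Config d → ℂ) :
    Memℓp f 2 ↔ Summable fun n => ‖f n‖ ^ 2 := by
  rw [memℓp_gen_iff (by norm_num)]
  simp

lemma memlp_two_iff_mul (f : Config d → ℂ) :
    Memℓp f 2 ↔ Summable fun n => conj (f n) * f n := by
  rw [memlp_two_iff, ← Complex.summable_ofReal]
  refine summable_congr fun n => ?_
  rw [Complex.conj_mul']; push_cast; rfl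

/-- The operator `a_k† a_k` multiplies by the occupation number. -/
lemma creat_annih_apply (k : Mode d) (f : Config d → ℂ) (n : Config d) :
    creat k (annih k f) n = (n k : ℂ) * f n := by
  simp only [annih_apply, creat_apply]
  by_cases h : n k = 0
  · simp [h]
  · rw [sub_single_add_single h, sub_single_apply_add_one h, ← mul_assoc, sqrt_mul_sqrt_natCast]

lemma memlp_annih_iff (k : Mode d) (f : Config d → ℂ) :
    Memℓp (annih k f) 2 ↔ Summable fun n => (n k : ℝ) * ‖f n‖ ^ 2 := by
  rw [memlp_two_iff_mul, ← summable_mul_creat_iff, ← Complex.summable_ofReal]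
  refine summable_congr fun n => ?_
  rw [creat_annih_apply]
  push_cast
  rw [← Complex.conj_mul']; ring

lemma tsum_norm_annih (k : Mode d) (f : Config d → ℂ) :
    ∑' n, ‖annih k f n‖ ^ 2 = ∑' n, (n k : ℝ) * ‖f n‖ ^ 2 := by
  have h := tsum_mul_creat k f (annih k f)
  apply Complex.ofReal_injective
  rw [Complex.ofReal_tsum, Complex.ofReal_tsum]
  convert h.symm using 1
  · refine tsum_congr fun n => ?_
    rw [Complex.conj_mul']; push_cast; rfl
  · refine tsum_congr fun n => ?_
    rw [creat_annih_apply]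
    push_cast
    rw [← Complex.conj_mul']; ring

/-- By the commutation relation, `‖a_k† f‖² = ‖a_k f‖² + ‖f‖²`. -/
lemma memlp_creat {k : Mode d} {f : Config d → ℂ} (hf : Memℓp f 2) (hk : Memℓp (annih k f) 2) :
    Memℓp (creat k f) 2 := by
  rw [memlp_two_iff_mul, summable_mul_creat_iff, annih_creat_self]
  have h1 := (memlp_two_iff_mul _).1 hf
  have h2 := (memlp_two_iff_mul _).1 hk
  rw [← summable_mul_creat_iff] at h2
  have h3 := (Complex.summable_conj.2 (h2.add h1))
  refine h3.congr fun n => ?_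
  simp [mul_comm]
  ring

open Classical in
/-- The element of Fock space with given coefficients, `0` if these are not square summable. -/
def toFock (f : Config d → ℂ) : Fock d := if hf : Memℓp f 2 then ⟨f, hf⟩ else 0

lemma coe_toFock {f : Config d → ℂ} (hf : Memℓp f 2) : ⇑(toFock f) = f := by
  simp [toFock, hf]

/-- The squared norm of a family of coefficients. -/
def nsq (f : Config d → ℂ) : ℝ := ∑' n, ‖f n‖ ^ 2

lemma nsq_nonneg (f : Config d → ℂ) : 0 ≤ nsq f := tsum_nonneg fun _ => by positivity

lemma inner_eq_tsum_mul (f g : Fock d) : ⟪f, g⟫_ℂ = ∑' n, conj (f n) * g n := by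
  rw [lp.inner_eq_tsum]
  exact tsum_congr fun n => by rw [RCLike.inner_apply, mul_comm]

lemma summable_mul (f g : Fock d) : Summable fun n => conj (f n) * g n := by
  refine (lp.summable_inner (𝕜 := ℂ) f g).congr fun n => ?_
  rw [RCLike.inner_apply, mul_comm]

lemma norm_sq_eq_tsum (f : Fock d) : ‖f‖ ^ 2 = ∑' n, ‖f n‖ ^ 2 := by
  have := lp.norm_rpow_eq_tsum (p := 2) (by norm_num) f
  simpa using this

lemma norm_toFock_sq {f : Config d → ℂ} (hf : Memℓp f 2) : ‖toFock f‖ ^ 2 = nsq f := by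
  rw [norm_sq_eq_tsum, coe_toFock hf]; rfl

lemma norm_toFock {f : Config d → ℂ} (hf : Memℓp f 2) : ‖toFock f‖ = Real.sqrt (nsq f) := by
  rw [← norm_toFock_sq hf, Real.sqrt_sq (norm_nonneg _)]

lemma inner_toFock {f g : Config d → ℂ} (hf : Memℓp f 2) (hg : Memℓp g 2) :
    ⟪toFock f, toFock g⟫_ℂ = ∑' n, conj (f n) * g n := by
  rw [inner_eq_tsum_mul, coe_toFock hf, coe_toFock hg]

lemma summable_mul_of_memlp {f g : Config d → ℂ} (hf : Memℓp f 2) (hg : Memℓp g 2) :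
    Summable fun n => conj (f n) * g n := by
  have := summable_mul (toFock f) (toFock g)
  rwa [coe_toFock hf, coe_toFock hg] at this

lemma tsum_conj_mul_self (f : Config d → ℂ) : ∑' n, conj (f n) * f n = (nsq f : ℂ) := by
  rw [nsq, Complex.ofReal_tsum]
  exact tsum_congr fun n => by rw [Complex.conj_mul']; push_cast; rfl

/-- On families with at most `M` particles in `PL`, a low annihilation operator is bounded by `√M`.
This is why products such as `a_p a_q Φ` with `p` low are square summable although only first
moments of the occupation numbers of `Φ` are assumed finite. -/
lemma memlp_annih_of_low {PL : Finset (Mode d)} {M : ℝ} {f : Config d → ℂ} (hf : Memℓp f 2)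
    (hlow : ∀ n, f n ≠ 0 → ∑ p ∈ PL, (n p : ℝ) ≤ M) {p : Mode d} (hp : p ∈ PL) :
    Memℓp (annih p f) 2 := by
  rw [memlp_annih_iff]
  refine Summable.of_nonneg_of_le (fun n => by positivity) (fun n => ?_)
    (((memlp_two_iff f).1 hf).mul_left M)
  by_cases h : f n = 0
  · simp [h]
  · gcongr
    exact (Finset.single_le_sum (f := fun p => (n p : ℝ)) (fun _ _ => by positivity) hp).trans
      (hlow n h)

lemma sum_nsq_annih_le {PL : Finset (Mode d)} {M : ℝ} {f : Config d → ℂ} (hf : Memℓp f 2)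
    (hlow : ∀ n, f n ≠ 0 → ∑ p ∈ PL, (n p : ℝ) ≤ M) :
    ∑ p ∈ PL, nsq (annih p f) ≤ M * nsq f := by
  have hs : ∀ p ∈ PL, Summable fun n : Config d => (n p : ℝ) * ‖f n‖ ^ 2 := fun p hp =>
    (memlp_annih_iff p f).1 (memlp_annih_of_low hf hlow hp)
  simp_rw [nsq, tsum_norm_annih]
  rw [← Summable.tsum_finsetSum hs, ← tsum_mul_left]
  refine Summable.tsum_le_tsum (fun n => ?_) (summable_sum hs)
    (((memlp_two_iff f).1 hf).mul_left M)
  rw [← Finset.sum_mul]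
  by_cases h : f n = 0
  · simp [h]
  · gcongr
    exact hlow n h

/-- Removing a particle, in whatever mode, cannot raise the number of low particles, so the bound by
`M` can be applied again after any annihilation. -/
lemma low_annih {PL : Finset (Mode d)} {M : ℝ} {f : Config d → ℂ}
    (hlow : ∀ n, f n ≠ 0 → ∑ p ∈ PL, (n p : ℝ) ≤ M) (q : Mode d) :
    ∀ n, annih q f n ≠ 0 → ∑ p ∈ PL, (n p : ℝ) ≤ M := by
  intro n hn
  have h : f (n + Finsupp.single q 1) ≠ 0 := fun h => hn (by simp [annih_apply, h])
  refine le_trans (Finset.sum_le_sum fun p _ => ?_) (hlow _ h)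
  simp

lemma nsq_creat {k : Mode d} {f : Config d → ℂ} (hf : Memℓp f 2) (hk : Memℓp (annih k f) 2) :
    nsq (creat k f) = nsq (annih k f) + nsq f := by
  apply Complex.ofReal_injective
  rw [← tsum_conj_mul_self, tsum_mul_creat, annih_creat_self]
  have h1 := (memlp_two_iff_mul _).1 hk
  rw [← summable_mul_creat_iff] at h1
  have h2 := (memlp_two_iff_mul _).1 hf
  have e : ∀ n, conj ((creat k (annih k f) + f) n) * f n
      = conj (conj (f n) * creat k (annih k f) n) + conj (f n) * f n := by
    intro n; simp; ring
  simp_rw [e]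
  rw [Summable.tsum_add (Complex.summable_conj.2 h1) h2, ← Complex.conj_tsum, tsum_mul_creat,
    tsum_conj_mul_self, tsum_conj_mul_self]
  push_cast
  rw [Complex.conj_ofReal]

end Ladder

/-! ### Completing the square at one high momentum -/

section SoftPair

variable {d : ℕ}

/-- A family of coefficients with finite particle numbers and at most `M` particles in `PL`. -/
structure LowState (Φ : Config d → ℂ) (PL : Finset (Mode d)) (M : ℝ) : Prop where
  memlp : Memℓp Φ 2
  memlp_annih : ∀ k, Memℓp (annih k Φ) 2
  low : ∀ n, Φ n ≠ 0 → ∑ p ∈ PL, (n p : ℝ) ≤ M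

variable {Φ : Config d → ℂ} {PL : Finset (Mode d)} {M : ℝ}

lemma LowState.memlp_annih_annih (h : LowState Φ PL M) {p : Mode d} (hp : p ∈ PL) (q : Mode d) :
    Memℓp (annih p (annih q Φ)) 2 :=
  memlp_annih_of_low (h.memlp_annih q) (low_annih h.low q) hp

lemma LowState.memlp_creat_annih (h : LowState Φ PL M) {p : Mode d} (hp : p ∈ PL) (q : Mode d) :
    Memℓp (creat q (annih p Φ)) 2 := by
  refine memlp_creat (h.memlp_annih p) ?_
  rw [annih_comm]
  exact h.memlp_annih_annih hp q

lemma LowState.memlp_creat (h : LowState Φ PL M) (q : Mode d) : Memℓp (creat q Φ) 2 :=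
  SoftPairs.memlp_creat h.memlp (h.memlp_annih q)

lemma LowState.sum_nsq_le (h : LowState Φ PL M) (q : Mode d) :
    ∑ p ∈ PL, nsq (annih p (annih q Φ)) ≤ M * nsq (annih q Φ) :=
  sum_nsq_annih_le (h.memlp_annih q) (low_annih h.low q)

/-- `⟨a†_{q} a_p Φ, a†_{q'} a_{p'} Φ⟩` in normal order. -/
lemma LowState.inner_creat_annih (h : LowState Φ PL M) {p p' : Mode d} (hp : p ∈ PL)
    (hp' : p' ∈ PL) (q q' : Mode d) :
    ⟪toFock (creat q (annih p Φ)), toFock (creat q' (annih p' Φ))⟫_ℂ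
      = ⟪toFock (annih p (annih q' Φ)), toFock (annih p' (annih q Φ))⟫_ℂ
        + if q = q' then ⟪toFock (annih p Φ), toFock (annih p' Φ)⟫_ℂ else 0 := by
  rw [inner_toFock (h.memlp_creat_annih hp q) (h.memlp_creat_annih hp' q'),
    inner_toFock (h.memlp_annih_annih hp q') (h.memlp_annih_annih hp' q),
    inner_toFock (h.memlp_annih p) (h.memlp_annih p'), ← tsum_mul_annih]
  by_cases hq : q = q'
  · subst hq
    rw [if_pos rfl, annih_creat_self, annih_comm p q, annih_comm p' q]
    have h1 : Summable fun n => conj (annih p Φ n) * creat q (annih q (annih p' Φ)) n := by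
      rw [summable_mul_creat_iff, annih_comm q p, annih_comm q p']
      exact summable_mul_of_memlp (h.memlp_annih_annih hp q) (h.memlp_annih_annih hp' q)
    have h2 : Summable fun n => conj (annih p Φ n) * annih p' Φ n :=
      summable_mul_of_memlp (h.memlp_annih p) (h.memlp_annih p')
    rw [← tsum_mul_creat q (annih p Φ), ← Summable.tsum_add h1 h2]
    exact tsum_congr fun n => by simp [mul_add]
  · rw [if_neg hq, add_zero, annih_creat_of_ne hq, tsum_mul_creat, annih_comm q', annih_comm q]

lemma two_mul_norm_mul_norm_le {E : Type*} [NormedAddCommGroup E] (x y : E) :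
    ‖x‖ * ‖y‖ ≤ (‖x‖ ^ 2 + ‖y‖ ^ 2) / 2 := by
  nlinarith [sq_nonneg (‖x‖ - ‖y‖)]

/-- The vector `∑_p a†_{p-k} a_p Φ`. -/
def pairVec (Φ : Config d → ℂ) (PL : Finset (Mode d)) (k : Mode d) : Fock d :=
  ∑ p ∈ PL, toFock (creat (p - k) (annih p Φ))

/-- Expand the square and normal order each inner product. The commutators survive only for `p = p'`
and give the first sum, the one later cancelled by the exchange energy. The normally ordered part
pairs `a_p a_{p'-k} Φ` with `a_{p'} a_{p-k} Φ`; Cauchy-Schwarz makes the two symmetric, and the sum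
over the low index costs `M`. -/
lemma LowState.norm_pairVec_sq_le (h : LowState Φ PL M) (k : Mode d) :
    ‖pairVec Φ PL k‖ ^ 2
      ≤ ∑ p ∈ PL, nsq (annih p Φ) + M * ∑ p ∈ PL, nsq (annih (p - k) Φ) := by
  have e : ‖pairVec Φ PL k‖ ^ 2 = ∑ p ∈ PL, ∑ p' ∈ PL,
      (⟪toFock (creat (p - k) (annih p Φ)), toFock (creat (p' - k) (annih p' Φ))⟫_ℂ).re := by
    have := inner_self_eq_norm_sq (𝕜 := ℂ) (pairVec Φ PL k)
    rw [← this, pairVec, sum_inner]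
    simp_rw [inner_sum]
    simp
  have hp : ∀ p ∈ PL, ∀ p' ∈ PL,
      (⟪toFock (creat (p - k) (annih p Φ)), toFock (creat (p' - k) (annih p' Φ))⟫_ℂ).re
      ≤ (nsq (annih p (annih (p' - k) Φ)) + nsq (annih p' (annih (p - k) Φ))) / 2
        + if p = p' then nsq (annih p Φ) else 0 := by
    intro p hp p' hp'
    rw [h.inner_creat_annih hp hp', Complex.add_re]
    refine add_le_add ?_ ?_
    · rw [← norm_toFock_sq (h.memlp_annih_annih hp _), ← norm_toFock_sq (h.memlp_annih_annih hp' _)]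
      refine le_trans (Complex.re_le_norm _) ((norm_inner_le_norm _ _).trans ?_)
      exact two_mul_norm_mul_norm_le _ _
    · by_cases hpp : p = p'
      · subst hpp
        simp only [if_true]
        rw [inner_toFock (h.memlp_annih p) (h.memlp_annih p), tsum_conj_mul_self,
          Complex.ofReal_re]
      · have : p - k ≠ p' - k := fun hh => hpp (sub_left_injective hh)
        simp [hpp, this]
  rw [e]
  refine (Finset.sum_le_sum fun p hp1 => Finset.sum_le_sum fun p' hp2 => hp p hp1 p' hp2).trans ?_
  simp_rw [Finset.sum_add_distrib, ← Finset.sum_div, Finset.sum_add_distrib]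
  have e1 : ∑ p ∈ PL, ∑ p' ∈ PL, (if p = p' then nsq (annih p Φ) else 0)
      = ∑ p ∈ PL, nsq (annih p Φ) := by
    refine Finset.sum_congr rfl fun p hp => ?_
    rw [Finset.sum_ite_eq, if_pos hp]
  have e2 : ∑ q ∈ PL, ∑ p ∈ PL, nsq (annih p (annih (q - k) Φ))
      ≤ M * ∑ p ∈ PL, nsq (annih (p - k) Φ) := by
    rw [Finset.mul_sum]
    exact Finset.sum_le_sum fun q _ => h.sum_nsq_le (q - k)
  have e3 := Finset.sum_comm (s := PL) (t := PL) (f := fun p p' => nsq (annih p (annih (p' - k) Φ)))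
  rw [e1]
  linarith

/-- Expand `κ ‖B + (γ/κ) S‖² ≥ 0`. Here `A` will be `a_k Φ` and `B` an unnormalised `b_k Φ`, so that
`A - B` is small. -/
lemma re_inner_lower {E : Type*} [NormedAddCommGroup E] [InnerProductSpace ℂ E] (A B S : E)
    {κ : ℝ} (hκ : 0 < κ) (γ : ℂ) :
    2 * (γ * ⟪A - B, S⟫_ℂ).re - ‖γ‖ ^ 2 / κ * ‖S‖ ^ 2
      ≤ κ * ‖B‖ ^ 2 + 2 * (γ * ⟪A, S⟫_ℂ).re := by
  have h : 0 ≤ κ * ‖B + (γ / κ) • S‖ ^ 2 := by positivity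
  have hκ' : (κ : ℂ) ≠ 0 := by exact_mod_cast hκ.ne'
  rw [norm_add_sq (𝕜 := ℂ), inner_smul_right, norm_smul, mul_pow, norm_div] at h
  have e1 : κ * (2 * RCLike.re (γ / κ * ⟪B, S⟫_ℂ)) = 2 * (γ * ⟪B, S⟫_ℂ).re := by
    have : γ / κ * ⟪B, S⟫_ℂ = ((κ⁻¹ : ℝ) : ℂ) * (γ * ⟪B, S⟫_ℂ) := by push_cast; ring
    rw [this]
    simp only [RCLike.re_to_complex, Complex.re_ofReal_mul]
    field_simp
  have e2 : κ * ((‖γ‖ / ‖(κ : ℂ)‖) ^ 2 * ‖S‖ ^ 2) = ‖γ‖ ^ 2 / κ * ‖S‖ ^ 2 := by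
    rw [Complex.norm_real, Real.norm_of_nonneg hκ.le]
    field_simp
  rw [mul_add, mul_add, e1, e2] at h
  rw [inner_sub_left, mul_sub, Complex.sub_re]
  linarith

/-- Completing the square in the soft pair interaction with one high momentum `k`. -/
theorem LowState.soft_pair_lower (h : LowState Φ PL M) (h0 : (0 : Mode d) ∉ PL) (k : Mode d)
    {α D : ℝ} (w : ℝ) (z : ℂ) (hD : 0 < D) (hα : α ^ 2 < 1) :
    -(2 * |α| * |w| * ‖z‖ * ∑ p ∈ PL, Real.sqrt (nsq (annih (p - k) Φ))
          * Real.sqrt (nsq (annih p (annih (-k) Φ))))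
        - w ^ 2 * ‖z‖ ^ 2 / D
          * (∑ p ∈ PL, nsq (annih p Φ) + M * ∑ p ∈ PL, nsq (annih (p - k) Φ))
      ≤ D / (1 - α ^ 2) * nsq (annih k Φ + (α : ℂ) • creat (-k) Φ)
        + ∑ p ∈ PL, 2 * w
          * (z * ⟪toFock (annih k Φ), toFock (creat (p - k) (annih p Φ))⟫_ℂ).re := by
  set A := toFock (annih k Φ) with hA
  set C := toFock (creat (-k) Φ) with hC
  set S := pairVec Φ PL k with hS
  have hκ : 0 < D / (1 - α ^ 2) := div_pos hD (by linarith)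
  have hB : nsq (annih k Φ + (α : ℂ) • creat (-k) Φ) = ‖A + (α : ℂ) • C‖ ^ 2 := by
    rw [norm_sq_eq_tsum, lp.coeFn_add, lp.coeFn_smul, hA, hC, coe_toFock (h.memlp_annih k),
      coe_toFock (h.memlp_creat _)]
    rfl
  have key := re_inner_lower A (A + (α : ℂ) • C) S hκ ((w : ℂ) * z)
  have e1 : ∑ p ∈ PL, 2 * w
      * (z * ⟪toFock (annih k Φ), toFock (creat (p - k) (annih p Φ))⟫_ℂ).re
      = 2 * ((w : ℂ) * z * ⟪A, S⟫_ℂ).re := by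
    rw [hS, pairVec, inner_sum, Finset.mul_sum, Complex.re_sum, Finset.mul_sum]
    refine Finset.sum_congr rfl fun p _ => ?_
    rw [mul_assoc (w : ℂ), Complex.re_ofReal_mul]; ring
  -- The favourable factor `1 - α² ≤ 1` of the completed square is discarded.
  have e2 : ‖(w : ℂ) * z‖ ^ 2 / (D / (1 - α ^ 2)) * ‖S‖ ^ 2 ≤ w ^ 2 * ‖z‖ ^ 2 / D
      * (∑ p ∈ PL, nsq (annih p Φ) + M * ∑ p ∈ PL, nsq (annih (p - k) Φ)) := by
    refine mul_le_mul ?_ (h.norm_pairVec_sq_le k) (by positivity) (by positivity)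
    rw [norm_mul, mul_pow, Complex.norm_real, Real.norm_eq_abs, sq_abs]
    refine div_le_div_of_nonneg_left (by positivity) hD ?_
    rw [le_div_iff₀ (by linarith)]
    nlinarith [sq_nonneg α]
  have e3 : -(2 * |α| * |w| * ‖z‖ * ∑ p ∈ PL, Real.sqrt (nsq (annih (p - k) Φ))
      * Real.sqrt (nsq (annih p (annih (-k) Φ))))
      ≤ 2 * ((w : ℂ) * z * ⟪A - (A + (α : ℂ) • C), S⟫_ℂ).re := by
    rw [sub_add_cancel_left, inner_neg_left, inner_smul_left, Complex.conj_ofReal]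
    have hb : ‖⟪C, S⟫_ℂ‖ ≤ ∑ p ∈ PL, Real.sqrt (nsq (annih (p - k) Φ))
        * Real.sqrt (nsq (annih p (annih (-k) Φ))) := by
      rw [hS, pairVec, inner_sum]
      refine (norm_sum_le _ _).trans (Finset.sum_le_sum fun p hp => ?_)
      -- As `p ≠ 0`, `a_{-k}` commutes with `a†_{p-k}` and no commutator arises: the remainder is
      -- `⟨a_{p-k} Φ, a_p a_{-k} Φ⟩`, which involves a low annihilation.
      have hne : -k ≠ p - k := by
        intro hh
        have : p = 0 := by simpa using (congrArg (· + k) hh).symm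
        exact h0 (this ▸ hp)
      have : ⟪C, toFock (creat (p - k) (annih p Φ))⟫_ℂ
          = ⟪toFock (annih (p - k) Φ), toFock (annih p (annih (-k) Φ))⟫_ℂ := by
        rw [hC, inner_toFock (h.memlp_creat _) (h.memlp_creat_annih hp _),
          inner_toFock (h.memlp_annih _) (h.memlp_annih_annih hp _), ← tsum_mul_annih,
          annih_creat_of_ne hne, tsum_mul_creat, annih_comm p]
      rw [this, ← norm_toFock (h.memlp_annih _), ← norm_toFock (h.memlp_annih_annih hp _)]
      exact norm_inner_le_norm _ _
    have hn : ‖(w : ℂ) * z * -((α : ℂ) * ⟪C, S⟫_ℂ)‖ ≤ |α| * |w| * ‖z‖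
        * ∑ p ∈ PL, Real.sqrt (nsq (annih (p - k) Φ))
          * Real.sqrt (nsq (annih p (annih (-k) Φ))) := by
      rw [norm_mul, norm_mul, norm_neg, norm_mul, Complex.norm_real, Complex.norm_real,
        Real.norm_eq_abs, Real.norm_eq_abs]
      calc |w| * ‖z‖ * (|α| * ‖⟪C, S⟫_ℂ‖) = |α| * |w| * ‖z‖ * ‖⟪C, S⟫_ℂ‖ := by ring
        _ ≤ _ := by gcongr
    have := (abs_le.1 (Complex.abs_re_le_norm ((w : ℂ) * z * -((α : ℂ) * ⟪C, S⟫_ℂ)))).1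
    linarith
  rw [hB, e1]
  linarith

end SoftPair

/-! ### Expectations as convergent series, and the sum over high momenta -/

section Expectations

variable {d : ℕ} {Φ : Config d → ℂ} {PL : Finset (Mode d)} {M : ℝ}

/-- `⟨a_k Φ, a†_{p-k} a_p Φ⟩`. -/
def pairAmp (Φ : Config d → ℂ) (k p : Mode d) : ℂ :=
  ⟪toFock (annih k Φ), toFock (creat (p - k) (annih p Φ))⟫_ℂ

lemma hasSum_number {k : Mode d} (hk : Memℓp (annih k Φ) 2) (c : ℝ) :
    HasSum (fun n => conj (Φ n) * ((c : ℂ) • (creat k * annih k) : Op d) Φ n)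
      ((c * nsq (annih k Φ) : ℝ) : ℂ) := by
  have h1 : Summable fun n => conj (Φ n) * creat k (annih k Φ) n := by
    rw [summable_mul_creat_iff]; exact (memlp_two_iff_mul _).1 hk
  have h2 := h1.hasSum.mul_left (c : ℂ)
  rw [tsum_mul_creat, tsum_conj_mul_self] at h2
  push_cast
  refine h2.congr_fun fun n => ?_
  simp; ring

/-- The two halves are adjoint to each other, so their expectations are complex conjugates and add
up to twice a real part. -/
lemma LowState.hasSum_cubic (h : LowState Φ PL M) (k : Mode d) {p : Mode d} (hp : p ∈ PL)
    (w : ℝ) (z : ℂ) :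
    HasSum (fun n => conj (Φ n) * ((w : ℂ) • (conj z • (creat p * annih (p - k) * annih k)
      + z • (creat k * creat (p - k) * annih p)) : Op d) Φ n)
      ((2 * w * (z * pairAmp Φ k p).re : ℝ) : ℂ) := by
  have h1 : Summable fun n => conj (Φ n) * creat p (annih (p - k) (annih k Φ)) n := by
    rw [summable_mul_creat_iff, summable_mul_annih_iff]
    exact summable_mul_of_memlp (h.memlp_creat_annih hp _) (h.memlp_annih k)
  have h2 : Summable fun n => conj (Φ n) * creat k (creat (p - k) (annih p Φ)) n := by
    rw [summable_mul_creat_iff]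
    exact summable_mul_of_memlp (h.memlp_annih k) (h.memlp_creat_annih hp _)
  have e1 : ∑' n, conj (Φ n) * creat p (annih (p - k) (annih k Φ)) n = conj (pairAmp Φ k p) := by
    rw [tsum_mul_creat, tsum_mul_annih, pairAmp, inner_conj_symm,
      inner_toFock (h.memlp_creat_annih hp _) (h.memlp_annih k)]
  have e2 : ∑' n, conj (Φ n) * creat k (creat (p - k) (annih p Φ)) n = pairAmp Φ k p := by
    rw [tsum_mul_creat, pairAmp, inner_toFock (h.memlp_annih k) (h.memlp_creat_annih hp _)]
  have h3 := ((h1.hasSum.mul_left (conj z)).add (h2.hasSum.mul_left z)).mul_left (w : ℂ)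
  have ev : (w : ℂ) * (conj z * conj (pairAmp Φ k p) + z * pairAmp Φ k p)
      = ((2 * w * (z * pairAmp Φ k p).re : ℝ) : ℂ) := by
    rw [← map_mul, add_comm, Complex.add_conj]
    simp only [Complex.ofReal_mul, Complex.ofReal_ofNat]
    ring
  rw [e1, e2, ev] at h3
  refine h3.congr_fun fun n => ?_
  simp; ring

/-- Moving `b_k†` across the pairing turns the expectation into the squared norm of `b_k Φ`; the two
normalising roots combine to `1 / (1 - α²)`. -/
lemma LowState.hasSum_diag (h : LowState Φ PL M) (k : Mode d) {α : ℝ} (D : ℝ)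
    (hα : α ^ 2 < 1) :
    HasSum (fun n => conj (Φ n) * ((D : ℂ) •
      ((((1 / Real.sqrt (1 - α ^ 2) : ℝ) : ℂ) • (creat k + (α : ℂ) • annih (-k))) *
       (((1 / Real.sqrt (1 - α ^ 2) : ℝ) : ℂ) • (annih k + (α : ℂ) • creat (-k)))) : Op d) Φ n)
      ((D / (1 - α ^ 2) * nsq (annih k Φ + (α : ℂ) • creat (-k) Φ) : ℝ) : ℂ) := by
  set B := annih k Φ + (α : ℂ) • creat (-k) Φ with hB
  have mB : Memℓp B 2 := (h.memlp_annih k).add ((h.memlp_creat (-k)).const_smul _)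
  have h1 : Summable fun n => conj (Φ n) * creat k B n := by
    rw [summable_mul_creat_iff]; exact summable_mul_of_memlp (h.memlp_annih k) mB
  have h2 : Summable fun n => conj (Φ n) * annih (-k) B n := by
    rw [summable_mul_annih_iff]; exact summable_mul_of_memlp (h.memlp_creat _) mB
  have h3 := (h1.hasSum.add (h2.hasSum.mul_left (α : ℂ))).mul_left ((D / (1 - α ^ 2) : ℝ) : ℂ)
  have e : ∑' n, conj (Φ n) * creat k B n + (α : ℂ) * ∑' n, conj (Φ n) * annih (-k) B n
      = (nsq B : ℂ) := by
    rw [tsum_mul_creat, tsum_mul_annih, ← tsum_conj_mul_self, ← tsum_mul_left,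
      ← Summable.tsum_add (summable_mul_of_memlp (h.memlp_annih k) mB)
        ((summable_mul_of_memlp (h.memlp_creat _) mB).mul_left _)]
    refine tsum_congr fun n => ?_
    rw [show conj (B n) = conj (annih k Φ n) + (α : ℂ) * conj (creat (-k) Φ n) by simp [hB]]
    ring
  rw [e] at h3
  rw [Complex.ofReal_mul]
  refine h3.congr_fun fun n => ?_
  have es : ((1 / Real.sqrt (1 - α ^ 2) : ℝ) : ℂ) * ((1 / Real.sqrt (1 - α ^ 2) : ℝ) : ℂ)
      = ((1 / (1 - α ^ 2) : ℝ) : ℂ) := by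
    rw [← Complex.ofReal_mul, div_mul_div_comm, Real.mul_self_sqrt (by linarith), one_mul]
  have e2 : ((D : ℂ) •
      ((((1 / Real.sqrt (1 - α ^ 2) : ℝ) : ℂ) • (creat k + (α : ℂ) • annih (-k))) *
       (((1 / Real.sqrt (1 - α ^ 2) : ℝ) : ℂ) • (annih k + (α : ℂ) • creat (-k)))) : Op d) Φ
      = ((D / (1 - α ^ 2) : ℝ) : ℂ) • (creat k B + (α : ℂ) • annih (-k) B) := by
    rw [smul_mul_smul_comm, es, smul_smul, ← Complex.ofReal_mul, mul_one_div]
    simp [hB]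
  rw [e2]
  simp
  ring

/-- A crude bound, uniform in `p`, that serves only the absolute convergence of the cubic term. -/
lemma LowState.norm_pairAmp_le (h : LowState Φ PL M) (hM : 0 ≤ M)
    (hν : Summable fun k : Mode d => nsq (annih k Φ)) (k : Mode d) {p : Mode d} (hp : p ∈ PL) :
    ‖pairAmp Φ k p‖ ≤ Real.sqrt (nsq (annih k Φ))
      * Real.sqrt ((M + 1) * ∑' k, nsq (annih k Φ)) := by
  rw [pairAmp]
  refine (norm_inner_le_norm _ _).trans ?_
  rw [norm_toFock (h.memlp_annih k), norm_toFock (h.memlp_creat_annih hp _)]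
  gcongr
  rw [nsq_creat (h.memlp_annih p) (by rw [annih_comm]; exact h.memlp_annih_annih hp _),
    annih_comm, add_mul, one_mul]
  refine add_le_add ?_ (hν.le_tsum p fun _ _ => nsq_nonneg _)
  calc nsq (annih p (annih (p - k) Φ)) ≤ ∑ p' ∈ PL, nsq (annih p' (annih (p - k) Φ)) :=
        Finset.single_le_sum (f := fun p' => nsq (annih p' (annih (p - k) Φ)))
          (fun _ _ => nsq_nonneg _) hp
    _ ≤ M * nsq (annih (p - k) Φ) := h.sum_nsq_le _
    _ ≤ _ := by gcongr; exact hν.le_tsum (p - k) fun _ _ => nsq_nonneg _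

lemma LowState.summable_cubic (h : LowState Φ PL M) (hM : 0 ≤ M)
    (hν : Summable fun k : Mode d => nsq (annih k Φ)) (PH : Set (Mode d)) (w : Mode d → ℝ) (z : ℂ)
    (hw : Summable fun k : PH => |w k| * Real.sqrt (nsq (annih k.1 Φ))) :
    Summable fun q : PH × PL => 2 * w q.1 * (z * pairAmp Φ q.1 q.2).re := by
  set Q := Real.sqrt ((M + 1) * ∑' k, nsq (annih k Φ)) with hQ
  have hs : Summable fun q : PH × PL => 2 * ‖z‖ * Q *
      ((|w q.1| * Real.sqrt (nsq (annih q.1.1 Φ))) * 1) := by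
    refine Summable.mul_left _ ?_
    refine Summable.mul_of_nonneg (f := fun k : PH => |w k| * Real.sqrt (nsq (annih k.1 Φ)))
      (g := fun _ : PL => (1 : ℝ)) hw (hasSum_fintype _).summable (fun k => ?_) (fun _ => ?_)
    · exact mul_nonneg (abs_nonneg _) (Real.sqrt_nonneg _)
    · exact zero_le_one
  refine hs.of_norm_bounded fun q => ?_
  rw [Real.norm_eq_abs, abs_mul, abs_mul, abs_two, mul_one]
  have h1 := (Complex.abs_re_le_norm (z * pairAmp Φ q.1 q.2)).trans_eq (norm_mul _ _)
  have h2 := h.norm_pairAmp_le hM hν q.1 q.2.2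
  calc 2 * |w q.1| * |(z * pairAmp Φ q.1 q.2).re|
      ≤ 2 * |w q.1| * (‖z‖ * (Real.sqrt (nsq (annih q.1.1 Φ)) * Q)) := by
        gcongr
        exact h1.trans (by gcongr)
    _ = _ := by ring

lemma LowState.nsq_quasi_le (h : LowState Φ PL M) (k : Mode d) (α : ℝ) :
    nsq (annih k Φ + (α : ℂ) • creat (-k) Φ)
      ≤ 2 * nsq (annih k Φ) + 2 * α ^ 2 * (nsq (annih (-k) Φ) + nsq Φ) := by
  have e : nsq (annih k Φ + (α : ℂ) • creat (-k) Φ)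
      = ‖toFock (annih k Φ) + (α : ℂ) • toFock (creat (-k) Φ)‖ ^ 2 := by
    rw [norm_sq_eq_tsum, lp.coeFn_add, lp.coeFn_smul, coe_toFock (h.memlp_annih k),
      coe_toFock (h.memlp_creat _)]
    rfl
  rw [e, ← nsq_creat h.memlp (h.memlp_annih _), ← norm_toFock_sq (h.memlp_annih _),
    ← norm_toFock_sq (h.memlp_creat _)]
  have h1 := norm_add_le (toFock (annih k Φ)) ((α : ℂ) • toFock (creat (-k) Φ))
  rw [norm_smul, Complex.norm_real, Real.norm_eq_abs] at h1
  have h2 := pow_le_pow_left₀ (norm_nonneg _) h1 2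
  have h3 : (|α| * ‖toFock (creat (-k) Φ)‖) ^ 2 = α ^ 2 * ‖toFock (creat (-k) Φ)‖ ^ 2 := by
    rw [mul_pow, sq_abs]
  nlinarith [sq_nonneg (‖toFock (annih k Φ)‖ - |α| * ‖toFock (creat (-k) Φ)‖)]

lemma LowState.summable_diag (h : LowState Φ PL M) (PH : Set (Mode d)) (α D : Mode d → ℝ)
    (hD : ∀ k ∈ PH, 0 < D k) (hα : ∀ k ∈ PH, α k ^ 2 ≤ 1 / 2)
    (hK : Summable fun k : PH => D k * nsq (annih k.1 Φ))
    (hK' : Summable fun k : PH => D k * nsq (annih (-k.1) Φ))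
    (hDα : Summable fun k : PH => D k * α k ^ 2) :
    Summable fun k : PH =>
      D k / (1 - α k ^ 2) * nsq (annih k.1 Φ + (α k : ℂ) • creat (-k.1) Φ) := by
  refine Summable.of_nonneg_of_le (fun k => ?_) (fun k => ?_)
    (((hK.mul_left 4).add (hK'.mul_left 4)).add (hDα.mul_left (4 * nsq Φ)))
  · have := hα k k.2
    exact mul_nonneg (div_nonneg (hD k k.2).le (by linarith)) (nsq_nonneg _)
  · have h1 := hα k k.2
    have h2 := hD k k.2
    have h3 : D k / (1 - α k ^ 2) ≤ 2 * D k := by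
      rw [div_le_iff₀ (by linarith)]; nlinarith
    have h4 := h.nsq_quasi_le k.1 (α k)
    have h5 : α k ^ 2 * nsq (annih (-k.1) Φ) ≤ 1 * nsq (annih (-k.1) Φ) := by
      gcongr
      · exact nsq_nonneg _
      · linarith
    calc _ ≤ 2 * D k * (2 * nsq (annih k.1 Φ)
          + 2 * α k ^ 2 * (nsq (annih (-k.1) Φ) + nsq Φ)) :=
          mul_le_mul h3 h4 (nsq_nonneg _) (by linarith)
      _ ≤ _ := by nlinarith

/-- The soft pair interaction and the diagonal kinetic energy of the high momenta, bounded from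
below by the number of low and of high particles. -/
theorem LowState.sum_soft_pair_lower (h : LowState Φ PL M) (hM : 0 ≤ M)
    (hν : Summable fun k : Mode d => nsq (annih k Φ)) (h0 : (0 : Mode d) ∉ PL)
    (PH H : Set (Mode d)) (w α D : Mode d → ℝ) (z : ℂ)
    (hD : ∀ k ∈ PH, 0 < D k) (hα : ∀ k ∈ PH, α k ^ 2 ≤ 1 / 2)
    (hcub : Summable fun q : PH × PL => 2 * w q.1 * (z * pairAmp Φ q.1 q.2).re)
    (hdiag : Summable fun k : PH =>
      D k / (1 - α k ^ 2) * nsq (annih k.1 Φ + (α k : ℂ) • creat (-k.1) Φ))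
    (hwD : Summable fun k : PH => w k ^ 2 / D k)
    (hneg : ∀ k ∈ PH, -k ∈ H) (hsub : ∀ k ∈ PH, ∀ p ∈ PL, p - k ∈ H)
    {X Y θ : ℝ} (hθ : 0 < θ) (hX : ∀ k ∈ PH, 2 * |α k| * |w k| * ‖z‖ ≤ X)
    (hY : ∀ k ∈ PH, w k ^ 2 * ‖z‖ ^ 2 / D k ≤ Y) (hY0 : 0 ≤ Y) :
    -(‖z‖ ^ 2 * (∑' k : PH, w k ^ 2 / D k) * ∑ p ∈ PL, nsq (annih p Φ))
      - ((θ / 2 + Y * M) * PL.card + X ^ 2 * M / θ / 2) * ∑' k : H, nsq (annih k.1 Φ)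
    ≤ ∑' q : PH × PL, 2 * w q.1 * (z * pairAmp Φ q.1 q.2).re
      + ∑' k : PH, D k / (1 - α k ^ 2) * nsq (annih k.1 Φ + (α k : ℂ) • creat (-k.1) Φ) := by
  have hνH : Summable fun k : H => nsq (annih k.1 Φ) := hν.subtype H
  -- The maps `k ↦ -k` and `k ↦ p - k` inject `PH` into `H`, so each reindexed sum is at most the
  -- total occupation of `H`.
  have hinj : ∀ e : PH → H, Function.Injective e →
      (Summable fun k => nsq (annih (e k).1 Φ)) ∧
        ∑' k, nsq (annih (e k).1 Φ) ≤ ∑' k : H, nsq (annih k.1 Φ) := fun e he =>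
    ⟨hνH.comp_injective he, Summable.tsum_le_tsum_of_inj e he (fun _ _ => nsq_nonneg _)
      (fun _ => le_rfl) (hνH.comp_injective he) hνH⟩
  have s1 := hinj (fun k => ⟨-k.1, hneg k.1 k.2⟩) fun k l hkl => by
    simpa [Subtype.ext_iff] using hkl
  have s2 : ∀ p ∈ PL, (Summable fun k : PH => nsq (annih (p - k.1) Φ)) ∧
      ∑' k : PH, nsq (annih (p - k.1) Φ) ≤ ∑' k : H, nsq (annih k.1 Φ) := fun p hp =>
    hinj (fun k => ⟨p - k.1, hsub k.1 k.2 p hp⟩) fun k l hkl => by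
      simpa [Subtype.ext_iff] using hkl
  have s3 : Summable fun k : PH => ∑ p ∈ PL, nsq (annih (p - k.1) Φ) :=
    summable_sum fun p hp => (s2 p hp).1
  have s3' : ∑' k : PH, ∑ p ∈ PL, nsq (annih (p - k.1) Φ)
      ≤ PL.card * ∑' k : H, nsq (annih k.1 Φ) := by
    rw [Summable.tsum_finsetSum fun p hp => (s2 p hp).1, ← nsmul_eq_mul]
    exact Finset.sum_le_card_nsmul _ _ _ fun p hp => (s2 p hp).2
  have e1 : ∑' q : PH × PL, 2 * w q.1 * (z * pairAmp Φ q.1 q.2).re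
      = ∑' k : PH, ∑ p ∈ PL, 2 * w k * (z * pairAmp Φ k p).re := by
    rw [hcub.tsum_prod]
    refine tsum_congr fun k => ?_
    rw [tsum_fintype, ← Finset.sum_coe_sort PL]
  have sc : Summable fun k : PH => ∑ p ∈ PL, 2 * w k * (z * pairAmp Φ k p).re := by
    refine hcub.prod.congr fun k => ?_
    rw [tsum_fintype, ← Finset.sum_coe_sort PL]
  set nL := ∑ p ∈ PL, nsq (annih p Φ) with hnL
  have hlow : ∀ k : PH,
      -(‖z‖ ^ 2 * nL * (w k ^ 2 / D k)) - (θ / 2 + Y * M) * (∑ p ∈ PL, nsq (annih (p - k.1) Φ))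
        - X ^ 2 * M / θ / 2 * nsq (annih (-k.1) Φ)
      ≤ ∑ p ∈ PL, 2 * w k * (z * pairAmp Φ k p).re
        + D k / (1 - α k ^ 2) * nsq (annih k.1 Φ + (α k : ℂ) • creat (-k.1) Φ) := by
    intro k
    have hk := h.soft_pair_lower h0 k.1 (w k) z (hD k k.2)
      ((hα k k.2).trans_lt (by norm_num))
    set T := ∑ p ∈ PL, nsq (annih (p - k.1) Φ) with hT
    have hT0 : 0 ≤ T := Finset.sum_nonneg fun _ _ => nsq_nonneg _
    have b1 : 2 * |α k| * |w k| * ‖z‖ * ∑ p ∈ PL, Real.sqrt (nsq (annih (p - k.1) Φ))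
        * Real.sqrt (nsq (annih p (annih (-k.1) Φ)))
        ≤ θ / 2 * T + X ^ 2 * M / θ / 2 * nsq (annih (-k.1) Φ) := by
      -- Young's inequality with a free weight `θ`: the first term will be summed over all `p ∈ PL`,
      -- hence will cost the cardinality of `PL`, while the second costs only `M`.
      have b2 : ∀ p ∈ PL, X * (Real.sqrt (nsq (annih (p - k.1) Φ))
          * Real.sqrt (nsq (annih p (annih (-k.1) Φ))))
          ≤ θ / 2 * nsq (annih (p - k.1) Φ)
            + X ^ 2 / θ / 2 * nsq (annih p (annih (-k.1) Φ)) := by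
        intro p _
        set a := Real.sqrt (nsq (annih (p - k.1) Φ)) with ha
        set b := Real.sqrt (nsq (annih p (annih (-k.1) Φ))) with hb
        rw [← Real.sq_sqrt (nsq_nonneg (annih (p - k.1) Φ)),
          ← Real.sq_sqrt (nsq_nonneg (annih p (annih (-k.1) Φ))), ← ha, ← hb]
        have : θ / 2 * a ^ 2 + X ^ 2 / θ / 2 * b ^ 2 - X * (a * b)
            = (θ * a - X * b) ^ 2 / (2 * θ) := by field_simp; ring
        have h2 : 0 ≤ (θ * a - X * b) ^ 2 / (2 * θ) := by positivity
        linarith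
      calc _ ≤ X * ∑ p ∈ PL, Real.sqrt (nsq (annih (p - k.1) Φ))
            * Real.sqrt (nsq (annih p (annih (-k.1) Φ))) := by
            refine mul_le_mul_of_nonneg_right (hX k k.2) (Finset.sum_nonneg fun _ _ => ?_)
            positivity
        _ ≤ θ / 2 * T + X ^ 2 / θ / 2 * ∑ p ∈ PL, nsq (annih p (annih (-k.1) Φ)) := by
            rw [Finset.mul_sum, hT, Finset.mul_sum, Finset.mul_sum, ← Finset.sum_add_distrib]
            exact Finset.sum_le_sum b2
        _ ≤ θ / 2 * T + X ^ 2 / θ / 2 * (M * nsq (annih (-k.1) Φ)) := by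
            gcongr
            exact h.sum_nsq_le _
        _ = _ := by ring
    have b3 : w k ^ 2 * ‖z‖ ^ 2 / D k * (nL + M * T)
        ≤ ‖z‖ ^ 2 * nL * (w k ^ 2 / D k) + Y * M * T := by
      have := mul_le_mul_of_nonneg_right (hY k k.2) (mul_nonneg hM hT0)
      calc _ = ‖z‖ ^ 2 * nL * (w k ^ 2 / D k) + w k ^ 2 * ‖z‖ ^ 2 / D k * (M * T) := by ring
        _ ≤ _ := by linarith
    simp only [pairAmp]
    linarith
  have key := Summable.tsum_le_tsum hlow
    (((hwD.mul_left _).neg.sub (s3.mul_left _)).sub (s1.1.mul_left _)) (sc.add hdiag)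
  rw [Summable.tsum_add sc hdiag,
    Summable.tsum_sub ((hwD.mul_left _).neg.sub (s3.mul_left _)) (s1.1.mul_left _),
    Summable.tsum_sub (hwD.mul_left _).neg (s3.mul_left _), tsum_neg, tsum_mul_left,
    tsum_mul_left, tsum_mul_left] at key
  rw [e1]
  refine le_trans ?_ key
  have c1 := mul_le_mul_of_nonneg_left s3' (show 0 ≤ θ / 2 + Y * M by positivity)
  have c2 := mul_le_mul_of_nonneg_left s1.2 (show 0 ≤ X ^ 2 * M / θ / 2 by positivity)
  dsimp only at c2
  linarith

end Expectations

/-! ### The Laplacian, its chain rule and integration by parts -/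

section WeakLaplacian

open MeasureTheory Filter Topology Laplacian

variable {E : Type*} [NormedAddCommGroup E] [InnerProductSpace ℝ E] [FiniteDimensional ℝ E]

lemma laplacian_eq_sum_fderiv (f : E → ℝ) (x : E) :
    laplacian f x = ∑ i, fderiv ℝ (fderiv ℝ f) x (stdOrthonormalBasis ℝ E i)
      (stdOrthonormalBasis ℝ E i) := by
  rw [InnerProductSpace.laplacian_eq_iteratedFDeriv_orthonormalBasis f (stdOrthonormalBasis ℝ E)]
  simp [iteratedFDeriv_two_apply]

/-- The squared norm of the gradient. -/
def gradSq (w : E → ℝ) (x : E) : ℝ := ∑ i, (fderiv ℝ w x (stdOrthonormalBasis ℝ E i)) ^ 2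

lemma gradSq_nonneg (w : E → ℝ) (x : E) : 0 ≤ gradSq w x := Finset.sum_nonneg fun _ _ => sq_nonneg _

lemma laplacian_comp {j : ℝ → ℝ} {w : E → ℝ} {x : E} (hj : ContDiffAt ℝ 2 j (w x))
    (hw : ContDiffAt ℝ 2 w x) :
    laplacian (fun y => j (w y)) x
      = deriv j (w x) * laplacian w x + deriv (deriv j) (w x) * gradSq w x := by
  have h1 : fderiv ℝ (fun y => j (w y)) =ᶠ[𝓝 x] fun y => deriv j (w y) • fderiv ℝ w y := by
    have hj' := hw.continuousAt.eventually (hj.eventually (by simp))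
    filter_upwards [hj', hw.eventually (by simp)] with y hy1 hy2
    have := (hy1.differentiableAt (by norm_num)).hasDerivAt.comp_hasFDerivAt y
      (hy2.differentiableAt (by norm_num)).hasFDerivAt
    exact this.fderiv
  have h2 : HasFDerivAt (fun y => deriv j (w y)) (deriv (deriv j) (w x) • fderiv ℝ w x) x := by
    have hd : DifferentiableAt ℝ (deriv j) (w x) :=
      (hj.derivWithin (m := 1) (by norm_num)).differentiableAt (by norm_num)
    exact hd.hasDerivAt.comp_hasFDerivAt x (hw.differentiableAt (by norm_num)).hasFDerivAt
  have h3 : HasFDerivAt (fderiv ℝ w) (fderiv ℝ (fderiv ℝ w) x) x :=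
    ((hw.fderiv_right (m := 1) (by norm_num)).differentiableAt (by norm_num)).hasFDerivAt
  have h4 := (h2.smul h3).congr_of_eventuallyEq h1
  rw [laplacian_eq_sum_fderiv, laplacian_eq_sum_fderiv, gradSq, Finset.mul_sum, Finset.mul_sum,
    ← Finset.sum_add_distrib]
  refine Finset.sum_congr rfl fun i _ => ?_
  rw [h4.fderiv]
  simp
  ring

lemma contDiff_laplacian {f : E → ℝ} (hf : ContDiff ℝ ∞ f) : ContDiff ℝ ∞ (laplacian f) := by
  have : laplacian f = fun x => ∑ i, fderiv ℝ (fderiv ℝ f) x (stdOrthonormalBasis ℝ E i)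
      (stdOrthonormalBasis ℝ E i) := funext (laplacian_eq_sum_fderiv f)
  rw [this]
  have h2 : ContDiff ℝ ∞ (fderiv ℝ (fderiv ℝ f)) :=
    (hf.fderiv_right (m := ∞) (by simp)).fderiv_right (m := ∞) (by simp)
  fun_prop

lemma tsupport_laplacian_subset (f : E → ℝ) : tsupport (laplacian f) ⊆ tsupport f := by
  refine closure_minimal (fun x hx => ?_) (isClosed_tsupport f)
  by_contra h
  refine hx ?_
  have : f =ᶠ[𝓝 x] fun _ => (0 : ℝ) := notMem_tsupport_iff_eventuallyEq.1 h
  rw [(InnerProductSpace.laplacian_congr_nhds this).eq_of_nhds]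
  simp

lemma laplacian_comp_sub_const (f : E → ℝ) (a x : E) :
    laplacian (fun y => f (y - a)) x = laplacian f (x - a) := by
  simp_rw [InnerProductSpace.laplacian_eq_iteratedFDeriv_orthonormalBasis _ (stdOrthonormalBasis ℝ E)]
  simp_rw [sub_eq_add_neg, iteratedFDeriv_comp_add_right]

lemma laplacian_comp_smul {f : E → ℝ} (hf : ContDiff ℝ 2 f) (c : ℝ) (x : E) :
    laplacian (fun y => f (c • y)) x = c ^ 2 * laplacian f (c • x) := by
  simp_rw [InnerProductSpace.laplacian_eq_iteratedFDeriv_orthonormalBasis _ (stdOrthonormalBasis ℝ E)]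
  simp_rw [iteratedFDeriv_comp_const_smul c hf]
  simp [Finset.mul_sum]

variable [MeasurableSpace E] [BorelSpace E]

/-- `f` need not have compact support: a cutoff equal to `1` near the support of `ψ` changes neither
integrand and reduces the claim to Schwartz functions. -/
lemma integral_mul_laplacian {f ψ : E → ℝ} (hf : ContDiff ℝ ∞ f) (hψ : ContDiff ℝ ∞ ψ)
    (hc : HasCompactSupport ψ) : ∫ x, f x * laplacian ψ x = ∫ x, laplacian f x * ψ x := by
  obtain ⟨r, hr0, hr⟩ := hc.isCompact.isBounded.subset_closedBall_lt 0 0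
  let χ : ContDiffBump (0 : E) := ⟨r + 1, r + 2, by linarith, by linarith⟩
  have hχ1 : ∀ x ∈ tsupport ψ, (fun y => χ y * f y) =ᶠ[𝓝 x] f := by
    intro x hx
    have : ∀ᶠ y in 𝓝 x, y ∈ Metric.ball (0 : E) (r + 1) :=
      Metric.isOpen_ball.mem_nhds (Metric.closedBall_subset_ball (by linarith) (hr hx))
    filter_upwards [this] with y hy
    rw [χ.one_of_mem_closedBall (Metric.ball_subset_closedBall hy), one_mul]
  have hcf : HasCompactSupport fun y => χ y * f y := χ.hasCompactSupport.mul_right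
  have hsf : ContDiff ℝ ∞ fun y => χ y * f y := χ.contDiff.mul hf
  have key := SchwartzMap.integral_mul_laplacian_right_eq_left (μ := volume) (hcf.toSchwartzMap hsf)
    (hc.toSchwartzMap hψ)
  have e1 : ∀ x, (hcf.toSchwartzMap hsf) x * (Δ (hc.toSchwartzMap hψ)) x
      = f x * laplacian ψ x := by
    intro x
    rw [SchwartzMap.laplacian_apply]
    by_cases hx : x ∈ tsupport ψ
    · exact congrArg (· * _) (hχ1 x hx).eq_of_nhds
    · have : laplacian ψ x = 0 :=
        image_eq_zero_of_notMem_tsupport fun h => hx (tsupport_laplacian_subset ψ h)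
      change _ * laplacian ψ x = _
      rw [this]; simp
  have e2 : ∀ x, (Δ (hcf.toSchwartzMap hsf)) x * (hc.toSchwartzMap hψ) x
      = laplacian f x * ψ x := by
    intro x
    rw [SchwartzMap.laplacian_apply]
    change laplacian (fun y => χ y * f y) x * ψ x = _
    by_cases hx : x ∈ tsupport ψ
    · rw [(InnerProductSpace.laplacian_congr_nhds (hχ1 x hx)).eq_of_nhds]
    · rw [image_eq_zero_of_notMem_tsupport hx]; simp
  simp_rw [e1, e2] at key
  exact key

end WeakLaplacian

/-! ### Mollification -/

section Mollify

open MeasureTheory Filter Topology Laplacian Convolution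

variable {E : Type*} [NormedAddCommGroup E] [InnerProductSpace ℝ E] [FiniteDimensional ℝ E]
  [MeasurableSpace E] [BorelSpace E]

/-- Convolution of real functions. -/
def conv (k u : E → ℝ) : E → ℝ := k ⋆[ContinuousLinearMap.lsmul ℝ ℝ, volume] u

lemma conv_apply (k u : E → ℝ) (x : E) : conv k u x = ∫ t, k t * u (x - t) := rfl

lemma fderiv_conv_apply {k u : E → ℝ} (hk : ContDiff ℝ 1 k) (hc : HasCompactSupport k)
    (hu : LocallyIntegrable u) (x e : E) :
    fderiv ℝ (conv k u) x e = conv (fun t => fderiv ℝ k t e) u x := by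
  have h := hc.hasFDerivAt_convolution_left (ContinuousLinearMap.lsmul ℝ ℝ) hk hu x
  have hi : Integrable fun t => (ContinuousLinearMap.precompL E (ContinuousLinearMap.lsmul ℝ ℝ))
      (fderiv ℝ k t) (u (x - t)) :=
    (hc.fderiv ℝ).convolutionExists_left _ (hk.continuous_fderiv (by norm_num)) hu x
  rw [conv, h.fderiv, convolution_def, ContinuousLinearMap.integral_apply hi]
  rfl

lemma contDiff_conv {k u : E → ℝ} (hk : ContDiff ℝ ∞ k) (hc : HasCompactSupport k)
    (hu : LocallyIntegrable u) : ContDiff ℝ ∞ (conv k u) :=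
  hc.contDiff_convolution_left _ hk hu

lemma laplacian_conv {k u : E → ℝ} (hk : ContDiff ℝ ∞ k) (hc : HasCompactSupport k)
    (hu : LocallyIntegrable u) (x : E) :
    laplacian (conv k u) x = conv (laplacian k) u x := by
  have hk1 : ContDiff ℝ ∞ (fderiv ℝ k) := hk.fderiv_right (m := ∞) (by simp)
  have hF : ContDiff ℝ ∞ (conv k u) := contDiff_conv hk hc hu
  have hF1 : ContDiff ℝ ∞ (fderiv ℝ (conv k u)) := hF.fderiv_right (m := ∞) (by simp)
  have e1 : ∀ e : E, fderiv ℝ (fderiv ℝ (conv k u)) x e e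
      = conv (fun t => fderiv ℝ (fderiv ℝ k) t e e) u x := by
    intro e
    have h1 : fderiv ℝ (fun y => fderiv ℝ (conv k u) y e) x e
        = fderiv ℝ (fderiv ℝ (conv k u)) x e e := by
      rw [fderiv_clm_apply (hF1.differentiable (by simp) x) (differentiableAt_const e)]
      simp
    have h2 : ∀ t, fderiv ℝ (fun y => fderiv ℝ k y e) t e = fderiv ℝ (fderiv ℝ k) t e e := by
      intro t
      rw [fderiv_clm_apply (hk1.differentiable (by simp) t) (differentiableAt_const e)]
      simp
    have h3 : (fun y => fderiv ℝ (conv k u) y e) = conv (fun t => fderiv ℝ k t e) u :=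
      funext fun y => fderiv_conv_apply (hk.of_le (by simp)) hc hu y e
    have hk2 : ContDiff ℝ 1 fun t => fderiv ℝ k t e :=
      (hk1.clm_apply contDiff_const).of_le (by simp)
    rw [← h1, h3, fderiv_conv_apply hk2 (hc.fderiv_apply ℝ e) hu]
    simp_rw [h2]
  rw [laplacian_eq_sum_fderiv]
  simp_rw [e1, conv_apply]
  rw [← integral_finsetSum]
  · refine integral_congr_ae (Eventually.of_forall fun t => ?_)
    simp only
    rw [laplacian_eq_sum_fderiv, Finset.sum_mul]
  · intro i _
    have hk2 : ContDiff ℝ ∞ (fderiv ℝ (fderiv ℝ k)) := hk1.fderiv_right (m := ∞) (by simp)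
    have hk3 : Continuous fun t => fderiv ℝ (fderiv ℝ k) t (stdOrthonormalBasis ℝ E i)
      (stdOrthonormalBasis ℝ E i) := by
      have := hk2.continuous
      fun_prop
    have hc3 : HasCompactSupport fun t => fderiv ℝ (fderiv ℝ k) t (stdOrthonormalBasis ℝ E i)
        (stdOrthonormalBasis ℝ E i) := by
      refine ((hc.fderiv ℝ).fderiv ℝ).mono fun t ht h => ht ?_
      simp [h]
    exact hc3.convolutionExists_left (ContinuousLinearMap.lsmul ℝ ℝ) hk3 hu x

lemma conv_eq_integral_sub (k u : E → ℝ) (hk : ∀ t, k (-t) = k t) (x : E) :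
    conv k u x = ∫ y, u y * k (y - x) := by
  rw [conv_apply, ← integral_sub_left_eq_self _ volume x]
  refine integral_congr_ae (Eventually.of_forall fun y => ?_)
  simp only [sub_sub_cancel]
  rw [← hk, neg_sub, mul_comm]

/-- `Δ u = f` in the sense of distributions. -/
def WeakLaplacian (u f : E → ℝ) : Prop :=
  ∀ ψ : E → ℝ, ContDiff ℝ ∞ ψ → HasCompactSupport ψ →
    ∫ x, u x * laplacian ψ x = ∫ x, f x * ψ x

/-- Put both derivatives on the kernel, then use its translate as the test function; evenness of the
kernel turns the convolutions into such pairings. Thus a weak equation becomes a classical one for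
the mollified functions. -/
lemma WeakLaplacian.laplacian_conv {u f : E → ℝ} (h : WeakLaplacian u f)
    (hu : LocallyIntegrable u) {k : E → ℝ} (hk : ContDiff ℝ ∞ k) (hc : HasCompactSupport k)
    (hkn : ∀ t, k (-t) = k t) (x : E) : laplacian (conv k u) x = conv k f x := by
  have hn : ∀ t, laplacian k (-t) = laplacian k t := by
    intro t
    have := laplacian_comp_smul (contDiff_infty.1 hk 2) (-1) t
    simpa [hkn] using this.symm
  rw [SoftPairs.laplacian_conv hk hc hu, conv_eq_integral_sub _ _ hn, conv_eq_integral_sub _ _ hkn]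
  have := h (fun y => k (y - x)) (hk.comp (contDiff_id.sub contDiff_const))
    (hc.comp_homeomorph (Homeomorph.subRight x))
  simp_rw [laplacian_comp_sub_const] at this
  exact this

/-- Convolution with a normalised bump function is an `L¹` contraction. -/
lemma integral_norm_conv_le (ρ : ContDiffBump (0 : E)) {u : E → ℝ} (hu : Integrable u) :
    Integrable (conv (ρ.normed volume) u) ∧
      ∫ x, ‖conv (ρ.normed volume) u x‖ ≤ ∫ x, ‖u x‖ := by
  have hk : Integrable (ρ.normed (volume : Measure E)) := ρ.integrable_normed
  have hi := hk.integrable_convolution (ContinuousLinearMap.lsmul ℝ ℝ) hu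
  have hi' := hk.integrable_convolution (ContinuousLinearMap.lsmul ℝ ℝ) hu.norm
  refine ⟨hi, ?_⟩
  have h1 : ∫ x, (ρ.normed volume ⋆[ContinuousLinearMap.lsmul ℝ ℝ, volume] fun y => ‖u y‖) x
      = ∫ x, ‖u x‖ := by
    rw [integral_convolution (ContinuousLinearMap.lsmul ℝ ℝ) hk hu.norm, ρ.integral_normed]
    simp
  rw [← h1]
  refine integral_mono hi.norm hi' fun x => ?_
  rw [conv_apply]
  refine (norm_integral_le_integral_norm _).trans_eq ?_
  refine integral_congr_ae (Eventually.of_forall fun t => ?_)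
  simp only [norm_mul, Real.norm_of_nonneg (ρ.nonneg_normed t)]
  rfl

/-- Approximate `u` in `L¹` by a continuous compactly supported `h`. By contraction, `k * (u - h)`
and `u - h` each contribute at most `ε/4`, and `k * h - h` is uniformly small on a fixed ball by
uniform continuity. -/
lemma tendsto_integral_norm_conv_sub {ρ : ℕ → ContDiffBump (0 : E)}
    (hρ : Tendsto (fun n => (ρ n).rOut) atTop (𝓝 0)) {u : E → ℝ} (hu : Integrable u) :
    Tendsto (fun n => ∫ x, ‖conv ((ρ n).normed volume) u x - u x‖) atTop (𝓝 0) := by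
  rw [Metric.tendsto_atTop]
  intro ε hε
  obtain ⟨h, hhc, hhε, hh, hhi⟩ := hu.exists_hasCompactSupport_integral_sub_le
    (show 0 < ε / 4 by positivity)
  obtain ⟨r, hr0, hr⟩ := hhc.isCompact.isBounded.subset_closedBall_lt 0 0
  set V := (volume : Measure E).real (Metric.closedBall 0 (r + 1)) with hV
  -- `V` is the volume of a ball containing the supports of `h` and of its mollifications once the
  -- bump radius is below `1`; the denominator `V + 1` makes the uniform bound integrate to at most
  -- `ε/4`.
  have huc : UniformContinuous h := hh.uniformContinuous_of_tendsto_cocompact hhc.is_zero_at_infty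
  obtain ⟨δ, hδ, hδh⟩ := Metric.uniformContinuous_iff.1 huc (ε / 4 / (V + 1)) (by positivity)
  obtain ⟨n0, hn0⟩ := Metric.tendsto_atTop.1 hρ (min δ 1) (by positivity)
  refine ⟨n0, fun n hn => ?_⟩
  have hout : (ρ n).rOut < min δ 1 := by
    have := hn0 n hn
    rwa [Real.dist_eq, sub_zero, abs_of_pos (ρ n).rOut_pos] at this
  set k := (ρ n).normed (volume : Measure E) with hk
  have c1 := integral_norm_conv_le (ρ n) (hu.sub hhi)
  have c2 := integral_norm_conv_le (ρ n) hu
  have c3 := integral_norm_conv_le (ρ n) hhi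
  rw [← hk] at c1 c2 c3
  have hkc : HasCompactSupport k := (ρ n).hasCompactSupport_normed
  have hkcont : Continuous k := (ρ n).continuous_normed
  have hsub : ∀ x, conv k (u - h) x = conv k u x - conv k h x := by
    intro x
    simp only [conv_apply, Pi.sub_apply, mul_sub]
    exact integral_sub
      (hkc.convolutionExists_left (ContinuousLinearMap.lsmul ℝ ℝ) hkcont hu.locallyIntegrable x)
      (hkc.convolutionExists_left (ContinuousLinearMap.lsmul ℝ ℝ) hkcont hhi.locallyIntegrable x)
  have hmid : ∫ x, ‖conv k h x - h x‖ ≤ ε / 4 := by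
    have hb : ∀ x, ‖conv k h x - h x‖
        ≤ (Metric.closedBall (0 : E) (r + 1)).indicator (fun _ => ε / 4 / (V + 1)) x := by
      intro x
      by_cases hx : x ∈ Metric.closedBall (0 : E) (r + 1)
      · rw [Set.indicator_of_mem hx, ← dist_eq_norm]
        refine ContDiffBump.dist_normed_convolution_le hh.aestronglyMeasurable fun y hy => ?_
        exact (hδh (lt_of_lt_of_le hy ((hout.trans_le (min_le_left _ _)).le))).le
      · rw [Set.indicator_of_notMem hx]
        have hz : ∀ y ∈ Metric.ball x (ρ n).rOut, h y = h x := by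
          have hx' : r + 1 < ‖x‖ := by simpa using hx
          have hzero : ∀ y, r < ‖y‖ → h y = 0 := fun y hy =>
            image_eq_zero_of_notMem_tsupport fun hy' => by
              have := hr hy'
              rw [mem_closedBall_zero_iff] at this
              linarith
          intro y hy
          have h1 : dist y x < 1 := lt_of_lt_of_le hy (hout.trans_le (min_le_right _ _)).le
          rw [dist_eq_norm] at h1
          have h2 := norm_sub_norm_le x y
          rw [norm_sub_rev] at h2
          rw [hzero y (by linarith), hzero x (by linarith)]
        have := ContDiffBump.normed_convolution_eq_right (μ := (volume : Measure E)) (φ := ρ n) hz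
        change ‖(k ⋆[ContinuousLinearMap.lsmul ℝ ℝ, volume] h) x - h x‖ ≤ 0
        rw [this]; simp
    refine (integral_mono (c3.1.sub hhi).norm ?_ hb).trans ?_
    · exact (integrable_indicator_iff measurableSet_closedBall).2
        (integrableOn_const (isCompact_closedBall _ _).measure_lt_top.ne)
    · rw [integral_indicator measurableSet_closedBall, setIntegral_const, smul_eq_mul, ← hV]
      have : 0 ≤ V := measureReal_nonneg
      rw [mul_div_assoc']
      rw [div_le_iff₀ (by linarith)]
      nlinarith
  have hfin : ∫ x, ‖conv k u x - u x‖ ≤ ∫ x, (‖conv k (u - h) x‖ + ‖conv k h x - h x‖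
      + ‖u x - h x‖) := by
    refine integral_mono (c2.1.sub hu).norm
      ((c1.1.norm.add (c3.1.sub hhi).norm).add (hu.sub hhi).norm) fun x => ?_
    simp only
    rw [hsub]
    calc ‖conv k u x - u x‖
        = ‖(conv k u x - conv k h x) + (conv k h x - h x) - (u x - h x)‖ := by congr 1; ring
      _ ≤ _ := (norm_sub_le _ _).trans (by gcongr; exact norm_add_le _ _)
  have hsplit : ∫ x, (‖conv k (u - h) x‖ + ‖conv k h x - h x‖ + ‖u x - h x‖)
      = (∫ x, ‖conv k (u - h) x‖) + (∫ x, ‖conv k h x - h x‖) + ∫ x, ‖u x - h x‖ := by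
    have i1 : Integrable fun x => ‖conv k (u - h) x‖ := c1.1.norm
    have i2 : Integrable fun x => ‖conv k h x - h x‖ := (c3.1.sub hhi).norm
    have i3 : Integrable fun x => ‖u x - h x‖ := (hu.sub hhi).norm
    have i4 : Integrable fun x => ‖conv k (u - h) x‖ + ‖conv k h x - h x‖ := i1.add i2
    rw [integral_add i4 i3, integral_add i1 i2]
  have c1' := c1.2
  simp only [Pi.sub_apply] at c1'
  rw [Real.dist_eq, sub_zero, abs_of_nonneg (integral_nonneg fun _ => norm_nonneg _)]
  linarith

end Mollify

/-! ### Kato's inequality and the weak maximum principle -/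

section Kato

open MeasureTheory Filter Topology Laplacian Real

/-- A smooth convex approximation of the positive part. -/
def softPos (s : ℝ) : ℝ := ∫ t in (0 : ℝ)..s, smoothTransition t

lemma hasDerivAt_softPos (s : ℝ) : HasDerivAt softPos (smoothTransition s) s :=
  intervalIntegral.integral_hasDerivAt_right
    (smoothTransition.continuous.intervalIntegrable _ _)
    (smoothTransition.continuous.stronglyMeasurableAtFilter _ _)
    smoothTransition.continuous.continuousAt

lemma deriv_softPos : deriv softPos = smoothTransition :=
  funext fun s => (hasDerivAt_softPos s).deriv

lemma contDiff_softPos : ContDiff ℝ ∞ softPos := by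
  rw [contDiff_infty_iff_deriv, deriv_softPos]
  exact ⟨fun s => (hasDerivAt_softPos s).differentiableAt, smoothTransition.contDiff⟩

lemma softPos_of_nonpos {s : ℝ} (h : s ≤ 0) : softPos s = 0 := by
  rw [softPos, intervalIntegral.integral_congr (g := fun _ => (0 : ℝ))]
  · simp
  · intro t ht
    rw [Set.uIcc_of_ge h] at ht
    exact smoothTransition.zero_of_nonpos ht.2

lemma softPos_pos {s : ℝ} (h : 0 < s) : 0 < softPos s :=
  intervalIntegral.intervalIntegral_pos_of_pos_on
    (smoothTransition.continuous.intervalIntegrable _ _)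
    (fun _ ht => smoothTransition.pos_of_pos ht.1) h

lemma softPos_nonneg (s : ℝ) : 0 ≤ softPos s := by
  rcases le_or_gt s 0 with h | h
  · exact (softPos_of_nonpos h).ge
  · exact (softPos_pos h).le

lemma abs_softPos_sub_le (s t : ℝ) : |softPos s - softPos t| ≤ |s - t| := by
  have := Convex.norm_image_sub_le_of_norm_deriv_le (f := softPos) (C := 1) (s := Set.univ)
    (fun x _ => (hasDerivAt_softPos x).differentiableAt) (fun x _ => by
      rw [deriv_softPos, Real.norm_of_nonneg (smoothTransition.nonneg x)]
      exact smoothTransition.le_one x) convex_univ (Set.mem_univ t) (Set.mem_univ s)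
  simpa using this

lemma abs_softPos_le (s : ℝ) : |softPos s| ≤ |s| := by
  simpa [softPos_of_nonpos le_rfl] using abs_softPos_sub_le s 0

variable {E : Type*} [NormedAddCommGroup E] [InnerProductSpace ℝ E] [FiniteDimensional ℝ E]
  [MeasurableSpace E] [BorelSpace E]

lemma tendsto_integral_of_norm_sub_le {F : ℕ → E → ℝ} {f : E → ℝ} {G : ℕ → E → ℝ} {C : ℝ}
    (hF : ∀ n, Integrable (F n)) (hf : Integrable f) (hG : ∀ n, Integrable (G n))
    (h : ∀ n x, ‖F n x - f x‖ ≤ C * G n x) (hG0 : Tendsto (fun n => ∫ x, G n x) atTop (𝓝 0)) :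
    Tendsto (fun n => ∫ x, F n x) atTop (𝓝 (∫ x, f x)) := by
  rw [tendsto_iff_norm_sub_tendsto_zero]
  have h0 : Tendsto (fun n => C * ∫ x, G n x) atTop (𝓝 0) := by simpa using hG0.const_mul C
  refine squeeze_zero (fun _ => norm_nonneg _) (fun n => ?_) h0
  rw [← integral_sub (hF n) hf, ← integral_const_mul]
  refine (norm_integral_le_integral_norm _).trans ?_
  exact integral_mono ((hF n).sub hf).norm ((hG n).const_mul C) (h n)

omit [MeasurableSpace E] [BorelSpace E] in
-- In the chain rule the gradient term has the coefficient `softPos'' ≥ 0` by convexity and can be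
-- dropped. This is Kato's inequality for smooth functions.
lemma laplacian_softPos_comp {w : E → ℝ} (hw : ContDiff ℝ ∞ w) (x : E) :
    smoothTransition (w x) * laplacian w x ≤ laplacian (fun y => softPos (w y)) x := by
  rw [laplacian_comp (contDiff_infty.1 contDiff_softPos 2).contDiffAt
    (contDiff_infty.1 hw 2).contDiffAt, deriv_softPos]
  have h1 : 0 ≤ deriv smoothTransition (w x) := smoothTransition.monotone.deriv_nonneg
  nlinarith [mul_nonneg h1 (gradSq_nonneg w x)]

/-- **Kato's inequality** for a smooth approximation of the positive part. -/
theorem WeakLaplacian.kato {u f : E → ℝ} (h : WeakLaplacian u f) (hu : LocallyIntegrable u)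
    (hf : LocallyIntegrable f) {ψ : E → ℝ} (hψ : ContDiff ℝ ∞ ψ) (hc : HasCompactSupport ψ)
    (hψ0 : ∀ x, 0 ≤ ψ x) :
    ∫ x, smoothTransition (u x) * f x * ψ x ≤ ∫ x, softPos (u x) * laplacian ψ x := by
  obtain ⟨r, hr0, hr⟩ := hc.isCompact.isBounded.subset_closedBall_lt 0 0
  let ρ : ℕ → ContDiffBump (0 : E) := fun n =>
    ⟨1 / ((n : ℝ) + 1) / 2, 1 / ((n : ℝ) + 1), by positivity, half_lt_self (by positivity)⟩
  have hρ : Tendsto (fun n => (ρ n).rOut) atTop (𝓝 0) := tendsto_one_div_add_atTop_nhds_zero_nat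
  have hρ1 : ∀ n, (ρ n).rOut ≤ 1 := fun n => by
    change 1 / ((n : ℝ) + 1) ≤ 1
    rw [div_le_one (by positivity)]
    linarith [Nat.cast_nonneg (α := ℝ) n]
  set k : ℕ → E → ℝ := fun n => (ρ n).normed volume with hk
  have hkc : ∀ n, HasCompactSupport (k n) := fun n => (ρ n).hasCompactSupport_normed
  have hks : ∀ n, ContDiff ℝ ∞ (k n) := fun n => (ρ n).contDiff_normed
  have hkn : ∀ n t, k n (-t) = k n t := fun n t => (ρ n).normed_neg t
  have hae : ∀ᵐ x, Tendsto (fun n => conv (k n) u x) atTop (𝓝 (u x)) :=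
    ContDiffBump.ae_convolution_tendsto_right_of_locallyIntegrable hρ
      (Eventually.of_forall fun n => show 1 / ((n : ℝ) + 1) ≤ 2 * (1 / ((n : ℝ) + 1) / 2) by
        linarith) hu
  -- Local `L¹` convergence of mollifiers: on the ball of radius `r`, bumps of radius at most `1`
  -- see only the truncation of `v` to the ball of radius `r + 1`, which is integrable.
  have hloc : ∀ {v : E → ℝ}, LocallyIntegrable v → ∃ G : ℕ → E → ℝ, (∀ n, Integrable (G n)) ∧
      (∀ n x, 0 ≤ G n x) ∧
      (∀ n, ∀ x ∈ Metric.closedBall (0 : E) r, |conv (k n) v x - v x| ≤ G n x) ∧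
      Tendsto (fun n => ∫ x, G n x) atTop (𝓝 0) := by
    intro v hv
    set v' := (Metric.closedBall (0 : E) (r + 1)).indicator v with hv'
    have hi : Integrable v' := (integrable_indicator_iff measurableSet_closedBall).2
      (hv.integrableOn_isCompact (isCompact_closedBall _ _))
    refine ⟨fun n x => ‖conv (k n) v' x - v' x‖,
      fun n => ((integral_norm_conv_le (ρ n) hi).1.sub hi).norm, fun _ _ => norm_nonneg _, ?_,
      tendsto_integral_norm_conv_sub hρ hi⟩
    intro n x hx
    have hx' : ‖x‖ ≤ r := by simpa using hx
    have e1 : v' x = v x := Set.indicator_of_mem (by simp; linarith) _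
    have e2 : conv (k n) v' x = conv (k n) v x := by
      rw [conv_apply, conv_apply]
      refine integral_congr_ae (Eventually.of_forall fun t => ?_)
      by_cases ht : t ∈ Function.support (k n)
      · have : ‖t‖ < (ρ n).rOut := by
          rw [hk, (ρ n).support_normed_eq] at ht
          simpa using ht
        have e3 : v' (x - t) = v (x - t) := Set.indicator_of_mem (by
          have := norm_sub_le x t
          simp only [mem_closedBall_zero_iff]
          linarith [hρ1 n]) _
        simp only [e3]
      · simp only [Function.notMem_support.1 ht, zero_mul]
    rw [← e1, ← e2]
    exact le_rfl
  obtain ⟨Gu, hGu1, hGu0, hGu2, hGu3⟩ := hloc hu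
  obtain ⟨Gf, hGf1, hGf0, hGf2, hGf3⟩ := hloc hf
  have hΔc : Continuous (laplacian ψ) := (contDiff_laplacian hψ).continuous
  have hΔs : HasCompactSupport (laplacian ψ) :=
    hc.of_isClosed_subset (isClosed_tsupport _) (tsupport_laplacian_subset ψ)
  obtain ⟨C1, hC1⟩ := hΔs.exists_bound_of_continuous hΔc
  obtain ⟨C2, hC2⟩ := hc.exists_bound_of_continuous hψ.continuous
  have hout : ∀ x ∉ Metric.closedBall (0 : E) r, ψ x = 0 ∧ laplacian ψ x = 0 := fun x hx =>
    ⟨image_eq_zero_of_notMem_tsupport fun h => hx (hr h),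
      image_eq_zero_of_notMem_tsupport fun h => hx (hr (tsupport_laplacian_subset ψ h))⟩
  have hus : ∀ n, ContDiff ℝ ∞ (conv (k n) u) := fun n => contDiff_conv (hks n) (hkc n) hu
  have hfs : ∀ n, ContDiff ℝ ∞ (conv (k n) f) := fun n => contDiff_conv (hks n) (hkc n) hf
  have hst := smoothTransition.continuous
  have hsu : AEStronglyMeasurable (fun x => smoothTransition (u x)) volume :=
    hst.comp_aestronglyMeasurable hu.aestronglyMeasurable
  have hjs : ∀ n, ContDiff ℝ ∞ fun x => softPos (conv (k n) u x) := fun n =>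
    contDiff_softPos.comp (hus n)
  have hlu : LocallyIntegrable fun x => softPos (u x) :=
    hu.mono (contDiff_softPos.continuous.comp_aestronglyMeasurable hu.aestronglyMeasurable)
      (Eventually.of_forall fun x => abs_softPos_le (u x))
  have hfψ : Integrable fun x => f x * ψ x := by
    simpa [mul_comm] using hf.integrable_smul_left_of_hasCompactSupport hψ.continuous hc
  have hA : Tendsto (fun n => ∫ x, softPos (conv (k n) u x) * laplacian ψ x) atTop
      (𝓝 (∫ x, softPos (u x) * laplacian ψ x)) := by
    refine tendsto_integral_of_norm_sub_le (C := C1) (fun n => ?_) ?_ hGu1 (fun n x => ?_) hGu3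
    · exact ((hjs n).continuous.mul hΔc).integrable_of_hasCompactSupport hΔs.mul_left
    · simpa [mul_comm] using hlu.integrable_smul_left_of_hasCompactSupport hΔc hΔs
    · rw [← sub_mul, norm_mul, mul_comm]
      by_cases hx : x ∈ Metric.closedBall (0 : E) r
      · exact mul_le_mul (hC1 x) ((abs_softPos_sub_le _ _).trans (hGu2 n x hx)) (norm_nonneg _)
          ((norm_nonneg _).trans (hC1 x))
      · rw [(hout x hx).2, norm_zero, zero_mul]
        exact mul_nonneg ((norm_nonneg _).trans (hC1 x)) (hGu0 n x)
  have hi1 : ∀ n, Integrable fun x => smoothTransition (conv (k n) u x) * f x * ψ x := by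
    intro n
    refine hfψ.mono ?_ (Eventually.of_forall fun x => ?_)
    · exact ((hst.comp (hus n).continuous).aestronglyMeasurable.mul hf.aestronglyMeasurable).mul
        hψ.continuous.aestronglyMeasurable
    · rw [mul_assoc, norm_mul, Real.norm_of_nonneg (smoothTransition.nonneg _)]
      exact mul_le_of_le_one_left (norm_nonneg _) (smoothTransition.le_one _)
  have hi2 : ∀ n, Integrable fun x =>
      smoothTransition (conv (k n) u x) * conv (k n) f x * ψ x := fun n =>
    (((hst.comp (hus n).continuous).mul (hfs n).continuous).mul
      hψ.continuous).integrable_of_hasCompactSupport hc.mul_left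
  -- The product of two converging factors is split: first the mollified `f` is replaced by `f`,
  -- with an error small in `L¹`; afterwards `f` is fixed and the a.e. convergence of the bounded
  -- factor suffices.
  have hB1 : Tendsto (fun n => ∫ x, smoothTransition (conv (k n) u x) *
      (conv (k n) f x - f x) * ψ x) atTop (𝓝 (∫ _ : E, (0 : ℝ))) := by
    refine tendsto_integral_of_norm_sub_le (C := C2) (fun n => ?_) (integrable_zero _ _ _) hGf1
      (fun n x => ?_) hGf3
    · refine ((hi2 n).sub (hi1 n)).congr (Eventually.of_forall fun x => ?_)
      simp only [Pi.sub_apply]; ring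
    · rw [sub_zero, norm_mul, norm_mul, Real.norm_of_nonneg (smoothTransition.nonneg _), mul_comm]
      by_cases hx : x ∈ Metric.closedBall (0 : E) r
      · refine mul_le_mul (hC2 x) ?_ (mul_nonneg (smoothTransition.nonneg _) (norm_nonneg _))
          ((norm_nonneg _).trans (hC2 x))
        exact (mul_le_of_le_one_left (norm_nonneg _) (smoothTransition.le_one _)).trans
          (hGf2 n x hx)
      · rw [(hout x hx).1, norm_zero, zero_mul]
        exact mul_nonneg ((norm_nonneg _).trans (hC2 x)) (hGf0 n x)
  have hB2 : Tendsto (fun n => ∫ x, smoothTransition (conv (k n) u x) * f x * ψ x) atTop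
      (𝓝 (∫ x, smoothTransition (u x) * f x * ψ x)) := by
    refine tendsto_integral_of_dominated_convergence (fun x => ‖f x * ψ x‖)
      (fun n => (hi1 n).aestronglyMeasurable) hfψ.norm (fun n => Eventually.of_forall fun x => ?_)
      ?_
    · rw [mul_assoc, norm_mul, Real.norm_of_nonneg (smoothTransition.nonneg _)]
      exact mul_le_of_le_one_left (norm_nonneg _) (smoothTransition.le_one _)
    · filter_upwards [hae] with x hx
      exact (((hst.tendsto _).comp hx).mul_const _).mul_const _
  have hB := hB1.add hB2
  rw [integral_zero, zero_add] at hB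
  refine le_of_tendsto_of_tendsto' hB hA fun n => ?_
  have e1 : ∫ x, softPos (conv (k n) u x) * laplacian ψ x
      = ∫ x, laplacian (fun y => softPos (conv (k n) u y)) x * ψ x :=
    integral_mul_laplacian (hjs n) hψ hc
  have i3 : Integrable fun x => smoothTransition (conv (k n) u x) *
      (conv (k n) f x - f x) * ψ x := by
    refine ((hi2 n).sub (hi1 n)).congr (Eventually.of_forall fun x => ?_)
    simp only [Pi.sub_apply]; ring
  rw [e1, ← integral_add i3 (hi1 n)]
  refine integral_mono (i3.add (hi1 n)) ?_ fun x => ?_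
  · exact ((contDiff_laplacian (hjs n)).continuous.mul
      hψ.continuous).integrable_of_hasCompactSupport hc.mul_left
  · simp only
    rw [← add_mul, ← mul_add, sub_add_cancel]
    refine mul_le_mul_of_nonneg_right ?_ (hψ0 x)
    rw [← h.laplacian_conv hu (hks n) (hkc n) (hkn n)]
    exact laplacian_softPos_comp (hus n) x

omit [FiniteDimensional ℝ E] [MeasurableSpace E] [BorelSpace E] in
lemma fderiv_norm_sq_eq (x : E) :
    fderiv ℝ (fun y : E => ‖y‖ ^ 2) x = (2 : ℝ) • innerSL ℝ x := by
  have := (hasStrictFDerivAt_norm_sq x).hasFDerivAt.fderiv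
  rw [this, two_smul, two_smul]

omit [MeasurableSpace E] [BorelSpace E] in
lemma laplacian_norm_sq (x : E) :
    laplacian (fun y : E => ‖y‖ ^ 2) x = 2 * Module.finrank ℝ E := by
  let L : E →L[ℝ] E →L[ℝ] ℝ := (2 : ℝ) • innerSL ℝ
  have h1 : fderiv ℝ (fun y : E => ‖y‖ ^ 2) = ⇑L := funext fun y => fderiv_norm_sq_eq y
  rw [laplacian_eq_sum_fderiv, h1, L.fderiv]
  have h2 : ∀ i, L (stdOrthonormalBasis ℝ E i) (stdOrthonormalBasis ℝ E i) = 2 := by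
    intro i
    change (2 : ℝ) * ⟪stdOrthonormalBasis ℝ E i, stdOrthonormalBasis ℝ E i⟫_ℝ = 2
    rw [real_inner_self_eq_norm_sq]
    simp
  simp [h2, mul_comm]

omit [MeasurableSpace E] [BorelSpace E] in
lemma gradSq_norm_sq (x : E) : gradSq (fun y : E => ‖y‖ ^ 2) x = 4 * ‖x‖ ^ 2 := by
  rw [gradSq, fderiv_norm_sq_eq, ← (stdOrthonormalBasis ℝ E).sum_sq_norm_inner_left x,
    Finset.mul_sum]
  refine Finset.sum_congr rfl fun i _ => ?_
  simp
  ring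

/-- The weak maximum principle: a function with `Δ u ≥ 0` where `u > 0`, and `u ≤ 0` on a shell
outside a ball, is nonpositive in the ball. -/
theorem WeakLaplacian.ae_nonpos {u f : E → ℝ} (h : WeakLaplacian u f) (hu : LocallyIntegrable u)
    (hf : LocallyIntegrable f) (hfu : ∀ x, 0 < u x → 0 ≤ f x) {r r' : ℝ} (hr : 0 < r)
    (hrr : r < r') (hshell : ∀ x, r ≤ ‖x‖ → ‖x‖ ≤ r' → u x ≤ 0) [Nontrivial E] :
    ∀ᵐ x, ‖x‖ ≤ r' → u x ≤ 0 := by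
  let χ : ContDiffBump (0 : E) := ⟨r, r', hr, hrr⟩
  -- The test function is this paraboloid times a cutoff. Its Laplacian is the constant `-2 dim E`
  -- on the inner ball; where the cutoff varies, the positive part of `u` vanishes by the shell
  -- hypothesis. Kato then reads `0 ≤ -2 dim E ∫ softPos u` over the inner ball, forcing `u ≤ 0`
  -- there.
  set q : E → ℝ := fun x => r' ^ 2 - ‖x‖ ^ 2 with hq
  have hqs : ContDiff ℝ ∞ q := contDiff_const.sub (contDiff_norm_sq ℝ)
  set ψ : E → ℝ := fun x => χ x * q x with hψd
  have hψ : ContDiff ℝ ∞ ψ := χ.contDiff.mul hqs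
  have hc : HasCompactSupport ψ := χ.hasCompactSupport.mul_right
  have hψ0 : ∀ x, 0 ≤ ψ x := by
    intro x
    by_cases hx : ‖x‖ < r'
    · exact mul_nonneg χ.nonneg (by simp only [hq]; nlinarith [norm_nonneg x])
    · rw [hψd]
      simp only
      rw [χ.zero_of_le_dist (by simpa using not_lt.1 hx), zero_mul]
  have key := h.kato hu hf hψ hc hψ0
  have h1 : 0 ≤ ∫ x, smoothTransition (u x) * f x * ψ x := by
    refine integral_nonneg fun x => mul_nonneg ?_ (hψ0 x)
    by_cases hx : 0 < u x
    · exact mul_nonneg (smoothTransition.nonneg _) (hfu x hx)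
    · rw [smoothTransition.zero_of_nonpos (not_lt.1 hx), zero_mul]
  have hN : (0 : ℝ) < Module.finrank ℝ E := by exact_mod_cast Module.finrank_pos
  have hint : ∀ x, softPos (u x) * laplacian ψ x = -(2 * Module.finrank ℝ E) *
      (Metric.ball (0 : E) r).indicator (fun x => softPos (u x)) x := by
    intro x
    by_cases hx : x ∈ Metric.ball (0 : E) r
    · have : ψ =ᶠ[𝓝 x] fun y => r' ^ 2 - ‖y‖ ^ 2 := by
        filter_upwards [Metric.isOpen_ball.mem_nhds hx] with y hy
        rw [hψd]
        simp only
        rw [χ.one_of_mem_closedBall (Metric.ball_subset_closedBall hy), one_mul]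
      rw [Set.indicator_of_mem hx, (InnerProductSpace.laplacian_congr_nhds this).eq_of_nhds]
      have e : laplacian (fun y : E => r' ^ 2 - ‖y‖ ^ 2) x = -(2 * Module.finrank ℝ E) := by
        have := ContDiffAt.laplacian_sub (f₁ := fun _ : E => r' ^ 2) (f₂ := fun y : E => ‖y‖ ^ 2)
          (x := x) contDiffAt_const (contDiff_norm_sq ℝ).contDiffAt
        rw [laplacian_norm_sq] at this
        simpa [Pi.sub_def] using this
      rw [e]; ring
    · rw [Set.indicator_of_notMem hx, mul_zero]
      have hx' : r ≤ ‖x‖ := by simpa using hx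
      by_cases hx2 : ‖x‖ ≤ r'
      · rw [softPos_of_nonpos (hshell x hx' hx2), zero_mul]
      · have : laplacian ψ x = 0 := by
          refine image_eq_zero_of_notMem_tsupport fun hm => hx2 ?_
          have h2 := tsupport_mul_subset_left (tsupport_laplacian_subset ψ hm)
          rw [χ.tsupport_eq] at h2
          simpa using h2
        rw [this, mul_zero]
  simp_rw [hint] at key
  rw [integral_const_mul] at key
  have hlu : LocallyIntegrable fun x => softPos (u x) :=
    hu.mono (contDiff_softPos.continuous.comp_aestronglyMeasurable hu.aestronglyMeasurable)
      (Eventually.of_forall fun x => abs_softPos_le (u x))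
  have hI : Integrable ((Metric.ball (0 : E) r).indicator fun x => softPos (u x)) :=
    (integrable_indicator_iff measurableSet_ball).2
      ((hlu.integrableOn_isCompact (isCompact_closedBall 0 r)).mono_set
        Metric.ball_subset_closedBall)
  have hI0 : 0 ≤ (Metric.ball (0 : E) r).indicator fun x => softPos (u x) :=
    Set.indicator_nonneg fun x _ => softPos_nonneg _
  have hz : ∫ x, (Metric.ball (0 : E) r).indicator (fun x => softPos (u x)) x = 0 := by
    refine le_antisymm ?_ (integral_nonneg hI0)
    by_contra hcon
    nlinarith [not_le.1 hcon]
  have := (integral_eq_zero_iff_of_nonneg hI0 hI).1 hz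
  filter_upwards [this] with x hx hxr
  by_cases hxb : x ∈ Metric.ball (0 : E) r
  · rw [Set.indicator_of_mem hxb] at hx
    by_contra hcon
    exact (softPos_pos (not_le.1 hcon)).ne' hx
  · exact hshell x (by simpa using hxb) hxr

end Kato

/-! ### Pointwise bounds on the scattering solution -/

section Scattering

open MeasureTheory Filter Topology Laplacian

lemma nontrivial_space {d : ℕ} (hd : d = 2 ∨ d = 3) : Nontrivial (Space d) := by
  refine Module.nontrivial_of_finrank_pos (R := ℝ) ?_
  rw [finrank_euclideanSpace_fin]; omega

variable {E : Type*} [NormedAddCommGroup E] [InnerProductSpace ℝ E] [FiniteDimensional ℝ E]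
  [MeasurableSpace E] [BorelSpace E]

lemma integrable_mul_laplacian {u : E → ℝ} (hu : LocallyIntegrable u) {ψ : E → ℝ}
    (hψ : ContDiff ℝ ∞ ψ) (hc : HasCompactSupport ψ) :
    Integrable fun x => u x * laplacian ψ x := by
  simpa [mul_comm] using hu.integrable_smul_left_of_hasCompactSupport
    (contDiff_laplacian hψ).continuous
    (hc.of_isClosed_subset (isClosed_tsupport _) (tsupport_laplacian_subset ψ))

lemma integrable_mul_test {u : E → ℝ} (hu : LocallyIntegrable u) {ψ : E → ℝ}
    (hψ : ContDiff ℝ ∞ ψ) (hc : HasCompactSupport ψ) : Integrable fun x => u x * ψ x := by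
  simpa [mul_comm] using hu.integrable_smul_left_of_hasCompactSupport hψ.continuous hc

lemma WeakLaplacian.congr_ae {u u' f f' : E → ℝ} (h : WeakLaplacian u f) (hu : u =ᵐ[volume] u')
    (hf : f =ᵐ[volume] f') : WeakLaplacian u' f' := by
  intro ψ hψ hc
  have h1 : ∫ x, u x * laplacian ψ x = ∫ x, u' x * laplacian ψ x :=
    integral_congr_ae (hu.mul (EventuallyEq.refl _ (laplacian ψ)))
  have h2 : ∫ x, f x * ψ x = ∫ x, f' x * ψ x :=
    integral_congr_ae (hf.mul (EventuallyEq.refl _ ψ))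
  rw [← h1, ← h2, h ψ hψ hc]

lemma integral_laplacian_eq_zero {ψ : E → ℝ} (hψ : ContDiff ℝ ∞ ψ) (hc : HasCompactSupport ψ) :
    ∫ x, laplacian ψ x = 0 := by
  have := integral_mul_laplacian (f := fun _ => (1 : ℝ)) contDiff_const hψ hc
  simpa using this

lemma WeakLaplacian.sub_const {u f : E → ℝ} (h : WeakLaplacian u f) (hu : LocallyIntegrable u)
    (c : ℝ) : WeakLaplacian (fun x => u x - c) f := by
  intro ψ hψ hc
  have hi : Integrable fun x => c * laplacian ψ x :=
    integrable_mul_laplacian (locallyIntegrable_const c) hψ hc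
  simp_rw [sub_mul]
  rw [integral_sub (integrable_mul_laplacian hu hψ hc) hi, integral_const_mul,
    integral_laplacian_eq_zero hψ hc, mul_zero, sub_zero]
  exact h ψ hψ hc

lemma WeakLaplacian.const_mul {u f : E → ℝ} (h : WeakLaplacian u f) (c : ℝ) :
    WeakLaplacian (fun x => c * u x) (fun x => c * f x) := by
  intro ψ hψ hc
  simp_rw [mul_assoc, integral_const_mul]
  rw [h ψ hψ hc]

variable {d : ℕ} {G : BoseGas d}

lemma BoseGas.Admissible.weakLaplacian (hG : G.Admissible) :
    WeakLaplacian G.φ₀ fun x => 1 / 2 * (G.v x * G.φ₀ x) := by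
  intro ψ hψ hc
  have h := hG.scattering.equation ψ hψ hc
  have i1 := integrable_mul_laplacian hG.scattering.locallyIntegrable hψ hc
  have i2 : Integrable fun x => 1 / 2 * (G.v x * G.φ₀ x) * ψ x := by
    simp_rw [mul_assoc (1 / 2 : ℝ)]
    exact (integrable_mul_test hG.scattering.locallyIntegrable_mul hψ hc).const_mul _
  have i3 : Integrable fun x => -(G.φ₀ x * laplacian ψ x) := i1.neg
  rw [integral_add i3 i2, integral_neg] at h
  linarith

/-- Maximum principle for `-φ₀`: where it is positive, its Laplacian `-v φ₀ / 2` is nonnegative, and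
beyond `max R a` the explicit formula gives `φ₀ ≥ 0`. -/
lemma BoseGas.Admissible.ae_nonneg (hG : G.Admissible) (hd : d = 2 ∨ d = 3) :
    ∀ᵐ x, 0 ≤ G.φ₀ x := by
  have := nontrivial_space hd
  have hout : ∀ x, max G.R G.a ≤ ‖x‖ → 0 ≤ G.φ₀ x := by
    intro x hx
    have ha := hG.a_pos
    have h1 : G.a ≤ ‖x‖ := (le_max_right _ _).trans hx
    rw [hG.scattering.outside x ((le_max_left _ _).trans hx)]
    split_ifs
    · exact Real.log_nonneg ((one_le_div ha).2 h1)
    · rw [sub_nonneg]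
      exact (div_le_one (ha.trans_le h1)).2 h1
  have h := (hG.weakLaplacian.const_mul (-1)).ae_nonpos (r := max G.R G.a)
    (r' := max G.R G.a + 1) (hG.scattering.locallyIntegrable.smul (-1 : ℝ))
    ((hG.scattering.locallyIntegrable_mul.smul (1 / 2 : ℝ)).smul (-1 : ℝ))
    (fun x hx => ?_) (lt_max_of_lt_left hG.R_pos) (by linarith) (fun x hx _ => ?_)
  · filter_upwards [h] with x hx
    rcases le_total (max G.R G.a) ‖x‖ with h1 | h1
    · exact hout x h1
    · linarith [hx (by linarith)]
  · have h1 : G.φ₀ x ≤ 0 := by linarith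
    have := mul_nonpos_of_nonneg_of_nonpos (hG.nonneg x) h1
    linarith
  · linarith [hout x hx]

/-- Since `v φ₀ ≥ 0` almost everywhere, `φ₀ - c` is subharmonic, and a bound on a shell outside the
potential propagates inwards. -/
lemma BoseGas.Admissible.ae_le_of_shell (hG : G.Admissible) (hd : d = 2 ∨ d = 3) {c R' : ℝ}
    (hR : G.R < R') (hc : ∀ x, G.R ≤ ‖x‖ → ‖x‖ ≤ R' → G.φ₀ x ≤ c) :
    ∀ᵐ x, ‖x‖ ≤ R' → G.φ₀ x ≤ c := by
  have := nontrivial_space hd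
  have hae := hG.ae_nonneg hd
  -- The absolute value alters the source on a null set only, and makes it nonnegative at every
  -- point, as `WeakLaplacian.ae_nonpos` asks.
  have hw : WeakLaplacian (fun x => G.φ₀ x - c) fun x => 1 / 2 * |G.v x * G.φ₀ x| := by
    refine (hG.weakLaplacian.sub_const hG.scattering.locallyIntegrable c).congr_ae
      (EventuallyEq.refl _ _) ?_
    filter_upwards [hae] with x hx
    rw [abs_of_nonneg (mul_nonneg (hG.nonneg x) hx)]
  have h := hw.ae_nonpos (r := G.R) (r' := R')
    (hG.scattering.locallyIntegrable.sub (locallyIntegrable_const c))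
    (LocallyIntegrable.smul (hG.scattering.locallyIntegrable_mul.mono
      hG.scattering.locallyIntegrable_mul.aestronglyMeasurable.norm
      (Eventually.of_forall fun x => (norm_norm _).le)) (1 / 2 : ℝ))
    (fun x _ => by positivity) hG.R_pos hR (fun x hx hx' => by linarith [hc x hx hx'])
  filter_upwards [h] with x hx hxR
  linarith [hx hxR]

lemma BoseGas.Admissible.ae_le_log {G : BoseGas 2} (hG : G.Admissible) {R' : ℝ}
    (hR : G.R < R') : ∀ᵐ x, ‖x‖ ≤ R' → G.φ₀ x ≤ Real.log (R' / G.a) := by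
  refine hG.ae_le_of_shell (Or.inl rfl) hR fun x hx hx' => ?_
  rw [hG.scattering.outside x hx, if_pos rfl]
  have := hG.a_pos
  have h2 := hG.R_pos.trans_le hx
  gcongr

lemma BoseGas.Admissible.ae_le_one {G : BoseGas 3} (hG : G.Admissible) :
    ∀ᵐ x, G.φ₀ x ≤ 1 := by
  have hout : ∀ x, G.R ≤ ‖x‖ → G.φ₀ x ≤ 1 := fun x hx => by
    rw [hG.scattering.outside x hx, if_neg (by norm_num)]
    have := div_nonneg hG.a_pos.le (norm_nonneg x)
    linarith
  have h := hG.ae_le_of_shell (Or.inr rfl) (c := 1) (lt_add_one G.R) fun x hx _ => hout x hx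
  filter_upwards [h] with x hx
  rcases le_total G.R ‖x‖ with h1 | h1
  · exact hout x h1
  · exact hx (by linarith)

end Scattering

/-! ### Fourier coefficients on the unit torus and Parseval's identity -/

section Torus

open MeasureTheory Filter Topology

attribute [local instance] instMeasureSpaceUnitAddCircle

variable {d : ℕ}

/-- The momentum `2π m` of the unit torus. -/
def unitMom (m : Mode d) : Space d := WithLp.toLp 2 fun i => 2 * Real.pi * (m i : ℝ)

/-- The Fourier coefficient `∫ e^{-2πi m·y} f(y) dy`. -/
def unitFourier (f : Space d → ℝ) (m : Mode d) : ℂ :=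
  ∫ y : Space d, Complex.exp (-(Complex.I * ((⟪unitMom m, y⟫_ℝ : ℝ) : ℂ))) * (f y : ℂ)

/-- A function supported in the unit box, as a function on the unit torus. -/
def toTorus (f : Space d → ℝ) (t : UnitAddTorus (Fin d)) : ℂ :=
  f (WithLp.toLp 2 fun i => (AddCircle.equivIoc 1 (-1 / 2) (t i)).1)

/-- The unit box. -/
def unitBox (d : ℕ) : Set (Fin d → ℝ) := {x | ∀ i, x i ∈ Set.Ioc (-1 / 2 : ℝ) (-1 / 2 + 1)}

lemma measurableSet_unitBox : MeasurableSet (unitBox d) := by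
  have : unitBox d = Set.pi Set.univ fun _ => Set.Ioc (-1 / 2 : ℝ) (-1 / 2 + 1) := by
    ext x; simp [unitBox]
  rw [this]
  exact MeasurableSet.univ_pi fun _ => measurableSet_Ioc

lemma toTorus_coe (f : Space d → ℝ) {x : Fin d → ℝ} (hx : x ∈ unitBox d) :
    toTorus f (fun i => (x i : UnitAddCircle)) = f (WithLp.toLp 2 x) := by
  have : (fun i => (AddCircle.equivIoc (1 : ℝ) (-1 / 2) (x i : UnitAddCircle)).1) = x := by
    funext i
    rw [AddCircle.equivIoc_coe_eq (hx i)]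
  rw [toTorus, this]

lemma eq_zero_of_notMem_unitBox {f : Space d → ℝ} (hf : ∀ y, 1 / 2 ≤ ‖y‖ → f y = 0)
    {x : Fin d → ℝ} (hx : x ∉ unitBox d) : f (WithLp.toLp 2 x) = 0 := by
  refine hf _ ?_
  by_contra hcon
  refine hx fun i => ?_
  have := PiLp.norm_apply_le (WithLp.toLp 2 x : Space d) i
  have h2 := abs_lt.1 (lt_of_le_of_lt this (not_le.1 hcon))
  exact ⟨by linarith [h2.1], by linarith [h2.2]⟩

/-- A function vanishing outside the open ball of radius `1/2` lives in one fundamental cell, so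
integrals over the torus are integrals over the whole space. -/
lemma integral_toTorus_mul (h : UnitAddTorus (Fin d) → ℂ) (f : Space d → ℝ)
    (hf : ∀ y, 1 / 2 ≤ ‖y‖ → f y = 0) :
    ∫ t, h t * toTorus f t
      = ∫ y : Space d, h (fun i => (y i : UnitAddCircle)) * (f y : ℂ) := by
  rw [UnitAddTorus.integral_preimage _ fun _ => (-1 / 2 : ℝ),
    ← (PiLp.volume_preserving_toLp (Fin d)).integral_comp
      (MeasurableEquiv.toLp 2 (Fin d → ℝ)).measurableEmbedding]
  change ∫ x in unitBox d, _ = _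
  rw [← integral_indicator measurableSet_unitBox]
  refine integral_congr_ae (Eventually.of_forall fun x => ?_)
  by_cases hx : x ∈ unitBox d
  · simp only [Set.indicator_of_mem hx, toTorus_coe f hx]
  · simp only [Set.indicator_of_notMem hx]
    rw [eq_zero_of_notMem_unitBox hf hx]; simp

lemma mFourier_coe (m : Mode d) (y : Space d) :
    UnitAddTorus.mFourier (-m) (fun i => (y i : UnitAddCircle))
      = Complex.exp (-(Complex.I * ((⟪unitMom m, y⟫_ℝ : ℝ) : ℂ))) := by
  simp only [UnitAddTorus.mFourier, ContinuousMap.coe_mk, Pi.neg_apply]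
  have : ∀ i, _root_.fourier (-m i) (y i : UnitAddCircle)
      = Complex.exp (-(Complex.I * ((2 * Real.pi * (m i : ℝ) * y i : ℝ) : ℂ))) := by
    intro i
    rw [fourier_coe_apply]
    congr 1
    push_cast
    ring
  simp_rw [this, ← Complex.exp_sum, PiLp.inner_apply, unitMom]
  congr 1
  rw [Finset.sum_neg_distrib, ← Finset.mul_sum]
  congr 2
  push_cast
  refine Finset.sum_congr rfl fun i _ => ?_
  simp
  ring

lemma mFourierCoeff_toTorus {f : Space d → ℝ} (hf : ∀ y, 1 / 2 ≤ ‖y‖ → f y = 0) (m : Mode d) :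
    UnitAddTorus.mFourierCoeff (toTorus f) m = unitFourier f m := by
  rw [UnitAddTorus.mFourierCoeff, unitFourier]
  simp_rw [smul_eq_mul]
  rw [integral_toTorus_mul _ f hf]
  simp_rw [mFourier_coe]

lemma memLp_toTorus {f : Space d → ℝ} (hf : MemLp f 2) : MemLp (toTorus f) 2 := by
  have h1 : MemLp (fun x : Fin d → ℝ => (f (WithLp.toLp 2 x) : ℂ)) 2 :=
    (hf.comp_measurePreserving (PiLp.volume_preserving_toLp (Fin d))).ofReal
  have h2 : MemLp (fun x : {x : Fin d → ℝ // ∀ i, x i ∈ Set.Ioc (-1 / 2 : ℝ) (-1 / 2 + 1)} =>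
      (f (WithLp.toLp 2 x.1) : ℂ)) 2 (Measure.comap Subtype.val volume) := by
    have := (MeasurableEmbedding.subtype_coe (measurableSet_unitBox (d := d))).memLp_map_measure_iff
      (μ := Measure.comap Subtype.val volume) (p := 2)
      (g := fun x : Fin d → ℝ => (f (WithLp.toLp 2 x) : ℂ))
    refine this.1 ?_
    rw [map_comap_subtype_coe measurableSet_unitBox]
    exact h1.restrict _
  exact h2.comp_measurePreserving (UnitAddTorus.measurePreserving_equivPiIoc fun _ => (-1 / 2 : ℝ))

lemma mFourierCoeff_toLp_toTorus {u : Space d → ℝ} (hu : ∀ y, 1 / 2 ≤ ‖y‖ → u y = 0)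
    (hu2 : MemLp (toTorus u) 2) (m : Mode d) :
    UnitAddTorus.mFourierCoeff (hu2.toLp (toTorus u)) m = unitFourier u m := by
  rw [← mFourierCoeff_toTorus hu]
  exact integral_congr_ae ((EventuallyEq.refl _ _).mul hu2.coeFn_toLp)

lemma integral_conj_toTorus_mul {f g : Space d → ℝ} (hg : ∀ y, 1 / 2 ≤ ‖y‖ → g y = 0) :
    ∫ t, conj (toTorus f t) * toTorus g t = ((∫ y, f y * g y : ℝ) : ℂ) := by
  rw [integral_toTorus_mul _ g hg, ← integral_complex_ofReal]
  refine integral_congr_ae (Eventually.of_forall fun y => ?_)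
  simp only
  by_cases hy : WithLp.ofLp y ∈ unitBox d
  · rw [toTorus_coe f hy]; simp
  · have := eq_zero_of_notMem_unitBox hg hy
    rw [WithLp.toLp_ofLp] at this
    simp [this]

lemma hasSum_mFourierCoeff_mul {F G : UnitAddTorus (Fin d) → ℂ} (hF : MemLp F 2)
    (hG : MemLp G 2) :
    HasSum (fun m : Mode d => conj (UnitAddTorus.mFourierCoeff (hF.toLp F) m)
      * UnitAddTorus.mFourierCoeff (hG.toLp G) m) (∫ t, conj (F t) * G t) := by
  have : ∫ t, conj ((hF.toLp F) t) * (hG.toLp G) t = ∫ t, conj (F t) * G t := by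
    refine integral_congr_ae ?_
    filter_upwards [hF.coeFn_toLp, hG.coeFn_toLp] with t h1 h2
    rw [h1, h2]
  rw [← this]
  exact UnitAddTorus.hasSum_prod_mFourierCoeff (hF.toLp F) (hG.toLp G)

/-- **Parseval's identity** for functions supported in the ball of radius `1/2`. -/
lemma hasSum_unitFourier {f g : Space d → ℝ} (hf : ∀ y, 1 / 2 ≤ ‖y‖ → f y = 0)
    (hg : ∀ y, 1 / 2 ≤ ‖y‖ → g y = 0) (hf2 : MemLp f 2) (hg2 : MemLp g 2) :
    HasSum (fun m : Mode d => conj (unitFourier f m) * unitFourier g m)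
      ((∫ y, f y * g y : ℝ) : ℂ) := by
  have key := hasSum_mFourierCoeff_mul (memLp_toTorus hf2) (memLp_toTorus hg2)
  rw [integral_conj_toTorus_mul hg] at key
  simp_rw [mFourierCoeff_toLp_toTorus hf, mFourierCoeff_toLp_toTorus hg] at key
  exact key

/-- The lattice sum converges because `4 > d`; the mode `m = 0` contributes `0` by the convention
for inverses. -/
lemma summable_inv_norm_unitMom (hd : d = 2 ∨ d = 3) :
    Summable fun m : Mode d => (‖unitMom m‖ ^ 4)⁻¹ := by
  let b := (EuclideanSpace.basisFun (Fin d) ℝ).toBasis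
  let L := Submodule.span ℤ (Set.range b)
  have hfin : Module.finrank ℤ L < 4 := by
    rw [ZLattice.rank ℝ L, finrank_euclideanSpace_fin]; omega
  have h1 := ZLattice.summable_norm_pow_inv L 4 hfin
  let e : Mode d → L := fun m => ⟨WithLp.toLp 2 fun i => (m i : ℝ), by
    have : (WithLp.toLp 2 fun i => (m i : ℝ) : Space d) = ∑ i, m i • b i := by
      ext j
      simp [b, EuclideanSpace.basisFun_apply, Finset.sum_apply, Pi.single_apply]
    rw [this]
    exact Submodule.sum_mem _ fun i _ => Submodule.smul_mem _ _ (Submodule.subset_span ⟨i, rfl⟩)⟩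
  have he : Function.Injective e := by
    intro m m' h
    funext i
    have := congrArg (fun x : L => (x : Space d) i) h
    simpa [e] using this
  have h2 := (h1.comp_injective he).mul_left ((2 * Real.pi) ^ 4)⁻¹
  refine h2.congr fun m => ?_
  have : unitMom m = (2 * Real.pi) • ((e m : L) : Space d) := by
    ext i; simp [unitMom, e]
  rw [this, norm_smul, Real.norm_of_nonneg (by positivity), mul_pow (2 * Real.pi), mul_inv,
    ← inv_pow ‖((e m : L) : Space d)‖]
  rfl

end Torus

/-! ### The fundamental solution and its regularisation -/

section FundamentalSolution

open MeasureTheory Filter Topology Laplacian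

variable {d : ℕ}

/-- The radial harmonic function on `ℝ^d \ {0}`, up to normalisation. -/
def fundSol (d : ℕ) (y : Space d) : ℝ := if d = 2 then Real.log ‖y‖ else ‖y‖⁻¹

lemma contDiffAt_fundSol {y : Space d} (hy : y ≠ 0) : ContDiffAt ℝ ∞ (fundSol d) y := by
  have h := contDiffAt_norm ℝ (n := ∞) hy
  have h0 := norm_ne_zero_iff.2 hy
  unfold fundSol
  split_ifs
  · exact h.log h0
  · exact h.inv h0

lemma deriv_half_log {s : ℝ} : deriv (fun s : ℝ => Real.log s / 2) s = s⁻¹ / 2 := by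
  rw [deriv_div_const, Real.deriv_log]

/-- Written as a function of `‖y‖²`, which is smooth everywhere with explicit gradient and
Laplacian, the radial computation reduces to the one-variable chain rule `laplacian_comp`. -/
lemma laplacian_fundSol (hd : d = 2 ∨ d = 3) {y : Space d} (hy : y ≠ 0) :
    laplacian (fundSol d) y = 0 := by
  have h0 : 0 < ‖y‖ := norm_pos_iff.2 hy
  have hs : 0 < ‖y‖ ^ 2 := by positivity
  have hw : ContDiffAt ℝ 2 (fun y : Space d => ‖y‖ ^ 2) y := (contDiff_norm_sq ℝ).contDiffAt
  rcases hd with rfl | rfl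
  · have e : fundSol 2 = fun y => (fun s => Real.log s / 2) (‖y‖ ^ 2) := by
      funext x
      simp [fundSol]
    have hj : ContDiffAt ℝ 2 (fun s : ℝ => Real.log s / 2) (‖y‖ ^ 2) :=
      (Real.contDiffAt_log.2 hs.ne').div_const _
    have h2 : deriv (deriv fun s : ℝ => Real.log s / 2) (‖y‖ ^ 2) = -((‖y‖ ^ 2) ^ 2)⁻¹ / 2 := by
      rw [show deriv (fun s : ℝ => Real.log s / 2) = fun s => s⁻¹ / 2 from
        funext fun s => deriv_half_log, deriv_div_const, deriv_inv]
    rw [e, laplacian_comp (w := fun y : Space 2 => ‖y‖ ^ 2) hj hw, h2, deriv_half_log, laplacian_norm_sq, gradSq_norm_sq,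
      finrank_euclideanSpace_fin]
    field_simp
    norm_num
  · have e : fundSol 3 = fun y => (fun s : ℝ => s ^ (-1 / 2 : ℝ)) (‖y‖ ^ 2) := by
      funext x
      rw [fundSol, if_neg (by norm_num)]
      simp only
      rw [← Real.rpow_natCast, ← Real.rpow_mul (norm_nonneg x)]
      norm_num [Real.rpow_neg_one]
    have hj : ContDiffAt ℝ 2 (fun s : ℝ => s ^ (-1 / 2 : ℝ)) (‖y‖ ^ 2) :=
      Real.contDiffAt_rpow_const_of_ne hs.ne'
    have h1 : ∀ s : ℝ, 0 < s → deriv (fun s : ℝ => s ^ (-1 / 2 : ℝ)) s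
        = -1 / 2 * s ^ (-3 / 2 : ℝ) := by
      intro s hs
      rw [(Real.hasDerivAt_rpow_const (Or.inl hs.ne')).deriv]
      norm_num
    have h2 : deriv (deriv fun s : ℝ => s ^ (-1 / 2 : ℝ)) (‖y‖ ^ 2)
        = -1 / 2 * (-3 / 2 * (‖y‖ ^ 2) ^ (-5 / 2 : ℝ)) := by
      have : deriv (fun s : ℝ => s ^ (-1 / 2 : ℝ)) =ᶠ[𝓝 (‖y‖ ^ 2)]
          fun s => -1 / 2 * s ^ (-3 / 2 : ℝ) := by
        filter_upwards [lt_mem_nhds hs] with s hs using h1 s hs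
      rw [this.deriv_eq, ((Real.hasDerivAt_rpow_const (Or.inl hs.ne')).const_mul _).deriv]
      norm_num
    have h3 : (‖y‖ ^ 2) ^ (-3 / 2 : ℝ) = (‖y‖ ^ 2) ^ (-5 / 2 : ℝ) * ‖y‖ ^ 2 := by
      rw [← Real.rpow_add_one hs.ne']; norm_num
    rw [e, laplacian_comp (w := fun y : Space 3 => ‖y‖ ^ 2) hj hw, h2, h1 _ hs, laplacian_norm_sq, gradSq_norm_sq,
      finrank_euclideanSpace_fin, h3]
    push_cast
    ring

/-- The cutoff equal to `1` on the ball of radius `1/4` and to `0` outside that of radius `1/2`. -/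
def innerCutoff (d : ℕ) : ContDiffBump (0 : Space d) := ⟨1 / 4, 1 / 2, by norm_num, by norm_num⟩

/-- The fundamental solution with its singularity removed. -/
def regSol (d : ℕ) (y : Space d) : ℝ := (1 - innerCutoff d y) * fundSol d y

lemma innerCutoff_eq_one {y : Space d} (hy : ‖y‖ ≤ 1 / 4) : innerCutoff d y = 1 :=
  (innerCutoff d).one_of_mem_closedBall (by simpa [innerCutoff] using hy)

lemma innerCutoff_eq_zero {y : Space d} (hy : 1 / 2 ≤ ‖y‖) : innerCutoff d y = 0 :=
  (innerCutoff d).zero_of_le_dist (by simpa [innerCutoff] using hy)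

lemma regSol_inner {y : Space d} (hy : ‖y‖ ≤ 1 / 4) : regSol d y = 0 := by
  rw [regSol, innerCutoff_eq_one hy]; ring

lemma regSol_outer {y : Space d} (hy : 1 / 2 ≤ ‖y‖) : regSol d y = fundSol d y := by
  rw [regSol, innerCutoff_eq_zero hy]; ring

lemma contDiff_regSol : ContDiff ℝ ∞ (regSol d) := by
  rw [contDiff_iff_contDiffAt]
  intro y
  by_cases hy : y = 0
  · have : regSol d =ᶠ[𝓝 y] fun _ => 0 := by
      have hb : Metric.ball (0 : Space d) (1 / 4) ∈ 𝓝 y := by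
        rw [hy]; exact Metric.ball_mem_nhds _ (by norm_num)
      filter_upwards [hb] with x hx
      exact regSol_inner (mem_ball_zero_iff.1 hx).le
    exact contDiffAt_const.congr_of_eventuallyEq this
  · exact (contDiffAt_const.sub (innerCutoff d).contDiffAt).mul (contDiffAt_fundSol hy)

/-- The Laplacian of the regularised solution, a smooth function supported in the ball of
radius `1/2`. -/
def regSource (d : ℕ) : Space d → ℝ := laplacian (regSol d)

lemma contDiff_regSource : ContDiff ℝ ∞ (regSource d) := contDiff_laplacian contDiff_regSol

lemma regSource_outer (hd : d = 2 ∨ d = 3) {y : Space d} (hy : 1 / 2 < ‖y‖) :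
    regSource d y = 0 := by
  have h0 : y ≠ 0 := norm_pos_iff.1 (by linarith)
  have : regSol d =ᶠ[𝓝 y] fundSol d := by
    filter_upwards [(continuous_norm.isOpen_preimage _ isOpen_Ioi).mem_nhds hy] with x hx
    exact regSol_outer (le_of_lt hx)
  rw [regSource, (InnerProductSpace.laplacian_congr_nhds this).eq_of_nhds, laplacian_fundSol hd h0]

lemma hasCompactSupport_regSource (hd : d = 2 ∨ d = 3) : HasCompactSupport (regSource d) :=
  HasCompactSupport.intro (isCompact_closedBall (0 : Space d) (1 / 2)) fun y hy =>
    regSource_outer hd (by simpa using hy)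

/-- A smooth eigenfunction of the Laplacian pairs with a test function as expected. -/
lemma integral_laplacian_mul_eigen {e ψ : Space d → ℝ} (he : ContDiff ℝ ∞ e) {q : ℝ}
    (hq : ∀ y, laplacian e y = -q * e y) (hψ : ContDiff ℝ ∞ ψ) (hc : HasCompactSupport ψ) :
    ∫ y, laplacian ψ y * e y = -q * ∫ y, ψ y * e y := by
  have := integral_mul_laplacian he hψ hc
  simp_rw [hq] at this
  rw [← integral_const_mul]
  calc _ = ∫ y, e y * laplacian ψ y := by simp_rw [mul_comm]
    _ = _ := by rw [this]; congr 1; funext y; ring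

lemma laplacian_comp_inner {j : ℝ → ℝ} (hj : ContDiff ℝ 2 j) (p y : Space d) :
    laplacian (fun y => j ⟪p, y⟫_ℝ) y = ‖p‖ ^ 2 * deriv (deriv j) ⟪p, y⟫_ℝ := by
  have hw : ContDiff ℝ ∞ fun y : Space d => ⟪p, y⟫_ℝ := contDiff_const.inner ℝ contDiff_id
  have hf : fderiv ℝ (fun y : Space d => ⟪p, y⟫_ℝ) = fun _ => innerSL ℝ p := by
    funext x
    exact (innerSL ℝ p).hasFDerivAt.fderiv
  have h1 : laplacian (fun y : Space d => ⟪p, y⟫_ℝ) y = 0 := by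
    rw [laplacian_eq_sum_fderiv, hf]; simp
  have h2 : gradSq (fun y : Space d => ⟪p, y⟫_ℝ) y = ‖p‖ ^ 2 := by
    rw [gradSq, hf, ← OrthonormalBasis.sum_sq_norm_inner_left (stdOrthonormalBasis ℝ (Space d)) p]
    simp
  rw [laplacian_comp hj.contDiffAt (contDiff_infty.1 hw 2).contDiffAt, h1, h2]
  ring

lemma laplacian_cos_inner (p y : Space d) :
    laplacian (fun y => Real.cos ⟪p, y⟫_ℝ) y = -‖p‖ ^ 2 * Real.cos ⟪p, y⟫_ℝ := by
  rw [laplacian_comp_inner Real.contDiff_cos]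
  simp

lemma laplacian_sin_inner (p y : Space d) :
    laplacian (fun y => Real.sin ⟪p, y⟫_ℝ) y = -‖p‖ ^ 2 * Real.sin ⟪p, y⟫_ℝ := by
  rw [laplacian_comp_inner Real.contDiff_sin]
  simp

lemma contDiff_cos_inner (p : Space d) : ContDiff ℝ ∞ fun y : Space d => Real.cos ⟪p, y⟫_ℝ :=
  Real.contDiff_cos.comp (contDiff_const.inner ℝ contDiff_id)

lemma contDiff_sin_inner (p : Space d) : ContDiff ℝ ∞ fun y : Space d => Real.sin ⟪p, y⟫_ℝ :=
  Real.contDiff_sin.comp (contDiff_const.inner ℝ contDiff_id)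

end FundamentalSolution

/-! ### The sum-to-integral estimate on the unit scale -/

section UnitScattering

open MeasureTheory Filter Topology Laplacian

variable {d : ℕ}

/-- The scattering problem on the unit scale: `-Δφ + g / 2 = 0` with `g ≥ 0` supported in the ball
of radius `1/4`, outside of which `1 - φ = A + b F` for the fundamental solution `F`. -/
structure UnitScattering (d : ℕ) (φ g : Space d → ℝ) (A b : ℝ) : Prop where
  weak : WeakLaplacian φ fun y => 1 / 2 * g y
  locallyIntegrable : LocallyIntegrable φ
  memLp : MemLp g 2
  g_nonneg : ∀ᵐ y, 0 ≤ g y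
  g_support : ∀ y, 1 / 4 < ‖y‖ → g y = 0
  outside : ∀ y, 1 / 4 ≤ ‖y‖ → 1 - φ y = A + b * fundSol d y
  φ_nonneg : ∀ᵐ y, 0 ≤ φ y
  φ_le : ∀ᵐ y, ‖y‖ ≤ 1 / 4 → A ≤ 1 - φ y
  sign : ∀ y : Space d, ‖y‖ ≤ 1 / 2 → 0 ≤ b * fundSol d y

/-- The singular part of `1 - φ`, supported in the ball of radius `1/2`. -/
def corePart (φ : Space d → ℝ) (A b : ℝ) (y : Space d) : ℝ := 1 - φ y - A - b * regSol d y

lemma integrable_of_memLp_two_of_ball {f : Space d → ℝ} (hf : MemLp f 2) {r : ℝ}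
    (h : ∀ y, r < ‖y‖ → f y = 0) : Integrable f := by
  have h1 : MemLp f 1 := by
    have h2 : Function.support f ⊆ Metric.closedBall 0 r := fun y hy => by
      by_contra hcon
      exact hy (h y (by simpa using hcon))
    exact hf.mono_exponent_of_measure_support_ne_top (s := Metric.closedBall 0 r)
      (fun y hy => by_contra fun hc => hy (h2 hc)) measure_closedBall_lt_top.ne (by norm_num)
  exact memLp_one_iff_integrable.1 h1

namespace UnitScattering

variable {φ g : Space d → ℝ} {A b : ℝ} (h : UnitScattering d φ g A b)

include h

lemma integrable_g : Integrable g := integrable_of_memLp_two_of_ball h.memLp h.g_support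

lemma core_outer {y : Space d} (hy : 1 / 2 ≤ ‖y‖) : corePart φ A b y = 0 := by
  rw [corePart, h.outside y (by linarith), regSol_outer hy]; ring

/-- Inside radius `1/4` the regularised solution vanishes and the bound on `φ` applies. In the
annulus up to `1/2` what remains is the cutoff times `b F`, nonnegative by the sign condition;
further out it is zero. This fixes the sign of the zero mode in Parseval's identity. -/
lemma ae_core_nonneg : ∀ᵐ y, 0 ≤ corePart φ A b y := by
  filter_upwards [h.φ_le] with y hy
  rcases le_total ‖y‖ (1 / 4) with h1 | h1
  · rw [corePart, regSol_inner h1]; linarith [hy h1]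
  rcases le_total ‖y‖ (1 / 2) with h2 | h2
  · rw [corePart, h.outside y h1, regSol]
    have : A + b * fundSol d y - A - b * ((1 - innerCutoff d y) * fundSol d y)
        = innerCutoff d y * (b * fundSol d y) := by ring
    rw [this]
    exact mul_nonneg (innerCutoff d).nonneg (h.sign y h2)
  · rw [h.core_outer h2]

lemma aestronglyMeasurable_core : AEStronglyMeasurable (corePart φ A b) := by
  have h1 : AEStronglyMeasurable φ := h.locallyIntegrable.aestronglyMeasurable
  have h2 : AEStronglyMeasurable (regSol d) := contDiff_regSol.continuous.aestronglyMeasurable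
  exact ((aestronglyMeasurable_const.sub h1).sub aestronglyMeasurable_const).sub (h2.const_mul b)

/-- The core part is bounded: nonnegative, and at most `1 - A - b regSol` because `φ ≥ 0`. -/
lemma memLp_core : MemLp (corePart φ A b) 2 := by
  obtain ⟨B, hB⟩ := (isCompact_closedBall (0 : Space d) (1 / 2)).exists_bound_of_continuousOn
    (contDiff_regSol (d := d)).continuous.continuousOn
  have hbd : ∀ᵐ y, ‖corePart φ A b y‖ ≤ ‖(Metric.closedBall (0 : Space d) (1 / 2)).indicator
      (fun _ => |1 - A| + |b| * B) y‖ := by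
    filter_upwards [h.ae_core_nonneg, h.φ_nonneg] with y h1 h2
    by_cases hy : y ∈ Metric.closedBall (0 : Space d) (1 / 2)
    · rw [Set.indicator_of_mem hy, Real.norm_of_nonneg h1]
      refine le_trans ?_ (le_abs_self _)
      have e1 := le_abs_self (1 - A)
      have e2 : -(b * regSol d y) ≤ |b| * B := by
        refine (neg_le_abs _).trans ?_
        rw [abs_mul]
        exact mul_le_mul_of_nonneg_left (hB y hy) (abs_nonneg b)
      rw [corePart]; linarith
    · have : 1 / 2 ≤ ‖y‖ := by simpa using (not_le.1 (by simpa using hy)).le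
      rw [h.core_outer this]; simp
  refine MemLp.of_le ?_ h.aestronglyMeasurable_core hbd
  exact memLp_indicator_const 2 measurableSet_closedBall _ (Or.inr measure_closedBall_lt_top.ne)

lemma integrable_core : Integrable (corePart φ A b) :=
  integrable_of_memLp_two_of_ball h.memLp_core fun _ hy => h.core_outer (le_of_lt hy)

/-- The scattering equation tested with `e`. A cutoff equal to `1` on the unit ball makes `e`
admissible and is invisible, since `g`, the core part and the source all live in the ball of radius
`1/2`. Cosines and sines give `ĝ = 2k² û - 2b ĥ`; `e = 1` gives the total integral of `g`. -/
lemma integral_eigen (hd : d = 2 ∨ d = 3) {e : Space d → ℝ} (he : ContDiff ℝ ∞ e) {q : ℝ}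
    (hq : ∀ y, laplacian e y = -q * e y) :
    ∫ y, g y * e y = 2 * q * (∫ y, corePart φ A b y * e y)
      - 2 * b * ∫ y, regSource d y * e y := by
  let χ : ContDiffBump (0 : Space d) := ⟨1, 2, by norm_num, by norm_num⟩
  let ψ : Space d → ℝ := fun y => χ y * e y
  have hψ : ContDiff ℝ ∞ ψ := χ.contDiff.mul he
  have hc : HasCompactSupport ψ := χ.hasCompactSupport.mul_right
  have hnear : ∀ y : Space d, ‖y‖ < 1 → ψ =ᶠ[𝓝 y] e := fun y hy => by
    filter_upwards [(continuous_norm.isOpen_preimage _ isOpen_Iio).mem_nhds hy] with x hx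
    have : χ x = 1 := χ.one_of_mem_closedBall (by simpa [χ] using le_of_lt hx)
    simp [ψ, this]
  have hψe : ∀ y : Space d, ‖y‖ < 1 → ψ y = e y := fun y hy => (hnear y hy).eq_of_nhds
  have hΔ : ∀ y : Space d, ‖y‖ < 1 → laplacian ψ y = -q * e y := fun y hy => by
    rw [(InnerProductSpace.laplacian_congr_nhds (hnear y hy)).eq_of_nhds, hq]
  have i1 : Integrable fun y => φ y * laplacian ψ y :=
    integrable_mul_laplacian h.locallyIntegrable hψ hc
  have i2 : Integrable fun y => (1 - A) * laplacian ψ y :=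
    integrable_mul_laplacian (locallyIntegrable_const _) hψ hc
  have i3 : Integrable fun y => regSol d y * laplacian ψ y :=
    integrable_mul_laplacian (contDiff_regSol.continuous.locallyIntegrable) hψ hc
  have key : ∫ y, corePart φ A b y * laplacian ψ y
      = -(∫ y, 1 / 2 * g y * ψ y) - b * ∫ y, regSource d y * ψ y := by
    have e1 : ∀ y, corePart φ A b y * laplacian ψ y = (1 - A) * laplacian ψ y
        - φ y * laplacian ψ y - b * (regSol d y * laplacian ψ y) := fun y => by
      rw [corePart]; ring
    simp_rw [e1]
    have i4 : Integrable fun y => (1 - A) * laplacian ψ y - φ y * laplacian ψ y := i2.sub i1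
    rw [integral_sub i4 (i3.const_mul b), integral_sub i2 i1, integral_const_mul,
      integral_laplacian_eq_zero hψ hc, h.weak ψ hψ hc, integral_const_mul,
      integral_mul_laplacian contDiff_regSol hψ hc]
    simp [regSource]
  have k1 : ∫ y, corePart φ A b y * laplacian ψ y = -q * ∫ y, corePart φ A b y * e y := by
    rw [← integral_const_mul]
    congr 1; funext y
    rcases lt_or_ge ‖y‖ 1 with hy | hy
    · rw [hΔ y hy]; ring
    · rw [h.core_outer (by linarith)]; ring
  have k2 : ∫ y, 1 / 2 * g y * ψ y = 1 / 2 * ∫ y, g y * e y := by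
    rw [← integral_const_mul]
    congr 1; funext y
    rcases lt_or_ge ‖y‖ 1 with hy | hy
    · rw [hψe y hy]; ring
    · rw [h.g_support y (by linarith)]; ring
  have k3 : ∫ y, regSource d y * ψ y = ∫ y, regSource d y * e y := by
    congr 1; funext y
    rcases lt_or_ge ‖y‖ 1 with hy | hy
    · rw [hψe y hy]
    · rw [regSource_outer hd (by linarith)]; ring
  rw [k1, k2, k3] at key
  linarith

end UnitScattering

lemma integral_exp_inner_mul {f : Space d → ℝ} (hf : Integrable f) (p : Space d) :
    ∫ y : Space d, Complex.exp (-(Complex.I * ((⟪p, y⟫_ℝ : ℝ) : ℂ))) * (f y : ℂ)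
      = ((∫ y, f y * Real.cos ⟪p, y⟫_ℝ : ℝ) : ℂ)
        - Complex.I * ((∫ y, f y * Real.sin ⟪p, y⟫_ℝ : ℝ) : ℂ) := by
  have i1 : Integrable fun y => f y * Real.cos ⟪p, y⟫_ℝ :=
    hf.mul_bdd (c := 1) (contDiff_cos_inner _).continuous.aestronglyMeasurable
      (Eventually.of_forall fun y => Real.abs_cos_le_one _)
  have i2 : Integrable fun y => f y * Real.sin ⟪p, y⟫_ℝ :=
    hf.mul_bdd (c := 1) (contDiff_sin_inner _).continuous.aestronglyMeasurable
      (Eventually.of_forall fun y => Real.abs_sin_le_one _)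
  rw [← integral_complex_ofReal, ← integral_complex_ofReal, ← integral_const_mul,
    ← integral_sub i1.ofReal (i2.ofReal.const_mul _)]
  congr 1; funext y
  rw [show -(Complex.I * ((⟪p, y⟫_ℝ : ℝ) : ℂ)) = ((-⟪p, y⟫_ℝ : ℝ) : ℂ) * Complex.I by
    push_cast; ring, Complex.exp_mul_I, ← Complex.ofReal_cos, ← Complex.ofReal_sin, Real.cos_neg,
    Real.sin_neg]
  push_cast
  ring

lemma unitFourier_eq {f : Space d → ℝ} (hf : Integrable f) (m : Mode d) :
    unitFourier f m = ((∫ y, f y * Real.cos ⟪unitMom m, y⟫_ℝ : ℝ) : ℂ)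
      - Complex.I * ((∫ y, f y * Real.sin ⟪unitMom m, y⟫_ℝ : ℝ) : ℂ) :=
  integral_exp_inner_mul hf (unitMom m)

lemma fourier_eq {f : Space d → ℝ} (hf : Integrable f) (p : Space d) :
    SoftPairs.fourier f p = ∫ y, f y * Real.cos ⟪p, y⟫_ℝ := by
  rw [SoftPairs.fourier, integral_exp_inner_mul hf]
  simp

lemma norm_unitFourier_le (f : Space d → ℝ) (m : Mode d) :
    ‖unitFourier f m‖ ≤ ∫ y, |f y| := by
  refine (norm_integral_le_integral_norm _).trans_eq ?_
  congr 1; funext y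
  rw [norm_mul, show -(Complex.I * ((⟪unitMom m, y⟫_ℝ : ℝ) : ℂ))
    = ((-⟪unitMom m, y⟫_ℝ : ℝ) : ℂ) * Complex.I by push_cast; ring, Complex.norm_exp_ofReal_mul_I]
  simp

/-- The decay of the Fourier coefficients of the source. -/
lemma norm_unitFourier_regSource_le (hd : d = 2 ∨ d = 3) (m : Mode d) :
    ‖unitMom m‖ ^ 2 * ‖unitFourier (regSource d) m‖ ≤ ∫ y, |laplacian (regSource d) y| := by
  have hs := contDiff_regSource (d := d)
  have hc := hasCompactSupport_regSource hd
  have hc' : HasCompactSupport (laplacian (regSource d)) :=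
    hc.of_isClosed_subset (isClosed_tsupport _) (tsupport_laplacian_subset _)
  have i1 : Integrable (regSource d) := hs.continuous.integrable_of_hasCompactSupport hc
  have i2 : Integrable (laplacian (regSource d)) :=
    (contDiff_laplacian hs).continuous.integrable_of_hasCompactSupport hc'
  have : unitFourier (laplacian (regSource d)) m
      = (-‖unitMom m‖ ^ 2 : ℝ) * unitFourier (regSource d) m := by
    rw [unitFourier_eq i1, unitFourier_eq i2,
      integral_laplacian_mul_eigen (contDiff_cos_inner _) (laplacian_cos_inner _) hs hc,
      integral_laplacian_mul_eigen (contDiff_sin_inner _) (laplacian_sin_inner _) hs hc]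
    push_cast
    ring
  have h2 := norm_unitFourier_le (laplacian (regSource d)) m
  rw [this, norm_mul, Complex.norm_real, Real.norm_eq_abs, abs_neg,
    abs_of_nonneg (by positivity)] at h2
  exact h2

namespace UnitScattering

variable {φ g : Space d → ℝ} {A b : ℝ} (h : UnitScattering d φ g A b)

include h

lemma unitFourier_g (hd : d = 2 ∨ d = 3) (m : Mode d) :
    unitFourier g m = (2 * ‖unitMom m‖ ^ 2 : ℝ) * unitFourier (corePart φ A b) m
      - (2 * b : ℝ) * unitFourier (regSource d) m := by
  have i1 : Integrable (regSource d) :=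
    contDiff_regSource.continuous.integrable_of_hasCompactSupport (hasCompactSupport_regSource hd)
  rw [unitFourier_eq i1, unitFourier_eq h.integrable_g, unitFourier_eq h.integrable_core,
    h.integral_eigen hd (contDiff_cos_inner _) (laplacian_cos_inner (unitMom m)),
    h.integral_eigen hd (contDiff_sin_inner _) (laplacian_sin_inner (unitMom m))]
  push_cast
  ring

lemma integral_g (hd : d = 2 ∨ d = 3) : ∫ y, g y = -2 * b * ∫ y, regSource d y := by
  have := h.integral_eigen hd (e := fun _ => 1) contDiff_const (q := 0) (by simp)
  simpa using this

end UnitScattering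

lemma unitMom_eq_zero {m : Mode d} : unitMom m = 0 ↔ m = 0 := by
  constructor
  · intro hm
    funext i
    have := congrArg (fun x : Space d => x i) hm
    simpa [unitMom, Real.pi_ne_zero] using this
  · rintro rfl
    ext i
    simp [unitMom]

/-- **The sum-to-integral estimate**: `½ ∑_{k ≠ 0} |ĝ(k)|² / k²` is `∫ g (1 - φ)` up to boundary
terms. The constant depends on the dimension only. -/
lemma UnitScattering.sum_le (hd : d = 2 ∨ d = 3) :
    ∃ C : ℝ, 0 ≤ C ∧ ∀ (φ g : Space d → ℝ) (A b : ℝ), UnitScattering d φ g A b →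
      Summable (fun m : Mode d => ‖unitFourier g m‖ ^ 2 / (2 * ‖unitMom m‖ ^ 2)) ∧
      ∑' m : Mode d, ‖unitFourier g m‖ ^ 2 / (2 * ‖unitMom m‖ ^ 2)
        ≤ (∫ y, g y * (1 - φ y)) - A * (∫ y, g y) + C * |b| * ∫ y, g y := by
  set S := ∑' m : Mode d, (‖unitMom m‖ ^ 4)⁻¹ with hS
  set B := ∫ y, |laplacian (regSource d) y| with hB
  have hB0 : 0 ≤ B := integral_nonneg fun _ => abs_nonneg _
  have hS0 : 0 ≤ S := tsum_nonneg fun _ => by positivity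
  refine ⟨B * S, by positivity, fun φ g A b h => ?_⟩
  set I := ∫ y, g y with hI
  have hI0 : 0 ≤ I := integral_nonneg_of_ae h.g_nonneg
  have hIabs : ∫ y, |g y| = I :=
    integral_congr_ae (by filter_upwards [h.g_nonneg] with y hy using abs_of_nonneg hy)
  have hP := Complex.hasSum_re (hasSum_unitFourier (fun y hy => h.core_outer hy)
    (fun y hy => h.g_support y (by linarith)) h.memLp_core h.memLp)
  rw [Complex.ofReal_re] at hP
  -- On the support of `g` the regularised solution vanishes, so there the core part is `1 - φ - A`.
  have hUg : ∫ y, corePart φ A b y * g y = (∫ y, g y * (1 - φ y)) - A * I := by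
    have i1 : Integrable fun y => corePart φ A b y * g y := h.memLp_core.integrable_mul h.memLp
    have e : ∀ y, g y * (1 - φ y) = corePart φ A b y * g y + A * g y := fun y => by
      rcases le_or_gt ‖y‖ (1 / 4) with hy | hy
      · rw [corePart, regSol_inner hy]; ring
      · rw [h.g_support y hy]; ring
    simp_rw [e]
    rw [integral_add i1 (h.integrable_g.const_mul A), integral_const_mul]
    ring
  -- the zero mode
  have hzero : (conj (unitFourier (corePart φ A b) 0) * unitFourier g 0).re
      = (∫ y, corePart φ A b y) * I := by
    have : unitMom (0 : Mode d) = 0 := unitMom_eq_zero.2 rfl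
    rw [unitFourier_eq h.integrable_core, unitFourier_eq h.integrable_g, this]
    simp [hI]
  -- The left side of the estimate has no zero mode (`0/0 = 0`), while Parseval's sum does; being
  -- nonnegative, that term may simply be kept in an upper bound.
  have hzero' : 0 ≤ (conj (unitFourier (corePart φ A b) 0) * unitFourier g 0).re := by
    rw [hzero]
    exact mul_nonneg (integral_nonneg_of_ae h.ae_core_nonneg) hI0
  have hpt : ∀ m : Mode d, ‖unitFourier g m‖ ^ 2 / (2 * ‖unitMom m‖ ^ 2)
      ≤ (conj (unitFourier (corePart φ A b) m) * unitFourier g m).re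
        + B * |b| * I * (‖unitMom m‖ ^ 4)⁻¹ := by
    intro m
    by_cases hm : m = 0
    · subst hm
      have : unitMom (0 : Mode d) = 0 := unitMom_eq_zero.2 rfl
      simp only [this, norm_zero]
      norm_num
      simpa using hzero'
    have hq : 0 < ‖unitMom m‖ := norm_pos_iff.2 fun hc => hm (unitMom_eq_zero.1 hc)
    set q := ‖unitMom m‖ with hqdef
    set cg := unitFourier g m
    set cu := unitFourier (corePart φ A b) m
    set ch := unitFourier (regSource d) m
    have e1 : cg = (2 * q ^ 2 : ℝ) * cu - (2 * b : ℝ) * ch := h.unitFourier_g hd m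
    -- The equation is inserted in only one of the two factors, so that division by `2 q²` produces
    -- exactly the Parseval term. The error pairs `ĥ`, of order `q⁻²`, with `ĝ`, which is bounded by
    -- `∫ g`; altogether it is of order `q⁻⁴`, which is summable.
    have e2 : ‖cg‖ ^ 2 = 2 * q ^ 2 * (conj cu * cg).re - 2 * b * (conj ch * cg).re := by
      have : ((‖cg‖ ^ 2 : ℝ) : ℂ) = conj cg * cg := by
        rw [Complex.conj_mul']; push_cast; rfl
      have h2 := congrArg Complex.re this
      rw [Complex.ofReal_re] at h2
      rw [h2]
      nth_rewrite 1 [e1]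
      rw [map_sub, map_mul, map_mul, Complex.conj_ofReal, Complex.conj_ofReal, sub_mul, mul_assoc,
        mul_assoc, Complex.sub_re, Complex.re_ofReal_mul, Complex.re_ofReal_mul]
    have e3 : -(2 * b * (conj ch * cg).re) ≤ 2 * |b| * (‖ch‖ * I) := by
      refine (neg_le_abs _).trans ?_
      rw [abs_mul, abs_mul, abs_two]
      refine mul_le_mul_of_nonneg_left ?_ (by positivity)
      refine (Complex.abs_re_le_norm _).trans ?_
      rw [norm_mul, RCLike.norm_conj]
      exact mul_le_mul_of_nonneg_left ((norm_unitFourier_le g m).trans_eq hIabs) (norm_nonneg _)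
    have e4 : q ^ 2 * ‖ch‖ ≤ B := norm_unitFourier_regSource_le hd m
    rw [e2, div_le_iff₀ (by positivity)]
    have e5 : ((conj cu * cg).re + B * |b| * I * (q ^ 4)⁻¹) * (2 * q ^ 2)
        = 2 * q ^ 2 * (conj cu * cg).re + 2 * |b| * (B / q ^ 2 * I) := by
      field_simp
    rw [e5]
    have e6 : ‖ch‖ ≤ B / q ^ 2 := by
      rw [le_div_iff₀ (by positivity)]; linarith
    have e7 : 2 * |b| * (‖ch‖ * I) ≤ 2 * |b| * (B / q ^ 2 * I) := by gcongr
    linarith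
  have hsum : Summable fun m : Mode d => (conj (unitFourier (corePart φ A b) m)
      * unitFourier g m).re + B * |b| * I * (‖unitMom m‖ ^ 4)⁻¹ :=
    hP.summable.add ((summable_inv_norm_unitMom hd).mul_left _)
  have hs1 : Summable fun m : Mode d => ‖unitFourier g m‖ ^ 2 / (2 * ‖unitMom m‖ ^ 2) :=
    Summable.of_nonneg_of_le (fun m => by positivity) hpt hsum
  refine ⟨hs1, (hs1.tsum_le_tsum hpt hsum).trans ?_⟩
  rw [hP.summable.tsum_add ((summable_inv_norm_unitMom hd).mul_left _), hP.tsum_eq, tsum_mul_left,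
    hUg]
  exact le_of_eq (by rw [← hS]; ring)

end UnitScattering

/-! ### Change of scale -/

section Scaling

open MeasureTheory Filter Topology Laplacian

variable {d : ℕ}

lemma map_smul_volume {c : ℝ} (hc : c ≠ 0) :
    Measure.map (fun y : Space d => c • y) volume
      = ENNReal.ofReal |(c ^ Module.finrank ℝ (Space d))⁻¹| • volume :=
  Measure.map_addHaar_smul volume hc

lemma ae_comp_smul {c : ℝ} (hc : c ≠ 0) {p : Space d → Prop} (h : ∀ᵐ x, p x) :
    ∀ᵐ y : Space d, p (c • y) := by
  have h2 : ∀ᵐ x ∂(Measure.map (fun y : Space d => c • y) volume), p x := by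
    rw [map_smul_volume hc]
    exact Measure.ae_smul_measure h _
  exact ae_of_ae_map (measurable_const_smul c).aemeasurable h2

lemma memLp_comp_smul {c : ℝ} (hc : c ≠ 0) {f : Space d → ℝ} (hf : MemLp f 2) :
    MemLp (fun y => f (c • y)) 2 := by
  have h1 : MemLp f 2 (Measure.map (fun y : Space d => c • y) volume) := by
    rw [map_smul_volume hc]
    exact hf.smul_measure ENNReal.ofReal_ne_top
  exact (memLp_map_measure_iff h1.aestronglyMeasurable
    (measurable_const_smul c).aemeasurable).1 h1

lemma locallyIntegrable_comp_smul {c : ℝ} (hc : c ≠ 0) {f : Space d → ℝ}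
    (hf : LocallyIntegrable f) : LocallyIntegrable fun y => f (c • y) := by
  refine (locallyIntegrable_map_homeomorph (Homeomorph.smulOfNeZero c hc)).1 ?_
  change LocallyIntegrable f (Measure.map (fun y : Space d => c • y) volume)
  rw [map_smul_volume hc, locallyIntegrable_iff]
  intro K hK
  rw [IntegrableOn, Measure.restrict_smul]
  exact (hf.integrableOn_isCompact hK).smul_measure ENNReal.ofReal_ne_top

lemma integral_comp_smul_space {c : ℝ} (hc : 0 < c) (f : Space d → ℝ) :
    ∫ y, f (c • y) = (c ^ d)⁻¹ * ∫ x, f x := by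
  rw [Measure.integral_comp_smul volume f c, finrank_euclideanSpace_fin,
    abs_of_nonneg (by positivity), smul_eq_mul]

lemma WeakLaplacian.comp_smul {u f : Space d → ℝ} (h : WeakLaplacian u f) {c : ℝ} (hc : 0 < c) :
    WeakLaplacian (fun y => u (c • y)) fun y => c ^ 2 * f (c • y) := by
  intro ψ hψ hcs
  have hs : ContDiff ℝ ∞ fun x => ψ (c⁻¹ • x) := hψ.comp (contDiff_const_smul _)
  have hk : HasCompactSupport fun x => ψ (c⁻¹ • x) := hcs.comp_smul (inv_ne_zero hc.ne')
  have key := h _ hs hk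
  have e1 := integral_comp_smul_space hc fun x => u x * laplacian (fun x => ψ (c⁻¹ • x)) x
  have e2 := integral_comp_smul_space hc fun x => f x * ψ (c⁻¹ • x)
  rw [key, ← e2] at e1
  have e3 : ∀ y, laplacian (fun x => ψ (c⁻¹ • x)) (c • y) = (c⁻¹) ^ 2 * laplacian ψ y := fun y => by
    rw [laplacian_comp_smul (contDiff_infty.1 hψ 2), smul_smul, inv_mul_cancel₀ hc.ne', one_smul]
  simp_rw [e3, smul_smul, inv_mul_cancel₀ hc.ne', one_smul] at e1
  calc ∫ y, u (c • y) * laplacian ψ y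
      = c ^ 2 * ∫ y, u (c • y) * (c⁻¹ ^ 2 * laplacian ψ y) := by
        rw [← integral_const_mul]; congr 1; funext y; field_simp
    _ = _ := by rw [e1, ← integral_const_mul]; congr 1; funext y; ring

end Scaling

/-! ### The gas on the scale of the box -/

section Gas

open MeasureTheory Filter Topology Laplacian

variable {d : ℕ}

/-- The constant term of `1 - φ` outside the potential, on the scale `ℓ`. -/
def BoseGas.shift (G : BoseGas d) (ℓ : ℝ) : ℝ :=
  if d = 2 then 1 - 2 * G.delta * Real.log (ℓ / G.a) else 0

/-- The coefficient of the fundamental solution in `1 - φ`, on the scale `ℓ`. -/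
def BoseGas.slope (G : BoseGas d) (ℓ : ℝ) : ℝ := if d = 2 then -(2 * G.delta) else G.a / ℓ

lemma BoseGas.delta_nonneg (G : BoseGas d) : 0 ≤ G.delta := by
  rw [BoseGas.delta]; positivity

namespace BoseGas.Admissible

variable {G : BoseGas d} (hG : G.Admissible) (hd : d = 2 ∨ d = 3)

include hG

lemma locallyIntegrable_φ : LocallyIntegrable G.φ := by
  have h := hG.scattering.locallyIntegrable
  unfold BoseGas.φ
  split_ifs
  · exact h.smul (2 * G.delta)
  · exact h

lemma weakLaplacian_φ : WeakLaplacian G.φ fun x => 1 / 2 * G.g x := by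
  have h := hG.weakLaplacian
  unfold BoseGas.g BoseGas.φ
  split_ifs
  · have h2 := h.const_mul (2 * G.delta)
    have e : (fun x => 2 * G.delta * (1 / 2 * (G.v x * G.φ₀ x)))
        = fun x => 1 / 2 * (G.v x * (2 * G.delta * G.φ₀ x)) := by funext x; ring
    rwa [e] at h2
  · exact h

include hd

lemma ae_φ_nonneg : ∀ᵐ x, 0 ≤ G.φ x := by
  filter_upwards [hG.ae_nonneg hd] with x hx
  have := G.delta_nonneg
  unfold BoseGas.φ
  split_ifs
  · positivity
  · exact hx

lemma ae_g_nonneg : ∀ᵐ x, 0 ≤ G.g x := by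
  filter_upwards [hG.ae_φ_nonneg hd] with x hx using mul_nonneg (hG.nonneg x) hx

lemma ae_shift_le {ℓ : ℝ} (hR : G.R < ℓ) : ∀ᵐ x, ‖x‖ ≤ ℓ → G.shift ℓ ≤ 1 - G.φ x := by
  rcases hd with rfl | rfl
  · filter_upwards [hG.ae_le_log hR] with x hx h
    simp only [BoseGas.shift, BoseGas.φ, if_true]
    have := mul_le_mul_of_nonneg_left (hx h) (mul_nonneg two_pos.le G.delta_nonneg)
    linarith
  · filter_upwards [hG.ae_le_one] with x hx _
    simp only [BoseGas.shift, BoseGas.φ]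
    norm_num [hx]

omit hd in
lemma g_eq_zero {x : Space d} (hx : G.R < ‖x‖) : G.g x = 0 := by
  have : G.v x = 0 := by
    by_contra h
    have := hG.support_subset h
    rw [mem_closedBall_zero_iff] at this
    linarith
  rw [BoseGas.g, this, zero_mul]

/-- On the support of `v`, `φ` lies between `0` and `1 - shift (R + 1)`, so `g` is dominated by a
constant multiple of `v`. -/
lemma memLp_g : MemLp G.g 2 := by
  have h1 : AEStronglyMeasurable G.g :=
    hG.memLp_two.aestronglyMeasurable.mul hG.locallyIntegrable_φ.aestronglyMeasurable
  refine (hG.memLp_two.const_mul (1 - G.shift (G.R + 1))).of_le h1 ?_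
  filter_upwards [hG.ae_shift_le hd (lt_add_one G.R), hG.ae_φ_nonneg hd] with x hx h0
  rcases lt_or_ge G.R ‖x‖ with h | h
  · rw [hG.g_eq_zero h, norm_zero]; positivity
  · have h2 := hx (by linarith)
    rw [BoseGas.g, norm_mul, norm_mul, mul_comm]
    refine mul_le_mul_of_nonneg_right ?_ (norm_nonneg _)
    rw [Real.norm_of_nonneg h0]
    exact le_trans (by linarith) (le_abs_self _)

/-- With lengths measured in units of `ℓ`, the condition `R ≤ ℓ/4` puts the potential in the ball of
radius `1/4`; the factor `ℓ²` comes from the Laplacian. In two dimensions `log (ℓ‖y‖/a)` splits into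
a constant, absorbed in the shift, and `log ‖y‖`. -/
lemma unitScattering {ℓ : ℝ} (hR : G.R ≤ ℓ / 4) :
    UnitScattering d (fun y => G.φ (ℓ • y)) (fun y => ℓ ^ 2 * G.g (ℓ • y)) (G.shift ℓ)
      (G.slope ℓ) := by
  have hR0 := hG.R_pos
  have hℓ : 0 < ℓ := by linarith
  have ha := hG.a_pos
  have hn : ∀ y : Space d, ‖ℓ • y‖ = ℓ * ‖y‖ := fun y => by
    rw [norm_smul, Real.norm_of_nonneg hℓ.le]
  refine ⟨?_, locallyIntegrable_comp_smul hℓ.ne' hG.locallyIntegrable_φ,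
    (memLp_comp_smul hℓ.ne' (hG.memLp_g hd)).const_mul _, ?_, fun y hy => ?_, fun y hy => ?_,
    ae_comp_smul hℓ.ne' (hG.ae_φ_nonneg hd), ?_, fun y hy => ?_⟩
  · have h := hG.weakLaplacian_φ.comp_smul hℓ
    have e : (fun y => ℓ ^ 2 * (1 / 2 * G.g (ℓ • y))) = fun y => 1 / 2 * (ℓ ^ 2 * G.g (ℓ • y)) := by
      funext y; ring
    rwa [e] at h
  · filter_upwards [ae_comp_smul hℓ.ne' (hG.ae_g_nonneg hd)] with y hy using by positivity
  · rw [hG.g_eq_zero, mul_zero]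
    rw [hn]; nlinarith
  · have hy0 : 0 < ‖y‖ := by linarith
    have hout : G.R ≤ ‖ℓ • y‖ := by rw [hn]; nlinarith
    rw [BoseGas.φ, hG.scattering.outside _ hout, hn]
    unfold BoseGas.shift BoseGas.slope fundSol
    split_ifs
    · rw [mul_div_right_comm, Real.log_mul (by positivity) hy0.ne']; ring
    · field_simp; ring
  · filter_upwards [ae_comp_smul hℓ.ne' (hG.ae_shift_le hd (by linarith : G.R < ℓ))] with y hy h
    refine hy ?_
    rw [hn]; nlinarith
  · unfold BoseGas.slope fundSol
    have := G.delta_nonneg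
    split_ifs
    · have : Real.log ‖y‖ ≤ 0 := Real.log_nonpos (norm_nonneg _) (by linarith)
      nlinarith
    · positivity

end BoseGas.Admissible

end Gas

/-! ### Fourier transforms of `g` and `gω` -/

section GasFourier

open MeasureTheory Filter Topology

variable {d : ℕ}

lemma fourier_zero {f : Space d → ℝ} (hf : Integrable f) :
    SoftPairs.fourier f 0 = ∫ y, f y := by
  rw [fourier_eq hf]; simp

lemma abs_fourier_le {f : Space d → ℝ} (hf : Integrable f) (h0 : ∀ᵐ y, 0 ≤ f y) (p : Space d) :
    |SoftPairs.fourier f p| ≤ SoftPairs.fourier f 0 := by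
  rw [fourier_eq hf p, fourier_zero hf, ← Real.norm_eq_abs]
  refine norm_integral_le_of_norm_le hf ?_
  filter_upwards [h0] with y hy
  rw [norm_mul, Real.norm_of_nonneg hy]
  exact mul_le_of_le_one_right hy (Real.abs_cos_le_one _)

lemma one_sub_cos_le (x : ℝ) : 1 - Real.cos x ≤ |x| := by
  have h1 := Real.one_sub_sq_div_two_le_cos (x := x)
  rcases le_total |x| 2 with h | h
  · nlinarith [abs_nonneg x, sq_abs x]
  · linarith [Real.neg_one_le_cos x]

/-- On the support the phase is at most `‖p‖ R`, and `1 - cos x ≤ |x|`. This makes the exchange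
energy nearly constant on the low momenta. -/
lemma fourier_zero_sub_le {f : Space d → ℝ} (hf : Integrable f) (h0 : ∀ᵐ y, 0 ≤ f y) {R : ℝ}
    (hR : ∀ y, R < ‖y‖ → f y = 0) (p : Space d) :
    SoftPairs.fourier f 0 - SoftPairs.fourier f p ≤ ‖p‖ * R * SoftPairs.fourier f 0 := by
  have i1 : Integrable fun y => f y * Real.cos ⟪p, y⟫_ℝ :=
    hf.mul_bdd (c := 1) (contDiff_cos_inner _).continuous.aestronglyMeasurable
      (Eventually.of_forall fun y => Real.abs_cos_le_one _)
  rw [fourier_zero hf, fourier_eq hf p, ← integral_sub hf i1, ← integral_const_mul]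
  refine integral_mono_ae (hf.sub i1) (hf.const_mul _) ?_
  filter_upwards [h0] with y hy
  rcases lt_or_ge R ‖y‖ with h | h
  · simp [hR y h]
  · have e1 := one_sub_cos_le ⟪p, y⟫_ℝ
    have e2 := abs_real_inner_le_norm p y
    have e3 : ‖p‖ * ‖y‖ ≤ ‖p‖ * R := mul_le_mul_of_nonneg_left h (norm_nonneg _)
    have e4 := mul_le_mul_of_nonneg_left (e1.trans (e2.trans e3)) hy
    linarith

/-- The ratio of `ĝ(0)` to `δ` or `a`. -/
def gRatio (d : ℕ) : ℝ :=
  if d = 2 then 4 * ∫ y, regSource d y else -2 * ∫ y, regSource d y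

namespace BoseGas.Admissible

variable {G : BoseGas d} (hG : G.Admissible) (hd : d = 2 ∨ d = 3)

include hG hd

lemma integrable_g : Integrable G.g :=
  integrable_of_memLp_two_of_ball (hG.memLp_g hd) fun _ h => hG.g_eq_zero h

lemma gHat_zero : G.gHat 0 = ∫ x, G.g x := fourier_zero (hG.integrable_g hd)

lemma gHat_zero_nonneg : 0 ≤ G.gHat 0 := by
  rw [hG.gHat_zero hd]; exact integral_nonneg_of_ae (hG.ae_g_nonneg hd)

lemma abs_gHat_le (k : Space d) : |G.gHat k| ≤ G.gHat 0 :=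
  abs_fourier_le (hG.integrable_g hd) (hG.ae_g_nonneg hd) k

/-- The zero-momentum identity `∫ g = -2b ∫ h` in scaled variables, read at `ℓ = 4R`. The ratio
depends on the dimension alone; its value is never computed, only its sign is used later. -/
lemma gHat_zero_eq : G.gHat 0 = gRatio d * if d = 2 then G.delta else G.a := by
  have hR := hG.R_pos
  have h := (hG.unitScattering hd (ℓ := 4 * G.R) (by linarith)).integral_g hd
  rw [integral_const_mul, integral_comp_smul_space (by positivity) G.g, ← hG.gHat_zero hd] at h
  rcases hd with rfl | rfl
  · simp only [gRatio, BoseGas.slope, if_true] at h ⊢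
    field_simp at h
    linarith
  · simp only [gRatio, BoseGas.slope] at h ⊢
    norm_num at h ⊢
    field_simp at h
    linarith

/-- In two dimensions `φ = 1` at radius `a e^{1/(2δ)}` if this lies beyond `R`, so the maximum
principle gives `φ ≤ 1` inside. In three dimensions `φ ≤ 1` everywhere, and any radius above `R`
will do. -/
lemma ae_ω_mem (hRa : d = 2 → G.R < G.a * Real.exp (1 / (2 * G.delta))) :
    ∀ᵐ x, ‖x‖ ≤ G.R → 0 ≤ G.ω x ∧ G.ω x ≤ 1 := by
  obtain ⟨R', hR', hs⟩ : ∃ R', G.R < R' ∧ 0 ≤ G.shift R' := by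
    by_cases h2 : d = 2
    · refine ⟨_, hRa h2, ?_⟩
      have ha := hG.a_pos
      rw [BoseGas.shift, if_pos h2, mul_div_right_comm, div_self ha.ne', one_mul, Real.log_exp]
      -- With `δ = 0` the convention `1/0 = 0` applies and the shift equals `1`; otherwise it is
      -- exactly `0`.
      by_cases h0 : G.delta = 0
      · rw [h0]; norm_num
      · field_simp; norm_num
    · refine ⟨_, lt_add_one _, ?_⟩
      rw [BoseGas.shift, if_neg h2]
  filter_upwards [hG.ae_shift_le hd hR', hG.ae_φ_nonneg hd] with x hx h0 hxR
  have := hx (by linarith)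
  rw [BoseGas.ω]
  constructor <;> linarith

variable (hRa : d = 2 → G.R < G.a * Real.exp (1 / (2 * G.delta)))

include hRa

lemma ae_gω : ∀ᵐ x, 0 ≤ G.g x * G.ω x ∧ G.g x * G.ω x ≤ G.g x := by
  filter_upwards [hG.ae_ω_mem hd hRa, hG.ae_g_nonneg hd] with x hx h0
  rcases lt_or_ge G.R ‖x‖ with h | h
  · simp [hG.g_eq_zero h]
  · exact ⟨mul_nonneg h0 (hx h).1, mul_le_of_le_one_right h0 (hx h).2⟩

lemma integrable_gω : Integrable fun x => G.g x * G.ω x := by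
  have hm : AEStronglyMeasurable G.ω :=
    aestronglyMeasurable_const.sub hG.locallyIntegrable_φ.aestronglyMeasurable
  refine (hG.integrable_g hd).mono ((hG.integrable_g hd).aestronglyMeasurable.mul hm) ?_
  filter_upwards [hG.ae_gω hd hRa] with x hx
  rw [Real.norm_of_nonneg hx.1]
  exact hx.2.trans (le_abs_self _)

lemma gωHat_zero : G.gωHat 0 = ∫ x, G.g x * G.ω x := fourier_zero (hG.integrable_gω hd hRa)

lemma abs_gωHat_le (k : Space d) : |G.gωHat k| ≤ G.gωHat 0 :=
  abs_fourier_le (hG.integrable_gω hd hRa) ((hG.ae_gω hd hRa).mono fun _ h => h.1) k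

lemma gωHat_zero_le : G.gωHat 0 ≤ G.gHat 0 := by
  rw [hG.gωHat_zero hd hRa, hG.gHat_zero hd]
  exact integral_mono_ae (hG.integrable_gω hd hRa) (hG.integrable_g hd)
    ((hG.ae_gω hd hRa).mono fun _ h => h.2)

lemma gωHat_zero_sub_le (p : Space d) : G.gωHat 0 - G.gωHat p ≤ ‖p‖ * G.R * G.gHat 0 := by
  refine (fourier_zero_sub_le (hG.integrable_gω hd hRa) ((hG.ae_gω hd hRa).mono fun _ h => h.1)
    (fun y hy => by rw [hG.g_eq_zero hy, zero_mul]) p).trans ?_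
  have := hG.R_pos
  exact mul_le_mul_of_nonneg_left (hG.gωHat_zero_le hd hRa) (by positivity)

end BoseGas.Admissible

/-- **The sum-to-integral estimate** on the torus of side `ℓ`. -/
lemma BoseGas.sum_gHat_sq_le (hd : d = 2 ∨ d = 3) :
    ∃ C : ℝ, 0 ≤ C ∧ ∀ (G : BoseGas d), G.Admissible →
      (d = 2 → G.R < G.a * Real.exp (1 / (2 * G.delta))) → ∀ ℓ : ℝ, G.R ≤ ℓ / 4 →
      Summable (fun m : Mode d => G.gHat (ℓ⁻¹ • unitMom m) ^ 2 / ‖ℓ⁻¹ • unitMom m‖ ^ 2) ∧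
      (ℓ ^ d)⁻¹ * ∑' m : Mode d, G.gHat (ℓ⁻¹ • unitMom m) ^ 2 / ‖ℓ⁻¹ • unitMom m‖ ^ 2
        ≤ 2 * (G.gωHat 0 - G.shift ℓ * G.gHat 0 + C * |G.slope ℓ| * G.gHat 0) := by
  obtain ⟨C, hC, hmain⟩ := UnitScattering.sum_le hd
  refine ⟨C, hC, fun G hG hRa ℓ hR => ?_⟩
  have hℓ : 0 < ℓ := by have := hG.R_pos; linarith
  obtain ⟨hs, hle⟩ := hmain _ _ _ _ (hG.unitScattering hd hR)
  set γ : Space d → ℝ := fun y => ℓ ^ 2 * G.g (ℓ • y) with hγ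
  have hi : Integrable γ := (hG.unitScattering hd hR).integrable_g
  have hθ : (∫ y, γ y) = ℓ ^ 2 * (ℓ ^ d)⁻¹ * G.gHat 0 := by
    rw [hγ, integral_const_mul, integral_comp_smul_space hℓ G.g, hG.gHat_zero hd]; ring
  have hθ2 : (∫ y, γ y * (1 - G.φ (ℓ • y))) = ℓ ^ 2 * (ℓ ^ d)⁻¹ * G.gωHat 0 := by
    rw [hG.gωHat_zero hd hRa, mul_assoc, ← integral_comp_smul_space hℓ fun x => G.g x * G.ω x,
      ← integral_const_mul]
    congr 1; funext y
    rw [hγ, BoseGas.ω]; ring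
  -- Scaling of Fourier coefficients. Only the real part is identified, which is enough because the
  -- real part is at most the modulus and an upper bound is wanted.
  have hcoef : ∀ m, ℓ ^ 2 * (ℓ ^ d)⁻¹ * G.gHat (ℓ⁻¹ • unitMom m) = (unitFourier γ m).re := by
    intro m
    rw [unitFourier_eq hi, BoseGas.gHat, fourier_eq (hG.integrable_g hd), mul_assoc,
      ← integral_comp_smul_space hℓ, ← integral_const_mul]
    simp only [Complex.sub_re, Complex.ofReal_re, Complex.mul_re, Complex.I_re, Complex.I_im,
      Complex.ofReal_im, zero_mul, mul_zero, sub_zero]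
    congr 1; funext y
    rw [hγ, inner_smul_left, inner_smul_right]
    simp only [conj_trivial]
    rw [← mul_assoc ℓ⁻¹ ℓ, inv_mul_cancel₀ hℓ.ne', one_mul]
    ring
  have hpt : ∀ m, G.gHat (ℓ⁻¹ • unitMom m) ^ 2 / ‖ℓ⁻¹ • unitMom m‖ ^ 2
      ≤ 2 * (ℓ ^ d) ^ 2 / ℓ ^ 2 * (‖unitFourier γ m‖ ^ 2 / (2 * ‖unitMom m‖ ^ 2)) := by
    intro m
    have h1 : (ℓ ^ 2 * (ℓ ^ d)⁻¹ * G.gHat (ℓ⁻¹ • unitMom m)) ^ 2 ≤ ‖unitFourier γ m‖ ^ 2 := by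
      rw [hcoef m, ← sq_abs]
      exact pow_le_pow_left₀ (abs_nonneg _) (Complex.abs_re_le_norm _) 2
    rw [norm_smul, norm_inv, Real.norm_of_nonneg hℓ.le, mul_pow]
    rcases eq_or_ne ‖unitMom m‖ 0 with h0 | h0
    · rw [h0]; norm_num
    · have e : G.gHat (ℓ⁻¹ • unitMom m) ^ 2 / (ℓ⁻¹ ^ 2 * ‖unitMom m‖ ^ 2)
          = 2 * (ℓ ^ d) ^ 2 / ℓ ^ 2 * ((ℓ ^ 2 * (ℓ ^ d)⁻¹ * G.gHat (ℓ⁻¹ • unitMom m)) ^ 2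
            / (2 * ‖unitMom m‖ ^ 2)) := by
        field_simp
      rw [e]
      gcongr
  have hs' := hs.mul_left (2 * (ℓ ^ d) ^ 2 / ℓ ^ 2)
  have hs2 := Summable.of_nonneg_of_le (fun m => by positivity) hpt hs'
  refine ⟨hs2, ?_⟩
  have h3 := hs2.tsum_le_tsum hpt hs'
  rw [tsum_mul_left] at h3
  have hc : 0 ≤ (ℓ ^ d)⁻¹ := by positivity
  have hk : 0 ≤ 2 * (ℓ ^ d) ^ 2 / ℓ ^ 2 := by positivity
  refine (mul_le_mul_of_nonneg_left (h3.trans (mul_le_mul_of_nonneg_left hle hk)) hc).trans_eq ?_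
  rw [hθ, hθ2]
  field_simp

end GasFourier

/-! ### Parameter estimates in the dilute regime -/

section Regime

variable {d : ℕ}

lemma mom_eq (G : BoseGas d) (P : Params) (m : Mode d) : mom G P m = (ell G P)⁻¹ • unitMom m := by
  ext i
  simp [mom, unitMom]
  ring

/-- The consequences of the relations between the parameters that enter the estimate of the soft
pairs; `E` bounds the sum-to-integral error. -/
structure DiluteRegime (G : BoseGas d) (P : Params) (E : ℝ) : Prop where
  ell_pos : 0 < ell G P
  gHat_pos : 0 < G.gHat 0
  M_pos : 0 < P.M
  Kell_ge : 1 ≤ P.Kell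
  KL_ge : 2 ≤ P.KL
  KH_ge : 4 * P.KL ≤ P.KH
  Kell_sq_le : 8 * P.Kell ^ 2 ≤ P.KH
  ell_sq : ell G P ^ 2 * G.ρ * G.gHat 0 = P.Kell ^ 2
  R_lt : d = 2 → G.R < G.a * Real.exp (1 / (2 * G.delta))
  E_nonneg : 0 ≤ E
  summable : Summable fun m : Mode d => G.gHat (mom G P m) ^ 2 / ‖mom G P m‖ ^ 2
  sum_le : (vol G P)⁻¹ * ∑' m : Mode d, G.gHat (mom G P m) ^ 2 / ‖mom G P m‖ ^ 2
    ≤ 2 * (G.gωHat 0 + E)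
  gap : 3 / 2 * G.ρ * (4 * E + 6 * (P.Kell ^ 2 / P.KH ^ 2) * G.gHat 0
    + P.KL / ell G P * G.R * G.gHat 0) ≤ P.εgap / ell G P ^ 2
  quartic : G.ρ * G.gHat 0 ^ 2 * ell G P ^ 2 / vol G P / P.KH ^ 2 * P.KL ^ d * P.M
    ≤ P.Kell ^ 2 / (32 * ell G P ^ 2)

/-- Put `L = -log (ρa²) ≥ 1`. Then `1/δ = L + log L`, so `r = a e^{1/(2δ)}` satisfies `ρ r² = L` and
`ρ r² δ = L / (L + log L)`, which lies in `[1/2, 1]` since `0 ≤ log L ≤ L`. Thus `r` is comparable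
to `(ρδ)^{-1/2}`, the length scale of `ℓ / K_ℓ`. -/
lemma BoseGas.delta_two {G : BoseGas 2} (ha : 0 < G.a) (hρ : 0 < G.ρ)
    (hx : G.ρ * G.a ^ 2 ≤ Real.exp (-1)) :
    G.delta ≤ (-Real.log (G.ρ * G.a ^ 2))⁻¹ ∧
    1 / 2 ≤ G.ρ * (G.a * Real.exp (1 / (2 * G.delta))) ^ 2 * G.delta ∧
    G.ρ * (G.a * Real.exp (1 / (2 * G.delta))) ^ 2 * G.delta ≤ 1 := by
  set x := G.ρ * G.a ^ 2 with hxdef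
  have hx0 : 0 < x := by positivity
  set L := -Real.log x with hL
  have hL1 : 1 ≤ L := by
    have := Real.log_le_log hx0 hx
    rw [Real.log_exp] at this
    linarith
  have hL0 : 0 < L := by linarith
  have hlL : 0 ≤ Real.log L := Real.log_nonneg hL1
  have hlL' : Real.log L ≤ L := (Real.log_le_sub_one_of_pos hL0).trans (by linarith)
  have hδ : G.delta = 1 / (L + Real.log L) := by
    have e1 : |Real.log x| = L := by rw [abs_of_nonpos (by linarith)]
    rw [BoseGas.delta, ← hxdef, e1, Real.log_mul hx0.ne' (by positivity), Real.log_inv,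
      show Real.log x + -Real.log L = -(L + Real.log L) by rw [hL]; ring, abs_neg,
      abs_of_nonneg (by linarith)]
  have hexp : G.ρ * (G.a * Real.exp (1 / (2 * G.delta))) ^ 2 = L := by
    rw [hδ, mul_pow, ← Real.exp_nat_mul,
      show ((2 : ℕ) : ℝ) * (1 / (2 * (1 / (L + Real.log L)))) = L + Real.log L by
        push_cast; field_simp,
      Real.exp_add, Real.exp_log hL0, hL, Real.exp_neg, Real.exp_log hx0, ← mul_assoc, ← hxdef,
      ← mul_assoc, mul_inv_cancel₀ hx0.ne', one_mul]
  rw [hexp, hδ]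
  refine ⟨?_, ?_, ?_⟩
  · rw [← one_div]
    exact one_div_le_one_div_of_le hL0 (by linarith)
  · rw [mul_one_div, div_le_div_iff₀ two_pos (by positivity)]; linarith
  · rw [mul_one_div, div_le_one (by positivity)]; linarith

/-- Smallness of `ρ a^d` forces smallness of `s`, hence of the common factor `c s^ζ` of all the `≪`.
In two dimensions `δ ≤ 1/|log (ρa²)|`, which is why the constant is exponential in `s₀⁻¹`. -/
lemma BoseGas.exists_small (hd : d = 2 ∨ d = 3) {c ζ ε₀ : ℝ} (hc : 0 < c) (hζ : 0 < ζ)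
    (hε : 0 < ε₀) : ∃ C : ℝ, 0 < C ∧ ∀ G : BoseGas d, 0 < G.a → 0 < G.ρ →
      G.ρ * G.a ^ d ≤ C⁻¹ → 0 ≤ c * G.small ^ ζ ∧ c * G.small ^ ζ ≤ ε₀ ∧
      (d = 2 → 1 / 2 ≤ G.ρ * (G.a * Real.exp (1 / (2 * G.delta))) ^ 2 * G.delta ∧
        G.ρ * (G.a * Real.exp (1 / (2 * G.delta))) ^ 2 * G.delta ≤ 1) := by
  set s₀ := (ε₀ / c) ^ ζ⁻¹ with hs
  have hs0 : 0 < s₀ := by positivity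
  have key : ∀ s, 0 ≤ s → s ≤ s₀ → 0 ≤ c * s ^ ζ ∧ c * s ^ ζ ≤ ε₀ := by
    intro s h1 h2
    refine ⟨by positivity, ?_⟩
    have : s ^ ζ ≤ ε₀ / c := by
      refine (Real.rpow_le_rpow h1 h2 hζ.le).trans_eq ?_
      rw [hs, ← Real.rpow_mul (by positivity), inv_mul_cancel₀ hζ.ne', Real.rpow_one]
    rw [le_div_iff₀ hc] at this
    linarith
  rcases hd with rfl | rfl
  · refine ⟨Real.exp (max 1 s₀⁻¹), Real.exp_pos _, fun G ha hρ hx => ?_⟩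
    rw [← Real.exp_neg] at hx
    have hx1 : G.ρ * G.a ^ 2 ≤ Real.exp (-1) :=
      hx.trans (Real.exp_le_exp.2 (neg_le_neg (le_max_left _ _)))
    obtain ⟨h1, h2, h3⟩ := BoseGas.delta_two ha hρ hx1
    have hlog := Real.log_le_log (by positivity) hx
    rw [Real.log_exp] at hlog
    have h4 : G.small ≤ s₀ := by
      rw [BoseGas.small, if_pos rfl]
      refine h1.trans ?_
      rw [inv_le_comm₀ _ hs0]
      · linarith [le_max_right (1 : ℝ) s₀⁻¹]
      · linarith [le_max_left (1 : ℝ) s₀⁻¹]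
    have h5 := key G.small (by rw [BoseGas.small, if_pos rfl]; exact G.delta_nonneg) h4
    exact ⟨h5.1, h5.2, fun _ => ⟨h2, h3⟩⟩
  · refine ⟨s₀⁻¹, by positivity, fun G ha hρ hx => ?_⟩
    rw [inv_inv] at hx
    have e : G.small = G.ρ * G.a ^ 3 := by rw [BoseGas.small, if_neg (by norm_num)]
    have h5 := key G.small (by rw [e]; positivity) (e.trans_le hx)
    exact ⟨h5.1, h5.2, fun h => absurd h (by norm_num)⟩

/-- In two dimensions the logarithm in the sum-to-integral error dominates `log (ℓ / R')` and `1`,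
`R'` being the length `a e^{1/(2δ)}` at which `φ = 1`. -/
lemma log_ratio_bounds {ε κ K KH ℓ r δ ρ Γ : ℝ} (hε : 0 < ε) (hε1 : ε ≤ 1) (hκ : 0 < κ)
    (hεκ : ε ≤ κ / 4) (hεκ' : ε * (9 * κ) ≤ 1) (hK : 1 ≤ ε * K) (hKH : K ^ 4 ≤ ε ^ 2 * KH)
    (hℓ : 0 < ℓ) (hr : 0 < r) (h1 : 1 / 2 ≤ ρ * r ^ 2 * δ) (h2 : ρ * r ^ 2 * δ ≤ 1)
    (hsq : ℓ ^ 2 * ρ * (κ * δ) = K ^ 2) (hΓ : 0 ≤ Γ) :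
    1 ≤ Real.log (ℓ / r) ∧
      Real.log (ℓ / r) ≤ |Real.log (KH * (r / 2 * Real.exp Γ) / ℓ)| := by
  set y := ℓ / r with hy
  have hy0 : 0 < y := by positivity
  have hK0 : 0 < K := by
    by_contra h
    nlinarith
  have hK1 : 1 ≤ K := by nlinarith
  -- With `ρ r² δ ∈ [1/2, 1]` this pins `y² = (ℓ/r)²` between `K²/κ` and `2K²/κ`. The lower bound
  -- gives `y ≥ 3 > e`, and the upper one with `K_H ≫ K⁴` gives `K_H ≥ 2y²`.
  have e1 : y ^ 2 * (κ * (ρ * r ^ 2 * δ)) = K ^ 2 := by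
    rw [← hsq, hy]; field_simp
  have hlow : K ^ 2 ≤ y ^ 2 * κ := by
    rw [← e1]
    have : κ * (ρ * r ^ 2 * δ) ≤ κ := mul_le_of_le_one_right hκ.le h2
    exact mul_le_mul_of_nonneg_left this (by positivity)
  have hup : y ^ 2 * κ ≤ 2 * K ^ 2 := by
    rw [← e1]
    have : κ / 2 ≤ κ * (ρ * r ^ 2 * δ) := by nlinarith
    nlinarith [sq_nonneg y]
  have hy3 : 3 ≤ y := by
    have h3 : 9 * κ ≤ K ^ 2 := by
      have : 1 ≤ ε ^ 2 * K ^ 2 := by nlinarith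
      have h4 : ε ^ 2 * (9 * κ) ≤ 1 := by nlinarith
      have : ε ^ 2 * (9 * κ) ≤ ε ^ 2 * K ^ 2 := h4.trans this
      exact le_of_mul_le_mul_left this (by positivity)
    have : 9 ≤ y ^ 2 := le_of_mul_le_mul_right (h3.trans hlow) hκ
    nlinarith
  have hKH2 : 2 * y ^ 2 ≤ KH := by
    have h3 : 4 * K ^ 2 ≤ κ * KH := by
      have h4 : K ^ 2 ≤ ε ^ 2 * KH := (pow_le_pow_right₀ hK1 (by norm_num)).trans hKH
      have hKH0 : 0 ≤ KH := by
        by_contra hcon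
        nlinarith [sq_nonneg ε, pow_pos hK0 2]
      have h5 : ε ^ 2 * 4 ≤ κ := by nlinarith
      nlinarith
    nlinarith
  constructor
  · rw [Real.le_log_iff_exp_le hy0]
    linarith [Real.exp_one_lt_d9]
  · refine le_trans (Real.log_le_log hy0 ?_) (le_abs_self _)
    have hG : 1 ≤ Real.exp Γ := Real.one_le_exp hΓ
    have e2 : KH * (r / 2 * Real.exp Γ) / ℓ = KH / (2 * y) * Real.exp Γ := by
      rw [hy]; field_simp
    rw [e2]
    have h3 : y ≤ KH / (2 * y) := by
      rw [le_div_iff₀ (by positivity)]; nlinarith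
    nlinarith

/-- The Euler–Mascheroni constant only enters through its sign. -/
lemma eulerMascheroni_nonneg : 0 ≤ Real.eulerMascheroniConstant :=
  (by norm_num : (0 : ℝ) ≤ 1 / 2).trans Real.one_half_lt_eulerMascheroniConstant.le

lemma sumError_nonneg {G : BoseGas d} {P : Params} (hKH : 0 ≤ P.KH) (hℓ : 0 ≤ ell G P) :
    0 ≤ sumError G P := by
  unfold sumError
  split_ifs <;> positivity

/-- The boundary terms of the sum-to-integral estimate are controlled by `sumError`. -/
lemma boundary_le (hd : d = 2 ∨ d = 3) {G : BoseGas d} {P : Params} {ε κ C : ℝ}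
    (hG : G.Admissible) (hC : 0 ≤ C)
    (hε : 0 < ε) (hε1 : ε ≤ 1) (hκ : 0 < κ) (hεκ : ε ≤ κ / 4) (hεκ' : ε * (9 * κ) ≤ 1)
    (hK : 1 ≤ ε * P.Kell) (hKH : P.Kell ^ 4 ≤ ε ^ 2 * P.KH) (hKH1 : 1 ≤ P.KH)
    (hℓ : 0 < ell G P) (hsq : ell G P ^ 2 * G.ρ * G.gHat 0 = P.Kell ^ 2)
    (hratio : G.gHat 0 = κ * if d = 2 then G.delta else G.a) (hg : 0 < G.gHat 0)
    (hδ : d = 2 → 1 / 2 ≤ G.ρ * (G.a * Real.exp (1 / (2 * G.delta))) ^ 2 * G.delta ∧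
      G.ρ * (G.a * Real.exp (1 / (2 * G.delta))) ^ 2 * G.delta ≤ 1) :
    -G.shift (ell G P) * G.gHat 0 + C * |G.slope (ell G P)| * G.gHat 0
      ≤ 2 / κ * (1 + C) * sumError G P := by
  have ha := hG.a_pos
  set ℓ := ell G P with hℓdef
  rcases hd with rfl | rfl
  · rw [if_pos rfl] at hratio
    set r := G.a * Real.exp (1 / (2 * G.delta)) with hr
    have hr0 : 0 < r := by positivity
    have hδ0 : 0 < G.delta := by
      rw [hratio] at hg; exact pos_of_mul_pos_right hg hκ.le
    obtain ⟨l1, l2⟩ := log_ratio_bounds hε hε1 hκ hεκ hεκ' hK hKH hℓ hr0 (hδ rfl).1 (hδ rfl).2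
      (by rw [← hratio]; exact hsq) eulerMascheroni_nonneg
    -- In two dimensions the shift is negative, so it contributes a positive error `2δ log (ℓ/r)
    -- ĝ(0)`. As `δ` is proportional to `ĝ(0)`, this is a multiple of `ĝ(0)² log (ℓ/r)`, hence
    -- covered by the logarithm in `sumError`.
    have hshift : G.shift ℓ = -(2 * G.delta * Real.log (ℓ / r)) := by
      rw [BoseGas.shift, if_pos rfl, hr, Real.log_div hℓ.ne' ha.ne',
        Real.log_div hℓ.ne' (by positivity), Real.log_mul ha.ne' (by positivity), Real.log_exp]
      field_simp
      ring
    have hslope : |G.slope ℓ| = 2 * G.delta := by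
      rw [BoseGas.slope, if_pos rfl, abs_neg, abs_of_pos (by positivity)]
    have hX : G.gHat 0 ^ 2 * Real.log (ℓ / r) ≤ sumError G P := by
      rw [sumError, if_pos rfl]
      have e : G.ellDelta = r / 2 * Real.exp Real.eulerMascheroniConstant := by
        rw [BoseGas.ellDelta, hr]; ring
      rw [← e] at l2
      have := mul_le_mul_of_nonneg_left l2 (sq_nonneg (G.gHat 0))
      have h3 : 0 ≤ G.R ^ 2 / G.ellDelta ^ 2 * G.gHat 0 ^ 2 := by positivity
      linarith
    have hδg : 2 * G.delta * G.gHat 0 = 2 / κ * G.gHat 0 ^ 2 := by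
      have : G.delta = G.gHat 0 / κ := by rw [hratio]; field_simp
      rw [this]; ring
    rw [hshift, hslope]
    have hX' : G.gHat 0 ^ 2 ≤ sumError G P := le_trans (by nlinarith [sq_nonneg (G.gHat 0)]) hX
    calc _ = 2 / κ * (G.gHat 0 ^ 2 * Real.log (ℓ / r)) + C * (2 / κ * G.gHat 0 ^ 2) := by
          rw [← hδg]; linear_combination Real.log (ℓ / r) * hδg
      _ ≤ 2 / κ * sumError G P + C * (2 / κ * sumError G P) := by gcongr
      _ = _ := by ring
  · rw [if_neg (by norm_num)] at hratio
    have hshift : G.shift ℓ = 0 := by rw [BoseGas.shift, if_neg (by norm_num)]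
    have hslope : |G.slope ℓ| = G.gHat 0 / (κ * ℓ) := by
      rw [BoseGas.slope, if_neg (by norm_num), hratio, abs_of_pos (by positivity)]
      field_simp
    have hX : G.gHat 0 ^ 2 / ℓ ≤ sumError G P := by
      rw [sumError, if_neg (by norm_num), ← hℓdef]
      gcongr
      exact le_mul_of_one_le_right (sq_nonneg _) hKH1
    have hX0 : 0 ≤ sumError G P := le_trans (by positivity) hX
    rw [hshift, hslope]
    calc _ = C * (1 / κ * (G.gHat 0 ^ 2 / ℓ)) := by field_simp; ring
      _ ≤ C * (1 / κ * sumError G P) := by gcongr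
      _ = 1 / κ * (C * sumError G P) := by ring
      _ ≤ 1 / κ * (2 * (1 + C) * sumError G P) := by gcongr; linarith
      _ = _ := by ring

/-- In two dimensions the relations force `R < a e^{1/(2δ)}`. -/
lemma R_lt_of_gap {ε κ K KL ℓ r δ ρ R g e : ℝ} (hε : 0 < ε) (hε1 : ε ≤ 1) (hκ : 0 < κ)
    (hεκ : ε ≤ κ / 4) (hK : 1 ≤ K) (hKL : 1 ≤ KL) (hℓ : 0 < ℓ) (hr : 0 < r) (hρ : 0 < ρ)
    (hg : 0 < g) (hgδ : g = κ * δ) (h1 : 1 / 2 ≤ ρ * r ^ 2 * δ) (hsq : ℓ ^ 2 * ρ * g = K ^ 2)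
    (he : e ≤ ε) (hgap : R / ℓ * KL * ℓ ^ 2 * ρ * g ≤ ε * e) : R < r := by
  by_contra hcon
  have hrR := not_lt.1 hcon
  -- If `R ≥ r`, the gap relation bounds this quantity by `ε²`; but its square is `ρ r² δ · κ K²
  -- K_L² ≥ κ/2`, whereas `ε⁴ ≤ ε ≤ κ/4`.
  have e1 : r * KL * ℓ * ρ * g ≤ ε ^ 2 := by
    calc r * KL * ℓ * ρ * g ≤ R * KL * ℓ * ρ * g := by gcongr
      _ = R / ℓ * KL * ℓ ^ 2 * ρ * g := by field_simp
      _ ≤ ε * e := hgap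
      _ ≤ ε ^ 2 := by nlinarith
  have e2 : (r * KL * ℓ * ρ * g) ^ 2 ≤ (ε ^ 2) ^ 2 := pow_le_pow_left₀ (by positivity) e1 2
  have e3 : (r * KL * ℓ * ρ * g) ^ 2 = ρ * r ^ 2 * δ * κ * K ^ 2 * KL ^ 2 := by
    rw [← hsq]
    rw [hgδ]
    ring
  have e4 : κ / 2 ≤ ρ * r ^ 2 * δ * κ * K ^ 2 * KL ^ 2 := by
    calc κ / 2 = 1 / 2 * κ * 1 * 1 := by ring
      _ ≤ ρ * r ^ 2 * δ * κ * K ^ 2 * KL ^ 2 := by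
        gcongr
        · exact one_le_pow₀ hK
        · exact one_le_pow₀ hKL
  have e5 : (ε ^ 2) ^ 2 ≤ ε := by
    rw [← pow_mul]
    exact pow_le_of_le_one hε.le hε1 (by norm_num)
  linarith

end Regime

/-! ### From the relations `≪` to the dilute regime -/

section RegimeExists

variable {d : ℕ}

lemma ell_eq_sq {G : BoseGas d} {P : Params} (hρ : 0 < G.ρ) (hg : 0 < G.gHat 0) : ell G P ^ 2 * G.ρ * G.gHat 0 = P.Kell ^ 2 := by
  have hs : 0 < G.ρ * G.gHat 0 := by positivity
  rw [ell, div_pow, Real.sq_sqrt hs.le]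
  field_simp

/-- The relations between the parameters, with `ε = c s^ζ` small, imply those needed. -/
lemma ParamRelations.diluteRegime (hd : d = 2 ∨ d = 3) {G : BoseGas d} {P : Params}
    {c ζ ε κ C : ℝ} (hG : G.Admissible) (hP : ParamRelations G P c ζ)
    (hεdef : ε = c * G.small ^ ζ) (hε0 : 0 ≤ ε) (hε1 : ε ≤ 1 / 100) (hκ : 0 < κ)
    (hεκ : ε ≤ κ / 4) (hεκ' : ε * (9 * κ) ≤ 1) (hC : 0 ≤ C)
    (hεC : 3 / 2 * (4 * (2 / κ * (1 + C)) + 7) * ε ≤ 1)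
    (hR : G.R ≤ ell G P / 4)
    (hratio : G.gHat 0 = κ * if d = 2 then G.delta else G.a)
    (hδ : d = 2 → 1 / 2 ≤ G.ρ * (G.a * Real.exp (1 / (2 * G.delta))) ^ 2 * G.delta ∧
      G.ρ * (G.a * Real.exp (1 / (2 * G.delta))) ^ 2 * G.delta ≤ 1)
    (hsum : (d = 2 → G.R < G.a * Real.exp (1 / (2 * G.delta))) → ∀ ℓ : ℝ, G.R ≤ ℓ / 4 →
      Summable (fun m : Mode d => G.gHat (ℓ⁻¹ • unitMom m) ^ 2 / ‖ℓ⁻¹ • unitMom m‖ ^ 2) ∧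
      (ℓ ^ d)⁻¹ * ∑' m : Mode d, G.gHat (ℓ⁻¹ • unitMom m) ^ 2 / ‖ℓ⁻¹ • unitMom m‖ ^ 2
        ≤ 2 * (G.gωHat 0 - G.shift ℓ * G.gHat 0 + C * |G.slope ℓ| * G.gHat 0)) :
    DiluteRegime G P (2 / κ * (1 + C) * sumError G P) := by
  have hml : ∀ {A B : ℝ}, G.MuchLess c ζ A B → A ≤ ε * B := fun h => by rw [hεdef]; exact h
  have hR0 := hG.R_pos
  have hρ := hG.ρ_pos
  have hℓ : 0 < ell G P := by linarith
  have hg0 := hG.gHat_zero_nonneg hd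
  -- If `ĝ(0)` vanished, the quotient defining `ℓ` would be `0` by convention, contradicting `0 < R
  -- ≤ ℓ/4`.
  have hg : 0 < G.gHat 0 := by
    refine lt_of_le_of_ne hg0 fun h => ?_
    have : ell G P = 0 := by rw [ell, ← h]; simp
    linarith
  have hsq := ell_eq_sq (P := P) hρ hg
  have hK := hml hP.Kell_large
  have hε : 0 < ε := lt_of_le_of_ne hε0 fun h => by rw [← h] at hK; linarith
  have hM : 0 < P.M := by
    have := hml hP.M_large
    by_contra hcon
    nlinarith
  have hKpos : 0 < P.Kell := by
    by_contra hcon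
    nlinarith
  have hK1 : 100 ≤ P.Kell := by
    have := mul_le_mul_of_nonneg_right hε1 hKpos.le
    linarith
  have hK41 : P.Kell ^ 2 ≤ P.Kell ^ 4 := pow_le_pow_right₀ (by linarith) (by norm_num)
  have hK4 := hml hP.Kell4_KL
  have hKLpos : 0 < P.KL := by
    have : 0 < ε * P.KL := lt_of_lt_of_le (by positivity) hK4
    exact pos_of_mul_pos_right this hε.le
  have hKLK : 100 * P.Kell ^ 2 ≤ P.KL := by
    have := mul_le_mul_of_nonneg_right hε1 hKLpos.le
    linarith
  have hKLKH := hml hP.KL_KH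
  have hKHpos : 0 < P.KH := pos_of_mul_pos_right (hKLpos.trans_le hKLKH) hε.le
  have hKHKL : 100 * P.KL ≤ P.KH := by
    have := mul_le_mul_of_nonneg_right hε1 hKHpos.le
    linarith
  have hKL1 : 100 ≤ P.KL := by nlinarith only [hK1, hKLK]
  have hK4KH : P.Kell ^ 4 ≤ ε ^ 2 * P.KH := by
    calc P.Kell ^ 4 ≤ ε * P.KL := hK4
      _ ≤ ε * (ε * P.KH) := by gcongr
      _ = _ := by ring
  have hX : 0 ≤ sumError G P := sumError_nonneg hKHpos.le hℓ.le
  have hgap := hP.εgap_pos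
  have hgap1 : P.εgap ≤ ε := by simpa using hml hP.εgap_small
  have h3 := hml hP.gap_three
  have h2 := hml hP.gap_two
  have hεK := hP.εK_pos
  have hRlt : d = 2 → G.R < G.a * Real.exp (1 / (2 * G.delta)) := fun h => by
    rw [if_pos h] at hratio
    exact R_lt_of_gap hε (by linarith) hκ hεκ (by linarith) (by linarith) hℓ
      (mul_pos hG.a_pos (Real.exp_pos _)) hρ hg hratio (hδ h).1 hsq hgap1 h3
  obtain ⟨s1, s2⟩ := hsum hRlt (ell G P) hR
  simp_rw [← mom_eq] at s1 s2
  have hbd := boundary_le hd hG hC hε (by linarith) hκ hεκ hεκ' hK hK4KH (by linarith) hℓ hsq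
    hratio hg hδ
  have i1 : 0 ≤ P.εK * ell G P ^ 2 * G.ρ * G.gHat 0 := by positivity
  have i2 : 0 ≤ sumError G P * ell G P ^ 2 * G.ρ := by positivity
  have i3 : 0 ≤ P.Kell ^ 2 / P.KH := by positivity
  refine ⟨hℓ, hg, hM, by linarith, by linarith, by linarith, by linarith, hsq, hRlt,
    by positivity, s1, ?_, ?_, ?_⟩
  · refine le_trans s2 ?_
    linarith
  · rw [le_div_iff₀ (by positivity)]
    have j1 : sumError G P * ell G P ^ 2 * G.ρ ≤ ε * P.εgap := by linarith
    have j2 : P.Kell ^ 2 / P.KH ≤ ε * P.εgap := by linarith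
    have j3 : P.Kell ^ 2 / P.KH ≤ 1 := by rw [div_le_one hKHpos]; linarith
    have j4 : P.Kell ^ 2 / P.KH * (P.Kell ^ 2 / P.KH) ≤ ε * P.εgap :=
      (mul_le_of_le_one_right i3 j3).trans j2
    have hC1 : 0 ≤ 2 / κ * (1 + C) := by positivity
    set C₁ := 2 / κ * (1 + C)
    have e : 3 / 2 * G.ρ * (4 * (C₁ * sumError G P) + 6 * (P.Kell ^ 2 / P.KH ^ 2) * G.gHat 0
        + P.KL / ell G P * G.R * G.gHat 0) * ell G P ^ 2
        = 3 / 2 * (4 * C₁ * (sumError G P * ell G P ^ 2 * G.ρ)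
          + 6 * (P.Kell ^ 2 / P.KH ^ 2 * (ell G P ^ 2 * G.ρ * G.gHat 0))
          + G.R / ell G P * P.KL * ell G P ^ 2 * G.ρ * G.gHat 0) := by ring
    rw [e, hsq]
    have j5 : P.Kell ^ 2 / P.KH ^ 2 * P.Kell ^ 2
        = P.Kell ^ 2 / P.KH * (P.Kell ^ 2 / P.KH) := by field_simp
    rw [j5]
    calc _ ≤ 3 / 2 * (4 * C₁ * (ε * P.εgap) + 6 * (ε * P.εgap) + ε * P.εgap) := by gcongr
      _ = (3 / 2 * (4 * C₁ + 7) * ε) * P.εgap := by ring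
      _ ≤ 1 * P.εgap := by gcongr
      _ = P.εgap := one_mul _
  · have h4 := hml hP.Kell_sq_large
    have e : ell G P ^ ((4 : ℤ) - d) * G.ρ * G.gHat 0 ^ 2 * P.KH ^ (-2 : ℤ) * P.KL ^ d * P.M
        = G.ρ * G.gHat 0 ^ 2 * ell G P ^ 2 / vol G P / P.KH ^ 2 * P.KL ^ d * P.M
          * ell G P ^ 2 := by
      have e1 : ell G P ^ ((4 : ℤ) - d) = ell G P ^ 4 / vol G P := by
        rw [zpow_sub₀ hℓ.ne', vol, zpow_natCast]; norm_cast
      have e2 : P.KH ^ (-2 : ℤ) = (P.KH ^ 2)⁻¹ := by rw [zpow_neg]; norm_cast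
      rw [e1, e2]; ring
    rw [e] at h4
    rw [le_div_iff₀ (by positivity)]
    have := mul_le_mul_of_nonneg_right hε1 (sq_nonneg P.Kell)
    have hKsq := sq_nonneg P.Kell
    linarith

/-- In the dilute limit all admissible data are in the dilute regime. -/
lemma exists_diluteRegime (hd : d = 2 ∨ d = 3) {c ζ : ℝ} (hc : 0 < c) (hζ : 0 < ζ) :
    ∃ C : ℝ, 0 < C ∧ ∀ (G : BoseGas d) (P : Params), G.Admissible → ParamRelations G P c ζ →
      G.R ≤ ell G P / 4 → G.ρ * G.a ^ d ≤ C⁻¹ → ∃ E, DiluteRegime G P E := by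
  obtain ⟨C, hC, hsum⟩ := BoseGas.sum_gHat_sq_le hd
  set κ := gRatio d with hκdef
  -- the ratio is positive as soon as there is a gas with these data
  have hκ : ∀ (G : BoseGas d) (P : Params), G.Admissible → G.R ≤ ell G P / 4 → 0 < κ := by
    intro G P hG hR
    have hR0 := hG.R_pos
    have hg : G.gHat 0 ≠ 0 := fun h => by
      have : ell G P = 0 := by rw [ell, h]; simp
      linarith
    have hg' := lt_of_le_of_ne (hG.gHat_zero_nonneg hd) hg.symm
    rw [hG.gHat_zero_eq hd] at hg'
    have h0 : 0 ≤ if d = 2 then G.delta else G.a := by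
      split_ifs
      · exact G.delta_nonneg
      · exact hG.a_pos.le
    exact pos_of_mul_pos_left hg' h0
  -- The smallness threshold must be chosen before any gas is given, when the sign of `κ` is not yet
  -- known; the second branch is an arbitrary positive value, and once admissible data are present
  -- the first one applies.
  set ε₀ := if 0 < κ then min (min (1 / 100) (κ / 4))
    (min (9 * κ)⁻¹ (3 / 2 * (4 * (2 / κ * (1 + C)) + 7))⁻¹) else 1 with hε₀
  have hε₀pos : 0 < ε₀ := by
    rw [hε₀]
    split_ifs with h
    · positivity
    · exact one_pos
  obtain ⟨C', hC', hsmall⟩ := BoseGas.exists_small hd hc hζ hε₀pos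
  refine ⟨C', hC', fun G P hG hP hR hx => ?_⟩
  have hκ0 := hκ G P hG hR
  obtain ⟨h0, h1, h2⟩ := hsmall G hG.a_pos hG.ρ_pos hx
  rw [hε₀, if_pos hκ0, le_min_iff, le_min_iff, le_min_iff] at h1
  obtain ⟨⟨h3, h4⟩, h5, h6⟩ := h1
  refine ⟨_, hP.diluteRegime hd hG rfl h0 h3 hκ0 h4 ?_ hC ?_ hR (hG.gHat_zero_eq hd) h2
    fun h => hsum G hG h⟩
  · rwa [← one_div, le_div_iff₀ (by positivity)] at h5
  · rwa [← one_div, le_div_iff₀ (by positivity), mul_comm] at h6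

end RegimeExists

/-! ### Momenta and Bogoliubov coefficients -/

section Coefficients

variable {d : ℕ}

lemma sqrt_one_add_two_mul_bounds {t : ℝ} (ht : |t| ≤ 1 / 4) :
    1 + t - t ^ 2 ≤ Real.sqrt (1 + 2 * t) ∧ Real.sqrt (1 + 2 * t) ≤ 1 + t := by
  obtain ⟨h1, h2⟩ := abs_le.1 ht
  constructor
  · refine Real.le_sqrt_of_sq_le ?_
    have : 0 ≤ t ^ 2 * (1 + 2 * t - t ^ 2) := mul_nonneg (sq_nonneg t) (by nlinarith)
    nlinarith
  · rw [Real.sqrt_le_left (by linarith)]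
    nlinarith [sq_nonneg t]

lemma mom_neg (G : BoseGas d) (P : Params) (m : Mode d) : mom G P (-m) = -mom G P m := by
  ext i; simp [mom]

lemma mom_sub (G : BoseGas d) (P : Params) (m m' : Mode d) :
    mom G P (m - m') = mom G P m - mom G P m' := by
  ext i; simp [mom]; ring

lemma mom_zero (G : BoseGas d) (P : Params) : mom G P 0 = 0 := by
  ext i; simp [mom]

namespace DiluteRegime

variable {G : BoseGas d} {P : Params} {E : ℝ} (h : DiluteRegime G P E)

include h

lemma vol_pos : 0 < vol G P := pow_pos h.ell_pos d

lemma KH_pos : 0 < P.KH := by linarith [h.KH_ge, h.KL_ge]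

lemma norm_mom_pos {k : Mode d} (hk : k ∈ PH G P) : 0 < ‖mom G P k‖ :=
  (div_pos h.KH_pos h.ell_pos).trans_le hk

lemma sq_le_norm_mom_sq {k : Mode d} (hk : k ∈ PH G P) :
    P.KH ^ 2 / ell G P ^ 2 ≤ ‖mom G P k‖ ^ 2 := by
  rw [← div_pow]
  exact pow_le_pow_left₀ (div_pos h.KH_pos h.ell_pos).le hk 2

lemma Kell_div_le : 3 / 2 * (P.Kell ^ 2 / P.KH ^ 2) ≤ 1 / 4 := by
  have hKH := h.KH_pos
  have h1 : 8 ≤ P.KH := by linarith [h.KH_ge, h.KL_ge]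
  have h2 : P.Kell ^ 2 / P.KH ^ 2 ≤ 1 / 6 := by
    rw [div_le_div_iff₀ (by positivity) (by norm_num)]
    nlinarith [h.Kell_sq_le]
  linarith

lemma norm_mom_ge {m : Mode d} (hm : m ≠ 0) : 2 * Real.pi / ell G P ≤ ‖mom G P m‖ := by
  obtain ⟨i, hi⟩ := Function.ne_iff.1 hm
  refine le_trans ?_ (PiLp.norm_apply_le (mom G P m) i)
  have h1 : (1 : ℝ) ≤ |(m i : ℝ)| := by exact_mod_cast Int.one_le_abs hi
  have h2 : 0 < 2 * Real.pi / ell G P := div_pos (by positivity) h.ell_pos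
  simp only [mom, Real.norm_eq_abs, abs_mul, abs_of_pos h2]
  exact le_mul_of_one_le_right h2.le h1

lemma norm_mom_pos_iff {m : Mode d} : 0 < ‖mom G P m‖ ↔ m ≠ 0 := by
  constructor
  · rintro h1 rfl
    rw [mom_zero, norm_zero] at h1
    exact h1.ne rfl
  · intro hm
    exact (div_pos (by positivity) h.ell_pos).trans_le (h.norm_mom_ge hm)

/-- The number of low momenta. -/
lemma PL_finite_card :
    ∃ S : Finset (Mode d), (S : Set (Mode d)) = PL G P ∧ (S.card : ℝ) ≤ P.KL ^ d := by
  have hKL := h.KL_ge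
  -- The labels of low momenta lie in a cube with `(2n + 1)^d` points, and `2n + 1 ≤ K_L/3 + 1 ≤
  -- K_L` because `2π ≥ 6` and `K_L ≥ 2`.
  set n : ℤ := ⌊P.KL / (2 * Real.pi)⌋ with hn
  have hpi := Real.pi_gt_three
  have hn0 : 0 ≤ n := Int.floor_nonneg.2 (by positivity)
  set B : Finset (Mode d) := Fintype.piFinset fun _ => Finset.Icc (-n) n with hB
  have hsub : PL G P ⊆ B := by
    intro m hm
    rw [hB, Finset.mem_coe, Fintype.mem_piFinset]
    intro i
    have h1 := (PiLp.norm_apply_le (mom G P m) i).trans hm.2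
    have h2 : 0 < 2 * Real.pi / ell G P := div_pos (by positivity) h.ell_pos
    simp only [mom, Real.norm_eq_abs, abs_mul, abs_of_pos h2] at h1
    have h3 : |(m i : ℝ)| ≤ P.KL / (2 * Real.pi) := by
      rw [le_div_iff₀ (by positivity)]
      rw [div_mul_eq_mul_div, div_le_div_iff_of_pos_right h.ell_pos] at h1
      linarith
    have h4 : |m i| ≤ n := by
      rw [hn, Int.le_floor]; push_cast; exact h3
    exact Finset.mem_Icc.2 (abs_le.1 h4)
  have hfin : (PL G P).Finite := B.finite_toSet.subset hsub
  refine ⟨hfin.toFinset, hfin.coe_toFinset, ?_⟩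
  have hcard : hfin.toFinset.card ≤ B.card :=
    Finset.card_le_card fun m hm => hsub (hfin.mem_toFinset.1 hm)
  have hBc : (B.card : ℝ) = (2 * n + 1) ^ d := by
    rw [hB, Fintype.card_piFinset]
    simp only [Int.card_Icc, Finset.prod_const, Finset.card_univ, Fintype.card_fin]
    push_cast
    congr 1
    have : ((n + 1 - -n).toNat : ℤ) = 2 * n + 1 := by
      rw [Int.toNat_of_nonneg (by linarith)]; ring
    exact_mod_cast this
  calc ((hfin.toFinset.card : ℕ) : ℝ) ≤ B.card := by exact_mod_cast hcard
    _ = (2 * n + 1) ^ d := hBc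
    _ ≤ P.KL ^ d := by
      have hn0' : (0 : ℝ) ≤ n := by exact_mod_cast hn0
      refine pow_le_pow_left₀ (by positivity) ?_ d
      have h1 : (n : ℝ) ≤ P.KL / (2 * Real.pi) := Int.floor_le _
      have h2 : P.KL / (2 * Real.pi) ≤ P.KL / 6 := by gcongr; linarith
      linarith

variable {z : ℂ} (hG : G.Admissible) (hd : d = 2 ∨ d = 3) (hz : |rhoZ G P z - G.ρ| ≤ G.ρ / 2)

include hG hd hz

omit h hd in
lemma rhoZ_pos : 0 < rhoZ G P z := by
  have := hG.ρ_pos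
  linarith [(abs_le.1 hz).1]

omit h hG hd in
lemma rhoZ_le : rhoZ G P z ≤ 3 / 2 * G.ρ := by linarith [(abs_le.1 hz).2]

/-- The size of the pairing interaction relative to the kinetic energy. -/
lemma abs_ratio_le {k : Mode d} (hk : k ∈ PH G P) :
    |rhoZ G P z * G.gHat (mom G P k) / ‖mom G P k‖ ^ 2| ≤ 3 / 2 * (P.Kell ^ 2 / P.KH ^ 2) := by
  have h1 := rhoZ_pos hG hz
  have h2 := hG.abs_gHat_le hd (mom G P k)
  have hq := h.sq_le_norm_mom_sq hk
  have hKH := h.KH_pos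
  have hℓ := h.ell_pos
  have hg := h.gHat_pos
  have hρ := hG.ρ_pos
  rw [abs_div, abs_mul, abs_of_pos h1, abs_of_nonneg (sq_nonneg ‖mom G P k‖)]
  calc rhoZ G P z * |G.gHat (mom G P k)| / ‖mom G P k‖ ^ 2
      ≤ (3 / 2 * G.ρ) * G.gHat 0 / (P.KH ^ 2 / ell G P ^ 2) := by
        gcongr
        exact rhoZ_le hz
    _ = 3 / 2 * ((ell G P ^ 2 * G.ρ * G.gHat 0) / P.KH ^ 2) := by field_simp
    _ = _ := by rw [h.ell_sq]

omit h hG hd hz in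
lemma Dk_eq {k : Mode d} (hk : 0 < ‖mom G P k‖) : Dk G P z k = ‖mom G P k‖ ^ 2
    * Real.sqrt (1 + 2 * (rhoZ G P z * G.gHat (mom G P k) / ‖mom G P k‖ ^ 2)) := by
  rw [Dk, show ‖mom G P k‖ ^ 4 + 2 * ‖mom G P k‖ ^ 2 * rhoZ G P z * G.gHat (mom G P k)
      = (‖mom G P k‖ ^ 2) ^ 2 * (1 + 2 * (rhoZ G P z * G.gHat (mom G P k) / ‖mom G P k‖ ^ 2)) by
    field_simp, Real.sqrt_mul (by positivity), Real.sqrt_sq (by positivity)]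

lemma le_Dk {k : Mode d} (hk : k ∈ PH G P) : ‖mom G P k‖ ^ 2 / 2 ≤ Dk G P z k := by
  have ht := (h.abs_ratio_le hG hd hz hk).trans h.Kell_div_le
  have hs := (sqrt_one_add_two_mul_bounds ht).1
  rw [Dk_eq (h.norm_mom_pos hk)]
  set t := rhoZ G P z * G.gHat (mom G P k) / ‖mom G P k‖ ^ 2
  have : 1 / 2 ≤ Real.sqrt (1 + 2 * t) := by nlinarith [abs_le.1 ht]
  nlinarith [sq_nonneg ‖mom G P k‖]

lemma Dk_le {k : Mode d} (hk : k ∈ PH G P) : Dk G P z k ≤ 2 * ‖mom G P k‖ ^ 2 := by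
  have ht := (h.abs_ratio_le hG hd hz hk).trans h.Kell_div_le
  have hs := (sqrt_one_add_two_mul_bounds ht).2
  rw [Dk_eq (h.norm_mom_pos hk)]
  set t := rhoZ G P z * G.gHat (mom G P k) / ‖mom G P k‖ ^ 2
  have : Real.sqrt (1 + 2 * t) ≤ 2 := by linarith [abs_le.1 ht]
  nlinarith [sq_nonneg ‖mom G P k‖]

lemma Dk_pos {k : Mode d} (hk : k ∈ PH G P) : 0 < Dk G P z k := by
  have h1 := h.le_Dk hG hd hz hk
  have h2 := h.norm_mom_pos hk
  have : 0 < ‖mom G P k‖ ^ 2 / 2 := by positivity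
  linarith

/-- With `t = ρ_z ĝ(k)/k²`, `|t| ≤ 1/4`, one has `√(1 + 2t) (1 + 2|t|) ≥ 1`; the constant `3` is
twice the `3/2` in the bound on `|t|`. Keeping the leading coefficient equal to `1` is essential for
the cancellation with the exchange energy. -/
lemma inv_Dk_le {k : Mode d} (hk : k ∈ PH G P) :
    (Dk G P z k)⁻¹ ≤ (1 + 3 * (P.Kell ^ 2 / P.KH ^ 2)) / ‖mom G P k‖ ^ 2 := by
  have ht' := h.abs_ratio_le hG hd hz hk
  have ht := ht'.trans h.Kell_div_le
  have hs := (sqrt_one_add_two_mul_bounds ht).1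
  have hk0 := h.norm_mom_pos hk
  have hD := h.Dk_pos hG hd hz hk
  rw [inv_le_comm₀ hD (by positivity), inv_div, div_le_iff₀ (by positivity), Dk_eq hk0]
  set t := rhoZ G P z * G.gHat (mom G P k) / ‖mom G P k‖ ^ 2
  have h1 : 1 - |t| - |t| ^ 2 ≤ Real.sqrt (1 + 2 * t) := by
    rw [sq_abs]; linarith [neg_abs_le t]
  have h2 : 1 ≤ Real.sqrt (1 + 2 * t) * (1 + 2 * |t|) := by
    have ha := abs_nonneg t
    have : 0 ≤ |t| * (1 - 3 * |t| - 2 * |t| ^ 2) := mul_nonneg ha (by nlinarith)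
    nlinarith
  have h3 : 1 ≤ Real.sqrt (1 + 2 * t) * (1 + 3 * (P.Kell ^ 2 / P.KH ^ 2)) :=
    h2.trans (mul_le_mul_of_nonneg_left (by linarith) (Real.sqrt_nonneg _))
  rw [mul_assoc]
  exact le_mul_of_one_le_right (by positivity) h3

/-- In terms of `t = ρ_z ĝ(k)/k²`, `α_k = (1 + t - √(1 + 2t)) / t`, and the numerator lies between
`0` and `t²`. -/
lemma abs_alphaK_le {k : Mode d} (hk : k ∈ PH G P) :
    |alphaK G P z k| ≤ |rhoZ G P z * G.gHat (mom G P k) / ‖mom G P k‖ ^ 2| := by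
  have ht := (h.abs_ratio_le hG hd hz hk).trans h.Kell_div_le
  obtain ⟨hs1, hs2⟩ := sqrt_one_add_two_mul_bounds ht
  have hk0 := h.norm_mom_pos hk
  have e : alphaK G P z k = (1 + rhoZ G P z * G.gHat (mom G P k) / ‖mom G P k‖ ^ 2
      - Real.sqrt (1 + 2 * (rhoZ G P z * G.gHat (mom G P k) / ‖mom G P k‖ ^ 2)))
      / (rhoZ G P z * G.gHat (mom G P k) / ‖mom G P k‖ ^ 2) := by
    rw [alphaK, Dk_eq hk0]
    field_simp
  rw [e]
  set t := rhoZ G P z * G.gHat (mom G P k) / ‖mom G P k‖ ^ 2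
  rcases eq_or_ne t 0 with h0 | h0
  · simp [h0]
  · rw [abs_div, div_le_iff₀ (abs_pos.2 h0), abs_mul_abs_self, abs_of_nonneg (by linarith)]
    nlinarith

end DiluteRegime

end Coefficients

/-! ### Regularity of the state -/

section Forms

variable {d : ℕ}

lemma formSummable_of_hasSum {ι : Type} {X : ι → Op d} {Φ : Config d → ℂ} {f : ι → ℝ}
    (h : ∀ i, HasSum (fun n => conj (Φ n) * X i Φ n) ((f i : ℝ) : ℂ)) (hf : Summable f) :
    FormSummable X Φ ∧ formSum X Φ = ∑' i, f i := by
  have e : (fun i => expect (X i) Φ) = fun i => ((f i : ℝ) : ℂ) := funext fun i => (h i).tsum_eq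
  refine ⟨⟨fun i => (h i).summable, ?_⟩, ?_⟩
  · rw [e]; exact Complex.summable_ofReal.2 hf
  · rw [formSum, e, ← Complex.ofReal_tsum, Complex.ofReal_re]

lemma sum_le_tsum_subtype {ι : Type*} {s : Set ι} {S : Finset ι} (hS : ∀ p ∈ S, p ∈ s) {f : ι → ℝ}
    (h0 : ∀ p ∈ s, 0 ≤ f p) (hf : Summable fun k : s => f k) :
    ∑ p ∈ S, f p ≤ ∑' k : s, f k := by
  rw [tsum_subtype s f]
  have hf' : Summable (s.indicator f) := summable_subtype_iff_indicator.1 hf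
  refine le_trans (le_of_eq ?_) (hf'.sum_le_tsum S fun p _ => Set.indicator_nonneg h0 p)
  exact Finset.sum_congr rfl fun p hp => (Set.indicator_of_mem (hS p hp) f).symm

lemma annih_zero_of_excitation {Φ : Fock d} (hΦ : Φ ∈ excitationFock d) :
    annih (0 : Mode d) (Φ : Config d → ℂ) = 0 := by
  funext n
  have := hΦ (n + Finsupp.single 0 1) (by simp)
  rw [annih_apply, this, mul_zero]; rfl

variable {G : BoseGas d} {P : Params} {E : ℝ}

lemma DiluteRegime.memlp_annih (h : DiluteRegime G P E) {Φ : Fock d}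
    (hΦ : Φ ∈ excitationFock d) (hkin : FormSummable (kinetic G P) Φ) (k : Mode d) :
    Memℓp (annih k (Φ : Config d → ℂ)) 2 := by
  rcases eq_or_ne k 0 with rfl | hk
  · rw [annih_zero_of_excitation hΦ]; exact zero_memℓp
  · have hp := h.norm_mom_pos_iff.2 hk
    rw [memlp_annih_iff]
    have h1 := (hkin.1 k).mul_left (((‖mom G P k‖ ^ 2 : ℝ) : ℂ)⁻¹)
    rw [← Complex.summable_ofReal]
    refine h1.congr fun n => ?_
    have hne : ((‖mom G P k‖ ^ 2 : ℝ) : ℂ) ≠ 0 := by exact_mod_cast (by positivity)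
    change _ * (conj (Φ n) * (((‖mom G P k‖ ^ 2 : ℝ) : ℂ) * creat k (annih k Φ) n)) = _
    rw [creat_annih_apply]
    have : (((n k : ℝ) * ‖Φ n‖ ^ 2 : ℝ) : ℂ) = (n k : ℂ) * (conj (Φ n) * Φ n) := by
      rw [Complex.conj_mul']; push_cast; ring
    rw [this]
    field_simp

lemma DiluteRegime.summable_kinetic (h : DiluteRegime G P E) {Φ : Fock d}
    (hΦ : Φ ∈ excitationFock d) (hkin : FormSummable (kinetic G P) Φ) :
    Summable fun k => ‖mom G P k‖ ^ 2 * nsq (annih k (Φ : Config d → ℂ)) := by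
  rw [← Complex.summable_ofReal]
  refine hkin.2.congr fun k => ?_
  exact (hasSum_number (h.memlp_annih hΦ hkin k) (‖mom G P k‖ ^ 2)).tsum_eq

/-- Nonzero momenta on the torus have length at least `2π/ℓ`, so the kinetic energy controls the
particle number. -/
lemma DiluteRegime.summable_number (h : DiluteRegime G P E) {Φ : Fock d}
    (hΦ : Φ ∈ excitationFock d) (hkin : FormSummable (kinetic G P) Φ) :
    Summable fun k => nsq (annih k (Φ : Config d → ℂ)) := by
  have hc : 0 < 2 * Real.pi / ell G P := div_pos (by positivity) h.ell_pos
  refine Summable.of_nonneg_of_le (fun k => nsq_nonneg _) (fun k => ?_)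
    ((h.summable_kinetic hΦ hkin).mul_left ((2 * Real.pi / ell G P) ^ 2)⁻¹)
  rcases eq_or_ne k 0 with rfl | hk
  · rw [annih_zero_of_excitation hΦ]; simp [nsq]
  · have h1 := pow_le_pow_left₀ hc.le (h.norm_mom_ge hk) 2
    rw [← mul_assoc]
    refine le_mul_of_one_le_left (nsq_nonneg _) ?_
    rw [inv_mul_eq_div, one_le_div (by positivity)]
    exact h1

/-- Since `K_L < K_H`, every momentum of `𝒫_L` is counted by `n_+^L`, so the spectral projection
bounds the number of particles in `𝒫_L` by `𝓜`. -/
lemma DiluteRegime.lowState (h : DiluteRegime G P E) {Φ : Fock d}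
    (hΦ : Φ ∈ excitationFock d) (hkin : FormSummable (kinetic G P) Φ)
    (hlow : (Φ : Config d → ℂ) = lowProj G P P.M Φ) {S : Finset (Mode d)}
    (hS : (S : Set (Mode d)) = PL G P) : LowState (Φ : Config d → ℂ) S P.M := by
  refine ⟨Φ.2, h.memlp_annih hΦ hkin, fun n hn => ?_⟩
  have h1 : (numLow G P n : ℝ) ≤ P.M := by
    by_contra hcon
    refine hn ?_
    rw [hlow]
    exact if_neg hcon
  refine le_trans ?_ h1
  have hmem : ∀ p ∈ S, 0 < ‖mom G P p‖ ∧ ‖mom G P p‖ < P.KH / ell G P := fun p hp => by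
    have : p ∈ PL G P := by rw [← hS]; exact hp
    refine ⟨this.1, this.2.trans_lt ?_⟩
    have h2 := h.ell_pos
    have h3 := h.KH_ge
    have h4 := h.KL_ge
    gcongr
    linarith
  have h2 : ∑ p ∈ S, n p ≤ numLow G P n := by
    classical
    rw [numLow, Finsupp.sum]
    have e : ∑ p ∈ S, n p = ∑ p ∈ S ∩ n.support, n p := by
      refine (Finset.sum_subset Finset.inter_subset_left fun p hp hp' => ?_).symm
      by_contra h0
      exact hp' (Finset.mem_inter.2 ⟨hp, Finsupp.mem_support_iff.2 h0⟩)
    rw [e]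
    calc ∑ p ∈ S ∩ n.support, n p = ∑ p ∈ S ∩ n.support,
          if 0 < ‖mom G P p‖ ∧ ‖mom G P p‖ < P.KH / ell G P then n p else 0 :=
        Finset.sum_congr rfl fun p hp => (if_pos (hmem p (Finset.mem_inter.1 hp).1)).symm
      _ ≤ _ := by
        refine (Finset.sum_le_sum_of_subset Finset.inter_subset_right).trans (le_of_eq ?_)
        refine Finset.sum_congr rfl fun p _ => ?_
        congr
  exact_mod_cast h2

end Forms

/-! ### Bounds on the individual terms -/

section Bound

variable {d : ℕ} {G : BoseGas d} {P : Params} {E : ℝ}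

namespace DiluteRegime

variable (h : DiluteRegime G P E)

include h

lemma summable_ratio : Summable fun k : PH G P => G.gHat (mom G P k.1) ^ 2 / ‖mom G P k.1‖ ^ 2 :=
  h.summable.subtype (PH G P)

variable {z : ℂ} (hG : G.Admissible) (hd : d = 2 ∨ d = 3) (hz : |rhoZ G P z - G.ρ| ≤ G.ρ / 2)

include hG hd hz

lemma alphaK_sq_le {k : Mode d} (hk : k ∈ PH G P) : alphaK G P z k ^ 2 ≤ 1 / 2 := by
  have := (h.abs_alphaK_le hG hd hz hk).trans ((h.abs_ratio_le hG hd hz hk).trans h.Kell_div_le)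
  nlinarith [abs_le.1 this]

lemma sq_div_Dk_le {k : Mode d} (hk : k ∈ PH G P) :
    (G.gHat (mom G P k) / vol G P) ^ 2 / Dk G P z k
      ≤ (vol G P ^ 2)⁻¹ * (1 + 3 * (P.Kell ^ 2 / P.KH ^ 2))
        * (G.gHat (mom G P k) ^ 2 / ‖mom G P k‖ ^ 2) := by
  have h1 := mul_le_mul_of_nonneg_left (h.inv_Dk_le hG hd hz hk)
    (sq_nonneg (G.gHat (mom G P k) / vol G P))
  rw [← div_eq_mul_inv] at h1
  refine h1.trans_eq ?_
  rw [div_pow]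
  ring

lemma summable_sq_div_Dk :
    Summable fun k : PH G P => (G.gHat (mom G P k.1) / vol G P) ^ 2 / Dk G P z k.1 :=
  Summable.of_nonneg_of_le
    (fun k => div_nonneg (sq_nonneg _) (h.Dk_pos hG hd hz k.2).le)
    (fun k => h.sq_div_Dk_le hG hd hz k.2) (h.summable_ratio.mul_left _)

/-- The second order energy of the high momenta. -/
lemma tsum_sq_div_Dk_le :
    ‖z‖ ^ 2 * ∑' k : PH G P, (G.gHat (mom G P k.1) / vol G P) ^ 2 / Dk G P z k.1
      ≤ rhoZ G P z * (2 * G.gωHat 0 + 4 * E + 6 * (P.Kell ^ 2 / P.KH ^ 2) * G.gHat 0) := by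
  have hv := h.vol_pos
  have hρz := rhoZ_pos hG hz
  have hu := h.Kell_div_le
  have hu0 : 0 ≤ P.Kell ^ 2 / P.KH ^ 2 := by positivity
  set u := P.Kell ^ 2 / P.KH ^ 2
  set T := ∑' m : Mode d, G.gHat (mom G P m) ^ 2 / ‖mom G P m‖ ^ 2
  have h1 : ∑' k : PH G P, (G.gHat (mom G P k.1) / vol G P) ^ 2 / Dk G P z k.1
      ≤ (vol G P ^ 2)⁻¹ * (1 + 3 * u) * T := by
    refine ((h.summable_sq_div_Dk hG hd hz).tsum_le_tsum
      (fun k => h.sq_div_Dk_le hG hd hz k.2) (h.summable_ratio.mul_left _)).trans ?_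
    rw [tsum_mul_left]
    refine mul_le_mul_of_nonneg_left ?_ (by positivity)
    exact h.summable.tsum_subtype_le _ (PH G P) fun m => by positivity
  have e : ‖z‖ ^ 2 = rhoZ G P z * vol G P := by rw [rhoZ]; field_simp
  have h3 := h.sum_le
  have h4 := hG.gωHat_zero_le hd h.R_lt
  have h5 := h.E_nonneg
  calc _ ≤ ‖z‖ ^ 2 * ((vol G P ^ 2)⁻¹ * (1 + 3 * u) * T) :=
        mul_le_mul_of_nonneg_left h1 (sq_nonneg _)
    _ = rhoZ G P z * ((1 + 3 * u) * ((vol G P)⁻¹ * T)) := by rw [e]; field_simp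
    _ ≤ rhoZ G P z * ((1 + 3 * u) * (2 * (G.gωHat 0 + E))) := by gcongr
    -- With `u = K_ℓ²/K_H²`, `3u ≤ 1/2` yields `4E`, and `(gω)^(0) ≤ ĝ(0)` turns the correction `6u
    -- (gω)^(0)` into `6u ĝ(0)`.
    _ ≤ _ := by
      refine mul_le_mul_of_nonneg_left ?_ hρz.le
      nlinarith

omit hd in
/-- The number of high excitations enters with a coefficient below the gap. -/
lemma high_coefficient_le {q : ℝ} (hq0 : 0 ≤ q) (hq : q ≤ P.KL ^ d) :
    (P.Kell ^ 2 / (2 * ell G P ^ 2 * P.KL ^ d) / 2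
        + (G.gHat 0 / vol G P) ^ 2 * ‖z‖ ^ 2 / (P.KH ^ 2 / ell G P ^ 2 / 2) * P.M) * q
      + (2 * (3 / 2 * (P.Kell ^ 2 / P.KH ^ 2)) * (G.gHat 0 / vol G P) * ‖z‖) ^ 2 * P.M
        / (P.Kell ^ 2 / (2 * ell G P ^ 2 * P.KL ^ d)) / 2
      ≤ P.Kell ^ 2 / ell G P ^ 2 := by
  have hv := h.vol_pos
  have hℓ := h.ell_pos
  have hKL : 0 < P.KL := by linarith [h.KL_ge]
  have hK : 0 < P.Kell := by linarith [h.Kell_ge]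
  have hKH := h.KH_pos
  have hM := h.M_pos
  have hρz := rhoZ_pos hG hz
  have hρz' := rhoZ_le hz
  have hρ := hG.ρ_pos
  have e : ‖z‖ ^ 2 = rhoZ G P z * vol G P := by rw [rhoZ]; field_simp
  have hu := h.Kell_div_le
  -- `B` is the quantity controlled by `DiluteRegime.quartic`. In units of `K_ℓ²/ℓ²`, the Young
  -- weight contributes `1/4` and the other two terms at most `3B ≤ 3/32` each, in total less than
  -- `1`.
  set B := G.ρ * G.gHat 0 ^ 2 * ell G P ^ 2 / vol G P / P.KH ^ 2 * P.KL ^ d * P.M with hB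
  have hB0 : 0 ≤ B := by positivity
  have hquart := h.quartic
  rw [← hB] at hquart
  have b1 : P.Kell ^ 2 / (2 * ell G P ^ 2 * P.KL ^ d) / 2 * q ≤ P.Kell ^ 2 / ell G P ^ 2 / 4 := by
    calc _ ≤ P.Kell ^ 2 / (2 * ell G P ^ 2 * P.KL ^ d) / 2 * P.KL ^ d := by gcongr
      _ = _ := by field_simp; norm_num
  have b2 : (G.gHat 0 / vol G P) ^ 2 * ‖z‖ ^ 2 / (P.KH ^ 2 / ell G P ^ 2 / 2) * P.M * q
      ≤ 3 * B := by
    rw [e]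
    calc _ ≤ (G.gHat 0 / vol G P) ^ 2 * (3 / 2 * G.ρ * vol G P) / (P.KH ^ 2 / ell G P ^ 2 / 2)
          * P.M * P.KL ^ d := by gcongr
      _ = 3 * B := by rw [hB]; field_simp
  have b3 : (2 * (3 / 2 * (P.Kell ^ 2 / P.KH ^ 2)) * (G.gHat 0 / vol G P) * ‖z‖) ^ 2 * P.M
        / (P.Kell ^ 2 / (2 * ell G P ^ 2 * P.KL ^ d)) / 2 ≤ 3 * B := by
    rw [mul_pow _ ‖z‖, e]
    calc _ ≤ (2 * (3 / 2 * (P.Kell ^ 2 / P.KH ^ 2)) * (G.gHat 0 / vol G P)) ^ 2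
          * (3 / 2 * G.ρ * vol G P) * P.M / (P.Kell ^ 2 / (2 * ell G P ^ 2 * P.KL ^ d)) / 2 := by
          gcongr
      _ = 27 / 2 * (P.Kell ^ 2 / P.KH ^ 2) * B := by rw [hB]; field_simp; ring
      _ ≤ 3 * B := by nlinarith
  have hquart' : P.Kell ^ 2 / (32 * ell G P ^ 2) = P.Kell ^ 2 / ell G P ^ 2 / 32 := by
    field_simp
  have hpos : 0 ≤ P.Kell ^ 2 / ell G P ^ 2 := by positivity
  rw [add_mul]
  linarith

variable {Φ : Fock d} (hΦ : Φ ∈ excitationFock d) (hkin : FormSummable (kinetic G P) Φ)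

include hΦ hkin

omit hG hd hz in
lemma hasSum_nPlus : FormSummable (nPlus d) Φ ∧
    formSum (nPlus d) Φ = ∑' k : {k : Mode d // k ≠ 0}, nsq (annih k.1 (Φ : Config d → ℂ)) := by
  refine formSummable_of_hasSum (fun k => ?_) ((h.summable_number hΦ hkin).subtype {k | k ≠ 0})
  have := hasSum_number (h.memlp_annih hΦ hkin k.1) 1
  simpa [nPlus] using this

omit hG hd hz in
lemma hasSum_nPlusH : FormSummable (nPlusH G P) Φ ∧
    formSum (nPlusH G P) Φ = ∑' k : {k : Mode d // P.KL / ell G P < ‖mom G P k‖},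
      nsq (annih k.1 (Φ : Config d → ℂ)) := by
  refine formSummable_of_hasSum (fun k => ?_)
    ((h.summable_number hΦ hkin).subtype {k | P.KL / ell G P < ‖mom G P k‖})
  have := hasSum_number (h.memlp_annih hΦ hkin k.1) 1
  simpa [nPlusH] using this

omit hz in
lemma hasSum_Q2ex : FormSummable (Q2ex G P z) Φ ∧
    formSum (Q2ex G P z) Φ = ∑' k : {k : Mode d // k ≠ 0},
      rhoZ G P z * (G.gωHat (mom G P k.1) + G.gωHat 0) * nsq (annih k.1 (Φ : Config d → ℂ)) := by
  refine formSummable_of_hasSum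
    (fun k => hasSum_number (h.memlp_annih hΦ hkin k.1) _) ?_
  have hs := (h.summable_number hΦ hkin).mul_left (rhoZ G P z * (G.gωHat 0 + G.gωHat 0))
  have hρz : 0 ≤ rhoZ G P z := div_nonneg (sq_nonneg _) h.vol_pos.le
  refine Summable.of_nonneg_of_le (fun k => ?_) (fun k => ?_) (hs.subtype {k | k ≠ 0})
  · have := abs_le.1 (hG.abs_gωHat_le hd h.R_lt (mom G P k.1))
    exact mul_nonneg (mul_nonneg hρz (by linarith [this.1])) (nsq_nonneg _)
  · have := abs_le.1 (hG.abs_gωHat_le hd h.R_lt (mom G P k.1))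
    refine mul_le_mul_of_nonneg_right (mul_le_mul_of_nonneg_left ?_ hρz) (nsq_nonneg _)
    linarith [this.2]

/-- The exchange energy of the low excitations. -/
lemma le_formSum_Q2ex {S : Finset (Mode d)} (hS : (S : Set (Mode d)) = PL G P) :
    rhoZ G P z * (2 * G.gωHat 0 - P.KL / ell G P * G.R * G.gHat 0)
      * ∑ p ∈ S, nsq (annih p (Φ : Config d → ℂ)) ≤ formSum (Q2ex G P z) Φ := by
  obtain ⟨h1, h2⟩ := h.hasSum_Q2ex hG hd (z := z) hΦ hkin
  have hρz := rhoZ_pos hG hz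
  have hmem : ∀ p ∈ S, p ∈ PL G P := fun p hp => by rw [← hS]; exact hp
  have hsum : Summable fun k : {k : Mode d | k ≠ 0} =>
      rhoZ G P z * (G.gωHat (mom G P k.1) + G.gωHat 0) * nsq (annih k.1 (Φ : Config d → ℂ)) := by
    refine Complex.summable_ofReal.1 (h1.2.congr fun k => ?_)
    exact (hasSum_number (h.memlp_annih hΦ hkin k.1) _).tsum_eq
  rw [h2]
  refine le_trans ?_ (sum_le_tsum_subtype (s := {k | k ≠ 0}) (S := S)
    (fun p hp => h.norm_mom_pos_iff.1 (hmem p hp).1)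
    (f := fun k => rhoZ G P z * (G.gωHat (mom G P k) + G.gωHat 0)
      * nsq (annih k (Φ : Config d → ℂ))) (fun k _ => ?_) hsum)
  · rw [Finset.mul_sum]
    refine Finset.sum_le_sum fun p hp => ?_
    refine mul_le_mul_of_nonneg_right (mul_le_mul_of_nonneg_left ?_ hρz.le) (nsq_nonneg _)
    have e1 := hG.gωHat_zero_sub_le hd h.R_lt (mom G P p)
    have e2 : ‖mom G P p‖ * G.R * G.gHat 0 ≤ P.KL / ell G P * G.R * G.gHat 0 := by
      have := hG.R_pos
      have := h.gHat_pos
      gcongr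
      exact (hmem p hp).2
    linarith
  · have := abs_le.1 (hG.abs_gωHat_le hd h.R_lt (mom G P k))
    exact mul_nonneg (mul_nonneg hρz.le (by linarith [this.1])) (nsq_nonneg _)

lemma hasSum_KHdiag {S : Finset (Mode d)} (hL : LowState (Φ : Config d → ℂ) S P.M) :
    (Summable fun k : PH G P => Dk G P z k.1 / (1 - alphaK G P z k.1 ^ 2)
      * nsq (annih k.1 (Φ : Config d → ℂ) + (alphaK G P z k.1 : ℂ) • creat (-k.1) Φ)) ∧
    FormSummable (KHdiag G P z) Φ ∧
    formSum (KHdiag G P z) Φ = ∑' k : PH G P, Dk G P z k.1 / (1 - alphaK G P z k.1 ^ 2)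
      * nsq (annih k.1 (Φ : Config d → ℂ) + (alphaK G P z k.1 : ℂ) • creat (-k.1) Φ) := by
  have hk := h.summable_kinetic hΦ hkin
  have hk' : Summable fun k => ‖mom G P k‖ ^ 2 * nsq (annih (-k) (Φ : Config d → ℂ)) := by
    have := (Equiv.neg (Mode d)).summable_iff.2 hk
    refine this.congr fun k => ?_
    simp [mom_neg]
  have hs : Summable fun k : PH G P => Dk G P z k.1 / (1 - alphaK G P z k.1 ^ 2)
      * nsq (annih k.1 (Φ : Config d → ℂ) + (alphaK G P z k.1 : ℂ) • creat (-k.1) Φ) := by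
    refine hL.summable_diag (PH G P) (alphaK G P z) (Dk G P z)
      (fun k hk => h.Dk_pos hG hd hz hk) (fun k hk => h.alphaK_sq_le hG hd hz hk) ?_ ?_ ?_
    · refine Summable.of_nonneg_of_le
        (fun k => mul_nonneg (h.Dk_pos hG hd hz k.2).le (nsq_nonneg _)) (fun k => ?_)
        ((hk.mul_left 2).subtype (PH G P))
      simp only [Function.comp, ← mul_assoc]
      exact mul_le_mul_of_nonneg_right (h.Dk_le hG hd hz k.2) (nsq_nonneg _)
    · refine Summable.of_nonneg_of_le
        (fun k => mul_nonneg (h.Dk_pos hG hd hz k.2).le (nsq_nonneg _)) (fun k => ?_)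
        ((hk'.mul_left 2).subtype (PH G P))
      simp only [Function.comp, ← mul_assoc]
      exact mul_le_mul_of_nonneg_right (h.Dk_le hG hd hz k.2) (nsq_nonneg _)
    -- The constant part of `⟨b_k† b_k⟩` needs `∑ 𝒟_k α_k² < ∞`: as `α_k` is of order `ρ_z ĝ(k)/k²`,
    -- this is again the convergent sum of `ĝ(k)²/k²`.
    · refine Summable.of_nonneg_of_le
        (fun k => mul_nonneg (h.Dk_pos hG hd hz k.2).le (sq_nonneg _)) (fun k => ?_)
        (h.summable_ratio.mul_left (2 * rhoZ G P z ^ 2))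
      have hp := h.norm_mom_pos k.2
      have h1 : alphaK G P z k.1 ^ 2
          ≤ (rhoZ G P z * G.gHat (mom G P k.1) / ‖mom G P k.1‖ ^ 2) ^ 2 :=
        sq_le_sq.2 (h.abs_alphaK_le hG hd hz k.2)
      calc _ ≤ 2 * ‖mom G P k.1‖ ^ 2
            * (rhoZ G P z * G.gHat (mom G P k.1) / ‖mom G P k.1‖ ^ 2) ^ 2 := by
            gcongr
            exact h.Dk_le hG hd hz k.2
        _ = _ := by field_simp
  refine ⟨hs, formSummable_of_hasSum (fun k => ?_) hs⟩
  exact hL.hasSum_diag k.1 (Dk G P z k.1)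
    (by linarith [h.alphaK_sq_le hG hd hz k.2])

omit hG hd hz in
lemma hasSum_Q3soft {S : Finset (Mode d)} (hL : LowState (Φ : Config d → ℂ) S P.M)
    (hS : (S : Set (Mode d)) = PL G P) :
    (Summable fun q : PH G P × S => 2 * (G.gHat (mom G P q.1.1) / vol G P)
      * (z * pairAmp Φ q.1.1 q.2.1).re) ∧
    FormSummable (Q3soft G P z) Φ ∧
    formSum (Q3soft G P z) Φ = ∑' q : PH G P × S, 2 * (G.gHat (mom G P q.1.1) / vol G P)
      * (z * pairAmp Φ q.1.1 q.2.1).re := by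
  have hs : Summable fun q : PH G P × S => 2 * (G.gHat (mom G P q.1.1) / vol G P)
      * (z * pairAmp Φ q.1.1 q.2.1).re := by
    refine hL.summable_cubic h.M_pos.le (h.summable_number hΦ hkin) (PH G P)
      (fun k => G.gHat (mom G P k) / vol G P) z ?_
    refine Summable.of_nonneg_of_le (fun k => by positivity) (fun k => ?_)
      ((h.summable_ratio.mul_left (vol G P ^ 2)⁻¹).add
        ((h.summable_kinetic hΦ hkin).subtype (PH G P)))
    have hp := h.norm_mom_pos k.2
    have hv := h.vol_pos
    have hν := nsq_nonneg (annih k.1 (Φ : Config d → ℂ))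
    simp only [Function.comp]
    set q := ‖mom G P k.1‖
    set w := G.gHat (mom G P k.1) / vol G P with hw
    set r := Real.sqrt (nsq (annih k.1 (Φ : Config d → ℂ))) with hr
    have e1 : nsq (annih k.1 (Φ : Config d → ℂ)) = r ^ 2 := (Real.sq_sqrt hν).symm
    have e2 : (vol G P ^ 2)⁻¹ * (G.gHat (mom G P k.1) ^ 2 / q ^ 2) = (|w| / q) ^ 2 := by
      rw [div_pow, sq_abs, hw]; field_simp
    -- Weighting with `q = |k|` splits the product between `∑ ĝ(k)²/k²` and the kinetic energy, both
    -- finite.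
    have e3 : |w| * r = (|w| / q) * (q * r) := by field_simp
    rw [e1, e2, e3]
    nlinarith [sq_nonneg (|w| / q - q * r), sq_nonneg (|w| / q), sq_nonneg (q * r)]
  let e : PH G P × S ≃ PH G P × PL G P := Equiv.prodCongr (Equiv.refl _) (Equiv.setCongr hS)
  have hf := formSummable_of_hasSum (X := Q3soft G P z) (Φ := (Φ : Config d → ℂ))
    (f := fun q => 2 * (G.gHat (mom G P q.1.1) / vol G P) * (z * pairAmp Φ q.1.1 q.2.1).re)
    (fun q => hL.hasSum_cubic q.1.1
      (by have : q.2.1 ∈ (S : Set (Mode d)) := by rw [hS]; exact q.2.2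
          exact this) _ z) (e.summable_iff.1 hs)
  exact ⟨hs, hf.1, hf.2.trans (e.tsum_eq _).symm⟩

end DiluteRegime

end Bound

/-! ### Cancellation and conclusion -/

section Main

variable {d : ℕ} {G : BoseGas d} {P : Params} {E : ℝ} {z : ℂ} {Φ : Fock d}

/-- The cubic and diagonal terms, bounded below by completing squares. -/
lemma DiluteRegime.le_formSum_soft_pairs (h : DiluteRegime G P E) (hG : G.Admissible)
    (hd : d = 2 ∨ d = 3) (hz : |rhoZ G P z - G.ρ| ≤ G.ρ / 2) (hΦ : Φ ∈ excitationFock d)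
    (hkin : FormSummable (kinetic G P) Φ) {S : Finset (Mode d)}
    (hS : (S : Set (Mode d)) = PL G P) (hcard : (S.card : ℝ) ≤ P.KL ^ d)
    (hL : LowState (Φ : Config d → ℂ) S P.M) :
    -(rhoZ G P z * (2 * G.gωHat 0 + 4 * E + 6 * (P.Kell ^ 2 / P.KH ^ 2) * G.gHat 0)
        * ∑ p ∈ S, nsq (annih p (Φ : Config d → ℂ)))
      - P.Kell ^ 2 / ell G P ^ 2 * formSum (nPlusH G P) Φ
      ≤ formSum (Q3soft G P z) Φ + formSum (KHdiag G P z) Φ := by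
  obtain ⟨hcub, -, h3⟩ := h.hasSum_Q3soft (z := z) hΦ hkin hL hS
  obtain ⟨hdiag, -, h4⟩ := h.hasSum_KHdiag hG hd hz hΦ hkin hL
  have hv := h.vol_pos
  have hℓ := h.ell_pos
  have hKL : 0 < P.KL := by linarith [h.KL_ge]
  have hK : 0 < P.Kell := by linarith [h.Kell_ge]
  have hKH := h.KH_pos
  have hg := h.gHat_pos
  -- From `K_H ≥ 4K_L`: momenta `p - k` with `k` high and `p` low still exceed `K_L/ℓ`, hence are
  -- counted by `n_+^H`.
  have hgap : P.KL / ell G P < P.KH / ell G P - P.KL / ell G P := by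
    rw [← sub_div]
    gcongr
    linarith [h.KH_ge]
  have hp0 : 0 < P.KL / ell G P := by positivity
  have hw : ∀ k, |G.gHat (mom G P k) / vol G P| ≤ G.gHat 0 / vol G P := fun k => by
    rw [abs_div, abs_of_pos hv]
    gcongr
    exact hG.abs_gHat_le hd _
  have key := hL.sum_soft_pair_lower h.M_pos.le (h.summable_number hΦ hkin)
    (fun h0 => by
      have : (0 : Mode d) ∈ (S : Set (Mode d)) := h0
      rw [hS] at this
      exact h.norm_mom_pos_iff.1 this.1 rfl)
    (PH G P) {k | P.KL / ell G P < ‖mom G P k‖} (fun k => G.gHat (mom G P k) / vol G P)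
    (alphaK G P z) (Dk G P z) z (fun k hk => h.Dk_pos hG hd hz hk)
    (fun k hk => h.alphaK_sq_le hG hd hz hk) hcub hdiag (h.summable_sq_div_Dk hG hd hz)
    (fun k hk => by
      have : P.KH / ell G P ≤ ‖mom G P k‖ := hk
      rw [Set.mem_ofPred_eq, mom_neg, norm_neg]
      linarith)
    (fun k hk p hp => by
      have h1 : P.KH / ell G P ≤ ‖mom G P k‖ := hk
      have h2 : p ∈ PL G P := by rw [← hS]; exact hp
      have h3 := h2.2
      rw [Set.mem_ofPred_eq, mom_sub, norm_sub_rev]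
      linarith [norm_sub_norm_le (mom G P k) (mom G P p)])
    -- `X` and `Y` are suprema over the high momenta. The weight `θ` is chosen so that `θ/2` times
    -- the number of low modes, at most `K_L^d`, is a quarter of `K_ℓ²/ℓ²`.
    (X := 2 * (3 / 2 * (P.Kell ^ 2 / P.KH ^ 2)) * (G.gHat 0 / vol G P) * ‖z‖)
    (Y := (G.gHat 0 / vol G P) ^ 2 * ‖z‖ ^ 2 / (P.KH ^ 2 / ell G P ^ 2 / 2))
    (θ := P.Kell ^ 2 / (2 * ell G P ^ 2 * P.KL ^ d)) (by positivity)
    (fun k hk => by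
      have h1 := (h.abs_alphaK_le hG hd hz hk).trans (h.abs_ratio_le hG hd hz hk)
      have h2 := hw k
      gcongr)
    (fun k hk => by
      have h1 : P.KH ^ 2 / ell G P ^ 2 / 2 ≤ Dk G P z k :=
        le_trans (by linarith [h.sq_le_norm_mom_sq hk]) (h.le_Dk hG hd hz hk)
      have h2 : (G.gHat (mom G P k) / vol G P) ^ 2 ≤ (G.gHat 0 / vol G P) ^ 2 :=
        sq_le_sq.2 ((hw k).trans (le_abs_self _))
      gcongr)
    (by positivity)
  rw [h3, h4]
  refine le_trans ?_ key
  rw [(h.hasSum_nPlusH hΦ hkin).2]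
  have e1 := mul_le_mul_of_nonneg_right (h.tsum_sq_div_Dk_le hG hd hz)
    (Finset.sum_nonneg fun p (_ : p ∈ S) => nsq_nonneg (annih p (Φ : Config d → ℂ)))
  have e2 := mul_le_mul_of_nonneg_right
    (h.high_coefficient_le hG hz (Nat.cast_nonneg S.card) hcard)
    (tsum_nonneg (L := .unconditional _) fun k : {k : Mode d // P.KL / ell G P < ‖mom G P k‖} =>
      nsq_nonneg (annih k.1 (Φ : Config d → ℂ)))
  exact sub_le_sub (neg_le_neg e1) e2

/-- The terms `∓ 2ρ_z (gω)^(0)` per low particle, from the completed squares and from the exchange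
energy, cancel. What is left is `ρ_z W` per low particle, where `W` collects the sum-to-integral
error, the replacement of `𝒟_k` by `k²`, and the variation of `(gω)^` on `𝒫_L`; it is below
`ε_gap/ℓ²`. -/
theorem DiluteRegime.main_bound (h : DiluteRegime G P E) (hG : G.Admissible)
    (hd : d = 2 ∨ d = 3) (hz : |rhoZ G P z - G.ρ| ≤ G.ρ / 2) (hΦ : Φ ∈ excitationFock d)
    (hkin : FormSummable (kinetic G P) Φ) {S : Finset (Mode d)}
    (hS : (S : Set (Mode d)) = PL G P) (hcard : (S.card : ℝ) ≤ P.KL ^ d)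
    (hL : LowState (Φ : Config d → ℂ) S P.M) :
    -(P.εgap * (formSum (nPlus d) Φ / ell G P ^ 2))
      - P.Kell ^ 2 * (formSum (nPlusH G P) Φ / ell G P ^ 2)
      ≤ formSum (Q3soft G P z) Φ + formSum (KHdiag G P z) Φ + formSum (Q2ex G P z) Φ := by
  have h1 := h.le_formSum_soft_pairs hG hd hz hΦ hkin hS hcard hL
  have h2 := h.le_formSum_Q2ex hG hd hz hΦ hkin hS
  set NL := ∑ p ∈ S, nsq (annih p (Φ : Config d → ℂ)) with hNL
  have hNL0 : 0 ≤ NL := Finset.sum_nonneg fun p _ => nsq_nonneg _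
  have hN : NL ≤ formSum (nPlus d) Φ := by
    rw [(h.hasSum_nPlus hΦ hkin).2]
    refine sum_le_tsum_subtype (s := {k | k ≠ 0}) (fun p hp => ?_) (fun _ _ => nsq_nonneg _)
      ((h.summable_number hΦ hkin).subtype _)
    have : p ∈ PL G P := by rw [← hS]; exact hp
    exact h.norm_mom_pos_iff.1 this.1
  have hℓ := h.ell_pos
  have hE := h.E_nonneg
  have hg := h.gHat_pos
  have hR := hG.R_pos
  have hKL : 0 < P.KL := by linarith [h.KL_ge]
  set W := 4 * E + 6 * (P.Kell ^ 2 / P.KH ^ 2) * G.gHat 0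
    + P.KL / ell G P * G.R * G.gHat 0 with hW
  have hW0 : 0 ≤ W := by positivity
  have h3 : rhoZ G P z * W ≤ P.εgap / ell G P ^ 2 :=
    (mul_le_mul_of_nonneg_right (rhoZ_le hz) hW0).trans h.gap
  have h4 : rhoZ G P z * W * NL ≤ P.εgap / ell G P ^ 2 * formSum (nPlus d) Φ := by
    have : 0 ≤ rhoZ G P z * W := mul_nonneg (rhoZ_pos hG hz).le hW0
    exact mul_le_mul h3 hN hNL0 (this.trans h3)
  have e1 : P.εgap * (formSum (nPlus d) Φ / ell G P ^ 2)
      = P.εgap / ell G P ^ 2 * formSum (nPlus d) Φ := by ring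
  have e2 : P.Kell ^ 2 * (formSum (nPlusH G P) Φ / ell G P ^ 2)
      = P.Kell ^ 2 / ell G P ^ 2 * formSum (nPlusH G P) Φ := by ring
  have e3 : -(rhoZ G P z * W * NL)
      = -(rhoZ G P z * (2 * G.gωHat 0 + 4 * E + 6 * (P.Kell ^ 2 / P.KH ^ 2) * G.gHat 0) * NL)
        + rhoZ G P z * (2 * G.gωHat 0 - P.KL / ell G P * G.R * G.gHat 0) * NL := by
    rw [hW]; ring
  rw [e1, e2]
  linarith

lemma lhyError_nonneg (hG : G.Admissible) (hℓ : 0 ≤ ell G P) (η : ℝ) : 0 ≤ lhyError G P η := by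
  have ha := hG.a_pos
  have hρ := hG.ρ_pos
  have hv : 0 ≤ vol G P := pow_nonneg hℓ d
  have hδ := G.delta_nonneg
  unfold lhyError
  split_ifs <;> positivity

end Main

end SoftPairs

end

theorem mainTheorem3 (d : ℕ) (hd : d = 2 ∨ d = 3) (c ζ : ℝ) (hc : 0 < c) (hζ : 0 < ζ) :
    ∃ C η : ℝ, 0 < C ∧ 0 < η ∧
      ∀ (G : BoseGas d) (P : Params),
        G.Admissible → ParamRelations G P c ζ → G.R ≤ ell G P / 4 →
        G.ρ * G.a ^ d ≤ C⁻¹ →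
        ∀ z : ℂ, |rhoZ G P z - G.ρ| ≤ G.ρ / 2 →
        ∀ Φ : Fock d, Φ ∈ excitationFock d → ‖Φ‖ = 1 →
          FormSummable (kinetic G P) Φ →
          (Φ : Config d → ℂ) = lowProj G P P.M Φ →
          FormSummable (Q3soft G P z) Φ ∧ FormSummable (KHdiag G P z) Φ ∧
          FormSummable (Q2ex G P z) Φ ∧ FormSummable (nPlus d) Φ ∧
          FormSummable (nPlusH G P) Φ ∧
          formSum (Q3soft G P z) Φ + formSum (KHdiag G P z) Φ + formSum (Q2ex G P z) Φ
            ≥ -(P.εgap * (formSum (nPlus d) Φ / ell G P ^ 2))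
              - P.Kell ^ 2 * (formSum (nPlusH G P) Φ / ell G P ^ 2)
              - C * lhyError G P η := by
  obtain ⟨C, hC, hmain⟩ := exists_diluteRegime hd hc hζ
  -- The value of `η` is immaterial: the bound already holds without the Lee-Huang-Yang error, which
  -- is nonnegative, so subtracting it only weakens the inequality.
  refine ⟨C, 1, hC, one_pos, fun G P hG hP hR hx z hz Φ hΦ _ hkin hlow => ?_⟩
  obtain ⟨E, h⟩ := hmain G P hG hP hR hx
  obtain ⟨S, hS, hcard⟩ := h.PL_finite_card
  have hL := h.lowState hΦ hkin hlow hS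
  refine ⟨(h.hasSum_Q3soft hΦ hkin hL hS).2.1, (h.hasSum_KHdiag hG hd hz hΦ hkin hL).2.1,
    (h.hasSum_Q2ex hG hd hΦ hkin).1, (h.hasSum_nPlus hΦ hkin).1, (h.hasSum_nPlusH hΦ hkin).1, ?_⟩
  have h1 := h.main_bound hG hd hz hΦ hkin hS hcard hL
  have h2 := mul_nonneg hC.le (lhyError_nonneg hG h.ell_pos.le 1)
  linarith
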